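/- Let $I=(-1,1)$, $\rho_0>0$, $\tau>0$, and $\rho(x)=\rho_0(1-x^2)$. Assume: * $q\in L^\infty(I)$; $r\in C^1([0,\infty))$ with $r,r'$ bounded; * $\beta\in C^2(\mathbb R)$ with $\beta,\beta',\beta''$ bounded; * $\varepsilon\in C^1(\mathbb R)$ with $\varepsilon,\varepsilon'$ bounded, and $\varepsilon(y)\ge\varepsilon_1$ for all $y\in\mathbb R$, for some $\varepsilon_1>0$; * $f\in C^1(\mathbb R)$ with $f,f'$ bounded and Lipschitz continuous; * $k\in C^1([-\tau,0]\times[-1,1])$. Let $V=\{w\in L^2(I): w\in AC_{loc}(I),\ \sqrt\rho\,w_x\in L^2(I)\}$, with the inner product $(u,v)_V=(u,v)_{L^2(I)}+(\sqrt\rho\,u_x,\sqrt\rho\,v_x)_{L^2(I)}$, and let $A$ be the operator in $L^2(I)$ with domain $D(A)=\{u\in V:\rho u_x\in H^1(I)\}$ and $Au=(\rho u_x)_x$ (the no-flux condition $\rho u_x=0$ at $x=\pm1$ is automatic on $D(A)$). Let $e^{tA}$, $t\ge0$, denote the strongly continuous semigroup on $L^2(I)$ with infinitesimal generator $A$. For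 $t\ge 0$, $w\in V$ and $v\in C([-\tau,0];V)$ put $$G(t,w)(x)=r(t)q(x)\beta(w(x))-\varepsilon(w(x))|w(x)|^3w(x),\qquad F(v)(x)=f\Big(\int_{-\tau}^0k(s,x)\,v(s)(x)\,ds\Big).$$ Given $u_0\in C([-\tau,0];V)$ and $T>0$, a function $$u\in H^1(0,T;L^2(I))\cap L^2(0,T;D(A))\cap C([-\tau,T];V)$$ is called a mild solution on $[0,T]$ of the degenerate Sellers model with memory $$u_t-(\rho u_x)_x=r(t)q(x)\beta(u)-\varepsilon(u)|u|^3u+f\Big(\int_{-\tau}^0k(s,x)u(t+s,x)\,ds\Big),\qquad \rho u_x|_{x=\pm1}=0,\qquad u|_{[-\tau,0]}=u_0,$$ if $u(s)=u_0(s)$ for all $s\in[-\tau,0]$ and, writing $u^{(s)}(\sigma)=u(s+\sigma)$ for $\sigma\in[-\tau,0]$, $$u(t)=e^{tA}u_0(0)+\int_0^te^{(t-s)A}\big(G(s,u(s))+F(u^{(s)})\big)\,ds\qquad\text{for all }t\in[0,T].$$ **Theorem.** Let $u_0\in C([-\tau,0];V)$ with $u_0(0)\in D(A)\cap L^\infty(I)$.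 Then for every $T>0$ there is one and only one mild solution $u$ on $[0,T]$. -/

import Mathlib

open MeasureTheory Set Filter Topology
open scoped ENNReal NNReal ContDiff

noncomputable section

namespace SellersEBM

/-- The space domain `I = (-1, 1)`. -/
def I : Set ℝ := Ioo (-1) 1

/-- Lebesgue measure on `I`. -/
abbrev volI : Measure ℝ := volume.restrict I

/-- The real Hilbert space `L²(I)`. -/
abbrev L2I : Type := Lp ℝ 2 volI

/-- The degenerate diffusion coefficient `ρ(x) = ρ₀ (1 - x²)`. -/
def rho (ρ₀ x : ℝ) : ℝ := ρ₀ * (1 - x ^ 2)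

/-- `f ∈ AC_loc(I)`: absolutely continuous on every compact subinterval of `I`. -/
def ACLoc (f : ℝ → ℝ) : Prop :=
  ∀ a ∈ I, ∀ b ∈ I, AbsolutelyContinuousOnInterval f a b

lemma ACLoc.ae_differentiableAt {f : ℝ → ℝ} (hf : ACLoc f) :
    ∀ᵐ x ∂volI, DifferentiableAt ℝ f x := by
  have hmem : ∀ n : ℕ, (1 - 1 / ((n : ℝ) + 2)) ∈ I ∧ (-(1 - 1 / ((n : ℝ) + 2))) ∈ I := by
    intro n
    have h1 : (0 : ℝ) < 1 / ((n : ℝ) + 2) := by positivity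
    have h2 : 1 / ((n : ℝ) + 2) ≤ 1 / 2 := by
      apply one_div_le_one_div_of_le <;> [norm_num; skip]
      have : (0 : ℝ) ≤ n := Nat.cast_nonneg n
      linarith
    constructor <;> constructor <;> linarith
  have h : ∀ᵐ x ∂(volume : Measure ℝ), ∀ n : ℕ,
      x ∈ uIcc (-(1 - 1 / ((n : ℝ) + 2))) (1 - 1 / ((n : ℝ) + 2)) → DifferentiableAt ℝ f x :=
    ae_all_iff.2 fun n => (hf _ (hmem n).2 _ (hmem n).1).ae_differentiableAt
  rw [ae_restrict_iff' (by exact measurableSet_Ioo)]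
  filter_upwards [h] with x hx hxI
  obtain ⟨hx1, hx2⟩ : -1 < x ∧ x < 1 := hxI
  obtain ⟨n, hn⟩ := exists_nat_one_div_lt (show (0 : ℝ) < 1 - |x| by
    have := abs_lt.2 ⟨hx1, hx2⟩
    linarith)
  have h3 : 1 / ((n : ℝ) + 2) ≤ 1 / ((n : ℝ) + 1) :=
    one_div_le_one_div_of_le (by positivity) (by linarith)
  have h4 := abs_le.1 (show |x| ≤ 1 - 1 / ((n : ℝ) + 2) by linarith)
  refine hx n ?_
  rw [uIcc_of_le (by linarith [h4.1, h4.2])]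
  exact ⟨h4.1, h4.2⟩

lemma ACLoc.eqOn_of_ae_eq {f g : ℝ → ℝ} (hf : ACLoc f) (hg : ACLoc g)
    (h : f =ᵐ[volI] g) : EqOn f g I := by
  have key : ∀ {f : ℝ → ℝ}, ACLoc f → ContinuousOn f I := by
    intro f hf x hx
    obtain ⟨hx1, hx2⟩ : -1 < x ∧ x < 1 := hx
    have ha : (x - 1) / 2 ∈ I := ⟨by linarith, by linarith⟩
    have hb : (x + 1) / 2 ∈ I := ⟨by linarith, by linarith⟩
    have hc := (hf _ ha _ hb).continuousOn
    rw [uIcc_of_le (by linarith)] at hc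
    exact (hc.continuousAt (Icc_mem_nhds (by linarith) (by linarith))).continuousWithinAt
  exact Measure.eqOn_open_of_ae_eq h isOpen_Ioo (key hf) (key hg)

/-- `f` is an `AC_loc` representative of the class `w ∈ L²(I)`, and `p ∈ L²(I)` is the class of
`√ρ w_x`. -/
def HasWeightedDeriv (ρ₀ : ℝ) (w p : L2I) (f : ℝ → ℝ) : Prop :=
  ACLoc f ∧ w =ᵐ[volI] f ∧ p =ᵐ[volI] fun x => √(rho ρ₀ x) * deriv f x

/-- The weighted Sobolev space `V = {w ∈ L²(I) : w ∈ AC_loc(I), √ρ w_x ∈ L²(I)}` with the inner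
product `(u, v)_V = (u, v)_{L²} + (√ρ u_x, √ρ v_x)_{L²}`. It is realised isometrically as the graph
of `w ↦ √ρ w_x` in the Hilbert sum `L²(I) ⊕ L²(I)`: an element is the pair `(w, √ρ w_x)`, which is
determined by `w` (see `V.toL2_injective`). -/
def VGraph (ρ₀ : ℝ) : Submodule ℝ (WithLp 2 (L2I × L2I)) where
  carrier := {z | ∃ f : ℝ → ℝ, HasWeightedDeriv ρ₀ z.fst z.snd f}
  zero_mem' := by
    refine ⟨fun _ => 0, fun a _ b _ => ?_, ?_, ?_⟩
    · simpa using (LipschitzOnWith.absolutelyContinuousOnInterval (K := 0)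
        (LipschitzWith.const (0 : ℝ)).lipschitzOnWith)
    · exact Lp.coeFn_zero ℝ 2 volI
    · filter_upwards [Lp.coeFn_zero ℝ 2 volI] with x hx
      simpa using hx
  add_mem' := by
    rintro z z' ⟨f, hf, hw, hp⟩ ⟨f', hf', hw', hp'⟩
    refine ⟨f + f', fun a ha b hb => (hf a ha b hb).add (hf' a ha b hb), ?_, ?_⟩
    · filter_upwards [Lp.coeFn_add z.fst z'.fst, hw, hw'] with x h1 h2 h3
      simp only [WithLp.add_fst, h1, Pi.add_apply, h2, h3]
    · filter_upwards [Lp.coeFn_add z.snd z'.snd, hp, hp', hf.ae_differentiableAt,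
        hf'.ae_differentiableAt] with x h1 h2 h3 h4 h5
      rw [WithLp.add_snd, h1, Pi.add_apply, h2, h3, deriv_add h4 h5, mul_add]
  smul_mem' := by
    rintro c z ⟨f, hf, hw, hp⟩
    refine ⟨fun x => c * f x, fun a ha b hb => (hf a ha b hb).const_mul c, ?_, ?_⟩
    · filter_upwards [Lp.coeFn_smul c z.fst, hw] with x h1 h2
      simp only [WithLp.smul_fst, h1, Pi.smul_apply, h2, smul_eq_mul]
    · filter_upwards [Lp.coeFn_smul c z.snd, hp, hf.ae_differentiableAt] with x h1 h2 h3
      rw [WithLp.smul_snd, h1, Pi.smul_apply, h2, deriv_const_mul c h3, smul_eq_mul]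
      ring

/-- The Hilbert space `V`. -/
abbrev V (ρ₀ : ℝ) : Type := VGraph ρ₀

namespace V

variable {ρ₀ : ℝ}

/-- The inclusion `V ⊆ L²(I)`. -/
def toL2 (w : V ρ₀) : L2I := (w : WithLp 2 (L2I × L2I)).fst

/-- The class of `√ρ w_x` in `L²(I)`. -/
def wderiv (w : V ρ₀) : L2I := (w : WithLp 2 (L2I × L2I)).snd

/-- The locally absolutely continuous representative of `w ∈ V`; its values on `I` are determined
by `w`. -/
def rep (w : V ρ₀) : ℝ → ℝ := Classical.choose w.2

lemma rep_spec (w : V ρ₀) : HasWeightedDeriv ρ₀ w.toL2 w.wderiv w.rep :=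
  Classical.choose_spec w.2

lemma inner_eq (u v : V ρ₀) :
    inner ℝ u v = inner ℝ u.toL2 v.toL2 + inner ℝ u.wderiv v.wderiv := rfl

lemma toL2_injective : Function.Injective (toL2 : V ρ₀ → L2I) := by
  intro u v h
  obtain ⟨hu, hu1, hu2⟩ := u.rep_spec
  obtain ⟨hv, hv1, hv2⟩ := v.rep_spec
  have he : EqOn u.rep v.rep I := hu.eqOn_of_ae_eq hv (hu1.symm.trans (h ▸ hv1))
  have hd : u.wderiv = v.wderiv := by
    apply Lp.ext
    filter_upwards [hu2, hv2, ae_restrict_mem (show MeasurableSet I from measurableSet_Ioo)]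
      with x h1 h2 h3
    rw [h1, h2, (he.eventuallyEq_of_mem (isOpen_Ioo.mem_nhds h3)).deriv_eq]
  apply Subtype.ext
  apply (WithLp.equiv 2 (L2I × L2I)).injective
  exact Prod.ext h hd

end V

/-- The graph of the operator `A u = (ρ u_x)_x` in `L²(I)`, with domain
`D(A) = {u ∈ V : ρ u_x ∈ H¹(I)}`: `OpA ρ₀ w v` says that `w ∈ D(A)` and `A w = v`. Here
`g` is the absolutely continuous representative of `ρ u_x` on `[-1, 1]`, and `g' = v ∈ L²(I)`. -/
def OpA (ρ₀ : ℝ) (w v : L2I) : Prop :=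
  ∃ u : V ρ₀, u.toL2 = w ∧ ∃ g : ℝ → ℝ, AbsolutelyContinuousOnInterval g (-1) 1 ∧
    (g =ᵐ[volI] fun x => rho ρ₀ x * deriv u.rep x) ∧ v =ᵐ[volI] deriv g

/-- `w ∈ D(A)`. -/
def InDomA (ρ₀ : ℝ) (w : L2I) : Prop := ∃ v : L2I, OpA ρ₀ w v

/-- `S` (restricted to `t ≥ 0`) is the strongly continuous semigroup whose infinitesimal generator
is the (unbounded) operator with graph `A`. Such an `S` is unique on `[0, ∞)`; it is `e^{tA}`. -/
structure IsSemigroupGeneratedBy {X : Type*} [NormedAddCommGroup X] [NormedSpace ℝ X]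
    (A : X → X → Prop) (S : ℝ → X →L[ℝ] X) : Prop where
  map_zero : S 0 = ContinuousLinearMap.id ℝ X
  map_add : ∀ s t : ℝ, 0 ≤ s → 0 ≤ t → S (s + t) = (S s).comp (S t)
  continuousOn : ∀ x : X, ContinuousOn (fun t => S t x) (Ici 0)
  generator : ∀ x y : X,
    A x y ↔ Tendsto (fun h : ℝ => h⁻¹ • (S h x - x)) (𝓝[>] 0) (𝓝 y)

/-- `u ∈ H¹(0, T; X)` for a function `u` defined everywhere on `[0, T]`:
`u` is the integral of some `g ∈ L²(0, T; X)`. -/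
def MemH1 {X : Type*} [NormedAddCommGroup X] [NormedSpace ℝ X] (T : ℝ) (u : ℝ → X) : Prop :=
  ∃ g : ℝ → X, MemLp g 2 (volume.restrict (Ioo 0 T)) ∧
    ∀ t ∈ Icc 0 T, u t = u 0 + ∫ s in (0 : ℝ)..t, g s

/-- `u ∈ L²(0, T; D(A))`, where `D(A)` carries the graph norm: `u` and `A u` are in
`L²(0, T; L²(I))`. -/
def MemL2DomA (ρ₀ T : ℝ) (u : ℝ → L2I) : Prop :=
  MemLp u 2 (volume.restrict (Ioo 0 T)) ∧
  ∃ v : ℝ → L2I, MemLp v 2 (volume.restrict (Ioo 0 T)) ∧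
    ∀ᵐ t ∂(volume.restrict (Ioo 0 T)), OpA ρ₀ (u t) (v t)

/-- `u` is the mild solution on `[0, T]` of `u' = A u + g`, `u(0) = u₀`, with
`g ∈ L²(0, T; X)`, where `S t = e^{tA}`. -/
def IsLinearMildSolution {X : Type*} [NormedAddCommGroup X] [NormedSpace ℝ X]
    (S : ℝ → X →L[ℝ] X) (g : ℝ → X) (u₀ : X) (T : ℝ) (u : ℝ → X) : Prop :=
  MemLp g 2 (volume.restrict (Ioo 0 T)) ∧
    ∀ t ∈ Icc 0 T, u t = S t u₀ + ∫ s in (0 : ℝ)..t, S (t - s) (g s)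

/-- The data of the model. -/
structure Data where
  /-- diffusion constant -/
  ρ₀ : ℝ
  /-- length of the memory -/
  τ : ℝ
  /-- time dependence of the solar flux -/
  r : ℝ → ℝ
  /-- insolation function -/
  q : ℝ → ℝ
  /-- coalbedo -/
  β : ℝ → ℝ
  /-- emissivity -/
  ε : ℝ → ℝ
  /-- response to the memory -/
  f : ℝ → ℝ
  /-- memory kernel `k(s, x)` -/
  k : ℝ → ℝ → ℝ

namespace Data

/-- The standing assumptions on the data of the Sellers type model. -/
structure Admissible (D : Data) : Prop where
  ρ₀_pos : 0 < D.ρ₀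
  τ_pos : 0 < D.τ
  q_mem : MemLp D.q ∞ volI
  r_contDiff : ContDiffOn ℝ 1 D.r (Ici 0)
  r_bdd : ∃ C, ∀ t, 0 ≤ t → |D.r t| ≤ C
  r_deriv_bdd : ∃ C, ∀ t, 0 ≤ t → |derivWithin D.r (Ici 0) t| ≤ C
  β_contDiff : ContDiff ℝ 2 D.β
  β_bdd : ∃ C, ∀ y, |D.β y| ≤ C
  β_deriv_bdd : ∃ C, ∀ y, |deriv D.β y| ≤ C
  β_deriv2_bdd : ∃ C, ∀ y, |deriv (deriv D.β) y| ≤ C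
  ε_contDiff : ContDiff ℝ 1 D.ε
  ε_bdd : ∃ C, ∀ y, |D.ε y| ≤ C
  ε_deriv_bdd : ∃ C, ∀ y, |deriv D.ε y| ≤ C
  ε_lower : ∃ ε₁ > 0, ∀ y, ε₁ ≤ D.ε y
  f_contDiff : ContDiff ℝ 1 D.f
  f_bdd : ∃ C, ∀ y, |D.f y| ≤ C
  f_deriv_bdd : ∃ C, ∀ y, |deriv D.f y| ≤ C
  f_lipschitz : ∃ L : ℝ≥0, LipschitzWith L D.f ∧ LipschitzWith L (deriv D.f)
  k_contDiff : ContDiffOn ℝ 1 (fun z : ℝ × ℝ => D.k z.1 z.2) (Icc (-D.τ) 0 ×ˢ Icc (-1) 1)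

variable (D : Data)

/-- The local reaction term `G(t, w)(x) = r(t) q(x) β(w(x)) - ε(w(x)) |w(x)|³ w(x)`. -/
def G (t : ℝ) (w : V D.ρ₀) (x : ℝ) : ℝ :=
  D.r t * D.q x * D.β (w.rep x) - D.ε (w.rep x) * |w.rep x| ^ 3 * w.rep x

/-- The history function `∫_{-τ}^0 k(s, x) v(s, x) ds` of `v : [-τ, 0] → V`. -/
def history (v : ℝ → V D.ρ₀) (x : ℝ) : ℝ :=
  ∫ s in (-D.τ)..0, D.k s x * (v s).rep x

/-- The memory term `F(v)(x) = f(∫_{-τ}^0 k(s, x) v(s, x) ds)`. -/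
def F (v : ℝ → V D.ρ₀) (x : ℝ) : ℝ := D.f (D.history v x)

/-- `u` is a mild solution on `[0, T]` of
`u'(t) = A u(t) + G(t, u(t)) + F(u^{(t)})`, `u(s) = u₀(s)` for `s ∈ [-τ, 0]`,
where `u^{(t)}(s) = u(t + s)`. -/
structure IsMildSolution (u₀ : ℝ → V D.ρ₀) (T : ℝ) (u : ℝ → V D.ρ₀) : Prop where
  continuousOn : ContinuousOn u (Icc (-D.τ) T)
  memH1 : MemH1 T fun t => (u t).toL2
  memL2DomA : MemL2DomA D.ρ₀ T fun t => (u t).toL2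
  initial : ∀ s ∈ Icc (-D.τ) 0, u s = u₀ s
  duhamel : ∃ (S : ℝ → L2I →L[ℝ] L2I) (g : ℝ → L2I),
    IsSemigroupGeneratedBy (OpA D.ρ₀) S ∧
    (∀ t ∈ Icc 0 T, g t =ᵐ[volI] fun x => D.G t (u t) x + D.F (fun s => u (t + s)) x) ∧
    IsLinearMildSolution S g (u₀ 0).toL2 T fun t => (u t).toL2

end Data

end SellersEBM

end

/-!
The operator `A u = (ρ u_x)_x` is `ρ₀` times the Legendre operator. Orthonormalised polynomials are
a Hilbert basis `b` of `L²(I)` with `A (b n) = -lam n • b n` (`exists_eigenbasis`), because `A`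
preserves polynomials of degree at most `n` and is symmetric. The whole problem is read off in
coefficients with respect to `b`.

* Green's formula `(A u, z) = -(√ρ u_x, √ρ z_x)` has no boundary terms (`inner_flux_deriv`). The
  absolutely continuous representative `g` of `ρ u_x` vanishes at an endpoint `e`, since otherwise
  `√ρ u_x` would behave like `1 / √ρ`, which is not square integrable; therefore
  `g = O(√|x - e|)`, and a nonzero limit of `g z` at `e` would make `z²` larger than a multiple of
  `1 / |x - e|`, which is not integrable. Hence `A w = v` means exactly that the coefficients of
  `v` are `-lam n` times those of `w` (`opA_iff_coeff`), and the semigroup generated by `A` is, on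
  `[0, ∞)`, multiplication of the coefficients by `exp (-lam n * t)`; conversely that
  multiplication is generated by `A` (`IsSemigroupGeneratedBy.isDiagonalSemigroup`,
  `IsDiagonalSemigroup.isSemigroupGeneratedBy`).
* Maximal regularity (`IsDiagonalSemigroup.duhamel_regularity`) is the scalar energy estimate for
  `y' = -l y + g`, summed over the coefficients. With an initial value in the form domain it makes
  the Duhamel formula produce `H¹(0, T; L²(I))`, `L²(0, T; D(A))` and, by a summable majorant of the
  coefficients, `C([0, T]; V)` (`exists_continuousOn_V`).
* The emission term dominates: there is `M`, at least the supremum of `|u₀(0)|`, such that the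
  right-hand side is nonpositive where the temperature is at least `M` and nonnegative where it is
  at most `-M`, whatever the value of the memory (`Data.Admissible.exists_reaction_sign`). The
  function `‖(u - M)⁺‖²` is then nonincreasing, so that `|u| ≤ M` (`le_of_forcing_nonpos`).
* Truncating the temperature in the local reaction to `[-M, M]` gives a forcing which is globally
  Lipschitz in `C([0, T]; L²(I))` and causal (`Data.Admissible.exists_isCausalLipschitz`), so that
  the truncated problem has exactly one solution: iterates of the Duhamel map differ by
  `(L t)ⁿ / n!` (`IsCausalLipschitz.eqOn`, `IsCausalLipschitz.exists_fixedPoint`).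

By the maximum principle, which applies to the truncated problem as well as to the original one,
both problems have the same solutions (`Data.IsMildSolution.eq_duhamelMap`,
`Data.Admissible.exists_isMildSolution`). The pointwise integral in the memory term is identified
with a Bochner integral in `L²(I)` in `integral_mul_rep_ae_eq`.
-/

noncomputable section

namespace SellersEBM

/-! ### Coefficients with respect to a Hilbert basis -/

section Coefficients

variable {X : Type*} [NormedAddCommGroup X] [InnerProductSpace ℝ X]
  (b : HilbertBasis ℕ ℝ X)

lemma hasSum_sq_coeff (x : X) : HasSum (fun n => (inner ℝ (b n) x) ^ 2) (‖x‖ ^ 2) := by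
  have h := b.hasSum_inner_mul_inner x x
  rw [real_inner_self_eq_norm_sq] at h
  simpa only [real_inner_comm x, ← sq] using h

lemma ext_coeff {x y : X} (h : ∀ n, inner ℝ (b n) x = inner ℝ (b n) y) : x = y := by
  apply b.repr.injective
  ext n
  rw [b.repr_apply_apply, b.repr_apply_apply, h n]

lemma exists_coeff_eq {c : ℕ → ℝ} (hc : Summable fun n => c n ^ 2) :
    ∃ x : X, ∀ n, inner ℝ (b n) x = c n := by
  have hm : Memℓp c 2 := by
    apply memℓp_gen
    simpa using hc
  refine ⟨b.repr.symm ⟨c, hm⟩, fun n => ?_⟩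
  rw [← b.repr_apply_apply, LinearIsometryEquiv.apply_symm_apply]

/-- Dominated convergence for coefficients: coefficientwise convergence is norm convergence as soon
as the squared coefficients have a common summable majorant. -/
lemma tendsto_of_tendsto_coeff {α : Type*} {l : Filter α} {F : α → X} {x : X}
    (h : ∀ n, Tendsto (fun a => inner ℝ (b n) (F a)) l (𝓝 (inner ℝ (b n) x)))
    {B : ℕ → ℝ} (hB : Summable B) (hFB : ∀ᶠ a in l, ∀ n, (inner ℝ (b n) (F a)) ^ 2 ≤ B n) :
    Tendsto F l (𝓝 x) := by
  rw [tendsto_iff_norm_sub_tendsto_zero]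
  have key : Tendsto (fun a => ∑' n, (inner ℝ (b n) (F a - x)) ^ 2) l (𝓝 (∑' _ : ℕ, (0 : ℝ))) := by
    refine tendsto_tsum_of_dominated_convergence
      (bound := fun n => 2 * B n + 2 * (inner ℝ (b n) x) ^ 2)
      ((hB.mul_left 2).add ((hasSum_sq_coeff b x).summable.mul_left 2)) (fun n => ?_) ?_
    · have h1 := ((h n).sub_const (inner ℝ (b n) x)).pow 2
      simpa [inner_sub_right] using h1
    · filter_upwards [hFB] with a ha n
      rw [inner_sub_right, Real.norm_eq_abs, abs_of_nonneg (sq_nonneg _)]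
      nlinarith [ha n, sq_nonneg (inner ℝ (b n) (F a) + inner ℝ (b n) x)]
  have h2 : ∀ a, ‖F a - x‖ = √(∑' n, (inner ℝ (b n) (F a - x)) ^ 2) := by
    intro a
    rw [(hasSum_sq_coeff b _).tsum_eq, Real.sqrt_sq (norm_nonneg _)]
  simp_rw [h2]
  simpa using key.sqrt

lemma continuousOn_of_coeff {α : Type*} [TopologicalSpace α] {s : Set α} {F : α → X}
    (h : ∀ n, ContinuousOn (fun a => inner ℝ (b n) (F a)) s)
    {B : ℕ → ℝ} (hB : Summable B) (hFB : ∀ a ∈ s, ∀ n, (inner ℝ (b n) (F a)) ^ 2 ≤ B n) :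
    ContinuousOn F s := fun a ha =>
  tendsto_of_tendsto_coeff b (fun n => h n a ha) hB
    (eventually_nhdsWithin_of_forall hFB)

lemma aestronglyMeasurable_of_coeff {α : Type*} [MeasurableSpace α] {μ : Measure α} {F : α → X}
    (h : ∀ n, AEStronglyMeasurable (fun a => inner ℝ (b n) (F a)) μ) :
    AEStronglyMeasurable F μ := by
  refine aestronglyMeasurable_of_tendsto_ae atTop
    (f := fun N a => ∑ n ∈ Finset.range N, (inner ℝ (b n) (F a)) • b n) (fun N => ?_) ?_
  · exact Finset.aestronglyMeasurable_fun_sum _ fun n _ => (h n).smul_const _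
  · refine Eventually.of_forall fun a => ?_
    have h1 := (b.hasSum_repr (F a)).tendsto_sum_nat
    simpa only [b.repr_apply_apply] using h1

/-- A multiplier bounded by `1` acts on the coefficients as a contraction. -/
lemma exists_multiplier {c : ℕ → ℝ} (hc : ∀ n, |c n| ≤ 1) :
    ∃ L : X →L[ℝ] X, ∀ x n, inner ℝ (b n) (L x) = c n * inner ℝ (b n) x := by
  have hsq : ∀ (x : X) n, (c n * inner ℝ (b n) x) ^ 2 ≤ (inner ℝ (b n) x) ^ 2 := by
    intro x n
    rw [mul_pow]
    have : c n ^ 2 ≤ 1 := by rw [← sq_abs]; exact pow_le_one₀ (abs_nonneg _) (hc n)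
    nlinarith [sq_nonneg (inner ℝ (b n) x)]
  have hex : ∀ x : X, ∃ y : X, ∀ n, inner ℝ (b n) y = c n * inner ℝ (b n) x := fun x =>
    exists_coeff_eq b (Summable.of_nonneg_of_le (fun n => sq_nonneg _) (hsq x)
      (hasSum_sq_coeff b x).summable)
  choose L hL using hex
  refine ⟨LinearMap.mkContinuous ⟨⟨L, fun x y => ?_⟩, fun a x => ?_⟩ 1 fun x => ?_, hL⟩
  · exact ext_coeff b fun n => by rw [inner_add_right, hL, hL, hL, inner_add_right]; ring
  · refine ext_coeff b fun n => ?_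
    simp only [RingHom.id_apply, inner_smul_right, hL]
    ring
  · rw [one_mul]
    refine abs_le_of_sq_le_sq' ?_ (norm_nonneg _) |>.2
    refine hasSum_le (fun n => ?_) (hasSum_sq_coeff b (L x)) (hasSum_sq_coeff b x)
    rw [hL]
    exact hsq x n

lemma norm_le_of_sq_coeff_le {x y : X}
    (h : ∀ n, (inner ℝ (b n) x) ^ 2 ≤ (inner ℝ (b n) y) ^ 2) : ‖x‖ ≤ ‖y‖ :=
  (abs_le_of_sq_le_sq' (hasSum_le h (hasSum_sq_coeff b x) (hasSum_sq_coeff b y))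
    (norm_nonneg _)).2

lemma clm_ext_basis {Y : Type*} [NormedAddCommGroup Y] [NormedSpace ℝ Y] {L M : X →L[ℝ] Y}
    (h : ∀ n, L (b n) = M (b n)) : L = M := by
  refine ContinuousLinearMap.ext_on (s := range b) ?_ ?_
  · rw [Submodule.dense_iff_topologicalClosure_eq_top]
    exact b.dense_span
  · rintro _ ⟨n, rfl⟩
    exact h n

end Coefficients

/-! ### Diagonal semigroups -/

section Semigroup

variable {X : Type*} [NormedAddCommGroup X] [InnerProductSpace ℝ X]
  {b : HilbertBasis ℕ ℝ X} {lam : ℕ → ℝ}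

/-- For `t ≥ 0`, `S t` multiplies the `n`-th coefficient with respect to `b` by `exp (-lam n * t)`:
`S` is the semigroup generated by the operator with eigenvalues `-lam n` and eigenvectors `b n`. -/
def IsDiagonalSemigroup (b : HilbertBasis ℕ ℝ X) (lam : ℕ → ℝ) (S : ℝ → X →L[ℝ] X) : Prop :=
  ∀ t, 0 ≤ t → ∀ x n, inner ℝ (b n) (S t x) = Real.exp (-lam n * t) * inner ℝ (b n) x

lemma exists_isDiagonalSemigroup (hlam : ∀ n, 0 ≤ lam n) :
    ∃ S : ℝ → X →L[ℝ] X, IsDiagonalSemigroup b lam S := by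
  have h : ∀ t : ℝ, ∃ L : X →L[ℝ] X, 0 ≤ t →
      ∀ x n, inner ℝ (b n) (L x) = Real.exp (-lam n * t) * inner ℝ (b n) x := by
    intro t
    by_cases ht : 0 ≤ t
    · obtain ⟨L, hL⟩ := exists_multiplier b (c := fun n => Real.exp (-lam n * t)) fun n => by
        rw [abs_of_pos (Real.exp_pos _), Real.exp_le_one_iff]
        nlinarith [mul_nonneg (hlam n) ht]
      exact ⟨L, fun _ => hL⟩
    · exact ⟨0, fun h => absurd h ht⟩
  choose S hS using h
  exact ⟨S, hS⟩

lemma exp_neg_mul_sq_le {l t : ℝ} (hl : 0 ≤ l) (ht : 0 ≤ t) (y : ℝ) :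
    (Real.exp (-l * t) * y) ^ 2 ≤ y ^ 2 := by
  have h1 : Real.exp (-l * t) ≤ 1 := Real.exp_le_one_iff.2 (by nlinarith [mul_nonneg hl ht])
  rw [mul_pow]
  have := pow_le_one₀ (Real.exp_pos _).le h1 (n := 2)
  nlinarith [sq_nonneg y]

variable {S : ℝ → X →L[ℝ] X}

lemma IsDiagonalSemigroup.norm_le (hS : IsDiagonalSemigroup b lam S) (hlam : ∀ n, 0 ≤ lam n)
    {t : ℝ} (ht : 0 ≤ t) (x : X) : ‖S t x‖ ≤ ‖x‖ :=
  norm_le_of_sq_coeff_le b fun n => by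
    rw [hS t ht]
    exact exp_neg_mul_sq_le (hlam n) ht _

/-- A diagonal semigroup is generated by the diagonal operator: the difference quotients converge
coefficientwise, and they are dominated by the coefficients of `A x`. -/
lemma IsDiagonalSemigroup.isSemigroupGeneratedBy (hS : IsDiagonalSemigroup b lam S)
    (hlam : ∀ n, 0 ≤ lam n) {A : X → X → Prop}
    (hA : ∀ x y, A x y ↔ ∀ n, inner ℝ (b n) y = -lam n * inner ℝ (b n) x) :
    IsSemigroupGeneratedBy A S where
  map_zero := by
    ext x
    exact ext_coeff b fun n => by simp [hS 0 le_rfl]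
  map_add s t hs ht := by
    ext x
    refine ext_coeff b fun n => ?_
    rw [ContinuousLinearMap.comp_apply, hS _ (add_nonneg hs ht), hS s hs, hS t ht, ← mul_assoc,
      ← Real.exp_add, mul_add]
  continuousOn x := by
    refine continuousOn_of_coeff b (fun n => ?_) (hasSum_sq_coeff b x).summable
      fun t ht n => ?_
    · refine ContinuousOn.congr (f := fun t => Real.exp (-lam n * t) * inner ℝ (b n) x) ?_
        fun t ht => hS t ht x n
      fun_prop
    · rw [hS t ht]
      exact exp_neg_mul_sq_le (hlam n) ht _
  generator x y := by
    have hlim : ∀ n, Tendsto (fun h : ℝ => inner ℝ (b n) (h⁻¹ • (S h x - x))) (𝓝[>] 0)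
        (𝓝 (-lam n * inner ℝ (b n) x)) := by
      intro n
      have hd : HasDerivAt (fun t => Real.exp (-lam n * t) * inner ℝ (b n) x)
          (-lam n * inner ℝ (b n) x) 0 := by
        have h1 : HasDerivAt (fun t => -lam n * t) (-lam n) 0 := by
          simpa using (hasDerivAt_id (0 : ℝ)).const_mul (-lam n)
        simpa using h1.exp.mul_const (inner ℝ (b n) x)
      have h2 := hd.tendsto_slope_zero_right
      refine h2.congr' ?_
      filter_upwards [self_mem_nhdsWithin] with h hh
      rw [inner_smul_right, inner_sub_right, hS h (le_of_lt hh)]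
      simp
    rw [hA]
    constructor
    · intro h
      refine tendsto_of_tendsto_coeff b (fun n => ?_) (hasSum_sq_coeff b y).summable ?_
      · rw [h n]; exact hlim n
      · filter_upwards [self_mem_nhdsWithin] with t ht n
        have ht' : 0 < t := ht
        rw [inner_smul_right, inner_sub_right, hS t ht'.le, h n]
        -- `lam n ^ 2` bounds the squared difference quotients of the exponential at `0`: the
        -- squared coefficients of `y` are a summable majorant
        have h1 : 1 - lam n * t ≤ Real.exp (-lam n * t) := by
          have := Real.add_one_le_exp (-lam n * t); linarith
        have h2 : Real.exp (-lam n * t) ≤ 1 :=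
          Real.exp_le_one_iff.2 (by nlinarith [mul_nonneg (hlam n) ht'.le])
        have h3 : (t⁻¹ * (Real.exp (-lam n * t) - 1)) ^ 2 ≤ (lam n) ^ 2 := by
          apply sq_le_sq'
          · rw [inv_mul_eq_div, le_div_iff₀ ht']; linarith
          · refine le_trans (mul_nonpos_of_nonneg_of_nonpos (by positivity) (by linarith)) (hlam n)
        calc _ = (t⁻¹ * (Real.exp (-lam n * t) - 1)) ^ 2 * (inner ℝ (b n) x) ^ 2 := by ring
          _ ≤ (lam n) ^ 2 * (inner ℝ (b n) x) ^ 2 := by gcongr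
          _ = _ := by ring
    · intro h n
      exact tendsto_nhds_unique
        ((((innerSL ℝ (b n)).continuous.tendsto y).comp h)) (hlim n)

/-- The semigroup generated by a diagonal operator is the diagonal one: on an eigenvector `b n` the
curve `exp (lam n * t) • S t (b n)` has vanishing right derivative. -/
lemma IsSemigroupGeneratedBy.isDiagonalSemigroup {A : X → X → Prop}
    (hSA : IsSemigroupGeneratedBy A S) (hlam : ∀ n, 0 ≤ lam n)
    (hA : ∀ x y, A x y ↔ ∀ n, inner ℝ (b n) y = -lam n * inner ℝ (b n) x) :
    IsDiagonalSemigroup b lam S := by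
  have hAb : ∀ n, A (b n) (-lam n • b n) := by
    intro n
    rw [hA]
    intro m
    rw [inner_smul_right]
    by_cases hmn : m = n
    · rw [hmn]
    · simp [b.orthonormal.2 hmn]
  have heig : ∀ n, ∀ t, 0 ≤ t → S t (b n) = Real.exp (-lam n * t) • b n := by
    intro n t ht
    -- right derivative at `r`, from the one at `0` and the semigroup law
    have hder : ∀ r, 0 ≤ r → HasDerivWithinAt (fun s => S s (b n)) (-lam n • S r (b n))
        (Ici r) r := by
      intro r hr
      rw [← hasDerivWithinAt_Ioi_iff_Ici, hasDerivWithinAt_iff_tendsto_slope' (by simp)]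
      have h1 := ((S r).continuous.tendsto _).comp ((hSA.generator _ _).1 (hAb n))
      have h2 : Tendsto (fun s : ℝ => s - r) (𝓝[>] r) (𝓝[>] 0) := by
        refine tendsto_nhdsWithin_iff.2 ⟨?_, ?_⟩
        · have : Tendsto (fun s : ℝ => s - r) (𝓝 r) (𝓝 (r - r)) :=
            (continuous_id.sub continuous_const).tendsto r
          rw [sub_self] at this
          exact this.mono_left nhdsWithin_le_nhds
        · filter_upwards [self_mem_nhdsWithin] with s hs
          exact sub_pos.2 (show r < s from hs)
      have h3 := h1.comp h2
      rw [map_smul] at h3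
      refine h3.congr' ?_
      filter_upwards [self_mem_nhdsWithin] with s hs
      have hs' : r < s := hs
      simp only [Function.comp_apply, slope_def_module, map_smul, map_sub]
      rw [← ContinuousLinearMap.comp_apply, ← hSA.map_add r (s - r) hr (by linarith)]
      simp
    have hconst := constant_of_has_deriv_right_zero
      (f := fun s => Real.exp (lam n * s) • S s (b n)) (a := 0) (b := t) ?_ ?_ t ⟨ht, le_rfl⟩
    · simp only [mul_zero, Real.exp_zero, one_smul, hSA.map_zero,
        ContinuousLinearMap.id_apply] at hconst
      have h0 : Real.exp (-lam n * t) * Real.exp (lam n * t) = 1 := by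
        rw [← Real.exp_add]; simp
      calc S t (b n) = (Real.exp (-lam n * t) * Real.exp (lam n * t)) • S t (b n) := by
            rw [h0, one_smul]
        _ = _ := by rw [mul_smul, hconst]
    · refine ContinuousOn.smul (by fun_prop) ((hSA.continuousOn (b n)).mono ?_)
      exact fun s hs => hs.1
    · intro s hs
      have h1 : HasDerivWithinAt (fun s => Real.exp (lam n * s)) (Real.exp (lam n * s) * lam n)
          (Ici s) s := by
        have : HasDerivAt (fun s => lam n * s) (lam n) s := by
          simpa using (hasDerivAt_id s).const_mul (lam n)
        exact this.exp.hasDerivWithinAt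
      refine (h1.smul (hder s hs.1)).congr_deriv ?_
      module
  obtain ⟨D, hD⟩ := exists_isDiagonalSemigroup (b := b) hlam
  intro t ht x n
  have : S t = D t := by
    refine clm_ext_basis b fun m => ?_
    rw [heig m t ht]
    refine ext_coeff b fun k => ?_
    rw [hD t ht, inner_smul_right]
    by_cases hkm : k = m
    · rw [hkm]
    · simp [b.orthonormal.2 hkm]
  rw [this]
  exact hD t ht x n

end Semigroup

/-! ### The linear Cauchy problem for a diagonal semigroup -/

lemma integral_eq_sub_of_ae_hasDerivAt {f f' : ℝ → ℝ} {a b : ℝ}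
    (hf : AbsolutelyContinuousOnInterval f a b)
    (h : ∀ᵐ x, x ∈ uIcc a b → HasDerivAt f (f' x) x) : ∫ x in a..b, f' x = f b - f a := by
  rw [← hf.integral_deriv_eq_sub]
  refine intervalIntegral.integral_congr_ae ?_
  filter_upwards [h] with x hx hxab
  exact (hx (uIoc_subset_uIcc hxab)).deriv.symm

lemma intervalIntegrable_of_memLp_two {X : Type*} [NormedAddCommGroup X] {g : ℝ → X} {T t : ℝ}
    (hg : MemLp g 2 (volume.restrict (Ioo 0 T))) (ht : t ∈ Icc 0 T) :
    IntervalIntegrable g volume 0 t := by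
  have h1 : Integrable g (volume.restrict (Ioo 0 T)) := hg.integrable (by norm_num)
  rw [intervalIntegrable_iff_integrableOn_Ioo_of_le ht.1]
  exact IntegrableOn.mono_set h1 (Ioo_subset_Ioo_right ht.2)

lemma intervalIntegrable_sq_of_memLp_two {g : ℝ → ℝ} {T t : ℝ}
    (hg : MemLp g 2 (volume.restrict (Ioo 0 T))) (ht : t ∈ Icc 0 T) :
    IntervalIntegrable (fun s => g s ^ 2) volume 0 t := by
  have h1 : Integrable (fun s => g s ^ 2) (volume.restrict (Ioo 0 T)) := hg.integrable_sq
  rw [intervalIntegrable_iff_integrableOn_Ioo_of_le ht.1]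
  exact IntegrableOn.mono_set h1 (Ioo_subset_Ioo_right ht.2)

lemma integral_sq_le_integral_sq {g : ℝ → ℝ} {T t : ℝ}
    (hg : MemLp g 2 (volume.restrict (Ioo 0 T))) (ht : t ∈ Icc 0 T) :
    ∫ s in (0 : ℝ)..t, g s ^ 2 ≤ ∫ s in (0 : ℝ)..T, g s ^ 2 :=
  intervalIntegral.integral_mono_interval le_rfl ht.1 ht.2
    (Eventually.of_forall fun _ => sq_nonneg _)
    (intervalIntegrable_sq_of_memLp_two hg ⟨ht.1.trans ht.2, le_rfl⟩)

section Scalar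

variable {l c T : ℝ} {g : ℝ → ℝ}

/-- The solution of the scalar problem `p' = -l p + g`, `p 0 = c`. -/
def scalarDuhamel (l c : ℝ) (g : ℝ → ℝ) (t : ℝ) : ℝ :=
  Real.exp (-l * t) * (c + ∫ s in (0 : ℝ)..t, Real.exp (l * s) * g s)

lemma scalarDuhamel_zero : scalarDuhamel l c g 0 = c := by simp [scalarDuhamel]

lemma scalarDuhamel_ac (hT : 0 ≤ T) (hg : MemLp g 2 (volume.restrict (Ioo 0 T))) :
    AbsolutelyContinuousOnInterval (scalarDuhamel l c g) 0 T := by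
  have h1 : IntervalIntegrable (fun s => Real.exp (l * s) * g s) volume 0 T :=
    (intervalIntegrable_of_memLp_two hg ⟨hT, le_rfl⟩).continuousOn_mul (by fun_prop)
  have h2 := h1.absolutelyContinuousOnInterval_intervalIntegral (c := 0) (by simp)
  have h3 : AbsolutelyContinuousOnInterval (fun _ : ℝ => c) 0 T :=
    (LipschitzWith.const c).lipschitzOnWith.absolutelyContinuousOnInterval
  have h4 : AbsolutelyContinuousOnInterval (fun t => Real.exp (-l * t)) 0 T := by
    refine ContDiffOn.absolutelyContinuousOnInterval (ContDiff.contDiffOn ?_)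
    fun_prop
  exact h4.mul (h3.add h2)

lemma scalarDuhamel_ae_hasDerivAt (hT : 0 ≤ T) (hg : MemLp g 2 (volume.restrict (Ioo 0 T))) :
    ∀ᵐ t, t ∈ uIcc 0 T → HasDerivAt (scalarDuhamel l c g) (-l * scalarDuhamel l c g t + g t) t := by
  have h1 : IntervalIntegrable (fun s => Real.exp (l * s) * g s) volume 0 T :=
    (intervalIntegrable_of_memLp_two hg ⟨hT, le_rfl⟩).continuousOn_mul (by fun_prop)
  filter_upwards [h1.ae_hasDerivAt_integral] with t ht htT
  have h2 := ht htT 0 (by simp)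
  have h3 : HasDerivAt (fun t => Real.exp (-l * t)) (Real.exp (-l * t) * -l) t := by
    have : HasDerivAt (fun s => -l * s) (-l) t := by
      simpa using (hasDerivAt_id t).const_mul (-l)
    exact this.exp
  have h4 := h3.mul (h2.const_add c)
  have h0 : Real.exp (-l * t) * Real.exp (l * t) = 1 := by rw [← Real.exp_add]; simp
  refine h4.congr_deriv ?_
  unfold scalarDuhamel
  linear_combination g t * h0

lemma scalarDuhamel_continuousOn (hT : 0 ≤ T) (hg : MemLp g 2 (volume.restrict (Ioo 0 T))) :
    ContinuousOn (scalarDuhamel l c g) (Icc 0 T) := by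
  simpa [uIcc_of_le hT] using (scalarDuhamel_ac (l := l) (c := c) hT hg).continuousOn

lemma memLp_restrict_Ioo_mono {X : Type*} [NormedAddCommGroup X] {g : ℝ → X} {t : ℝ}
    (hg : MemLp g 2 (volume.restrict (Ioo 0 T))) (ht : t ∈ Icc 0 T) :
    MemLp g 2 (volume.restrict (Ioo 0 t)) :=
  hg.mono_measure (Measure.restrict_mono (Ioo_subset_Ioo_right ht.2) le_rfl)

lemma scalarDuhamel_eq_integral {t : ℝ} (hg : MemLp g 2 (volume.restrict (Ioo 0 t)))
    (ht : 0 ≤ t) :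
    scalarDuhamel l c g t = c + ∫ s in (0 : ℝ)..t, (-l * scalarDuhamel l c g s + g s) := by
  rw [integral_eq_sub_of_ae_hasDerivAt (scalarDuhamel_ac ht hg) (scalarDuhamel_ae_hasDerivAt ht hg),
    scalarDuhamel_zero]
  ring

/-- The energy estimate behind maximal regularity: test `p' + l p = g` with `2 l p`. -/
lemma scalarDuhamel_energy {t : ℝ} (hg : MemLp g 2 (volume.restrict (Ioo 0 t)))
    (ht : 0 ≤ t) :
    l * scalarDuhamel l c g t ^ 2 + l ^ 2 * ∫ s in (0 : ℝ)..t, scalarDuhamel l c g s ^ 2 ≤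
      l * c ^ 2 + ∫ s in (0 : ℝ)..t, g s ^ 2 := by
  set p := scalarDuhamel l c g with hp
  have hac : AbsolutelyContinuousOnInterval (fun s => l * (p s * p s)) 0 t :=
    ((scalarDuhamel_ac ht hg).mul (scalarDuhamel_ac ht hg)).const_mul l
  have hder : ∀ᵐ s, s ∈ uIcc 0 t → HasDerivAt (fun s => l * (p s * p s))
      (2 * l * p s * (-l * p s + g s)) s := by
    filter_upwards [scalarDuhamel_ae_hasDerivAt (l := l) (c := c) ht hg] with s hs hst
    have h1 := hs hst
    refine ((h1.mul h1).const_mul l).congr_deriv ?_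
    rw [← hp]
    ring
  have hpc : ContinuousOn p (uIcc 0 t) := (scalarDuhamel_ac ht hg).continuousOn
  have hp2 : IntervalIntegrable (fun s => p s ^ 2) volume 0 t := (hpc.pow 2).intervalIntegrable
  have hgi := intervalIntegrable_of_memLp_two hg ⟨ht, le_rfl⟩
  have hg2 := intervalIntegrable_sq_of_memLp_two hg ⟨ht, le_rfl⟩
  have hi : IntervalIntegrable (fun s => 2 * l * p s * (-l * p s + g s)) volume 0 t := by
    refine IntervalIntegrable.continuousOn_mul
      (((hpc.const_mul (-l)).intervalIntegrable).add hgi) ?_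
    exact hpc.const_mul _
  have h1 := integral_eq_sub_of_ae_hasDerivAt hac hder
  have h2 : ∫ s in (0 : ℝ)..t, (2 * l * p s * (-l * p s + g s)) ≤
      ∫ s in (0 : ℝ)..t, (g s ^ 2 - l ^ 2 * p s ^ 2) :=
    intervalIntegral.integral_mono_on ht hi (hg2.sub (hp2.const_mul _)) fun s _ => by
      nlinarith [sq_nonneg (g s - l * p s)]
  rw [intervalIntegral.integral_sub hg2 (hp2.const_mul _), intervalIntegral.integral_const_mul,
    h1] at h2
  have h0 : p 0 = c := scalarDuhamel_zero
  rw [h0] at h2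
  nlinarith

lemma scalarDuhamel_sq_le {t : ℝ} (hl : 0 ≤ l) (hg : MemLp g 2 (volume.restrict (Ioo 0 t)))
    (ht : 0 ≤ t) :
    scalarDuhamel l c g t ^ 2 ≤ Real.exp t * (c ^ 2 + ∫ s in (0 : ℝ)..t, g s ^ 2) := by
  set p := scalarDuhamel l c g with hp
  have he : AbsolutelyContinuousOnInterval (fun s => Real.exp (-s)) 0 t := by
    refine ContDiffOn.absolutelyContinuousOnInterval (ContDiff.contDiffOn ?_)
    fun_prop
  have hac : AbsolutelyContinuousOnInterval (fun s => Real.exp (-s) * (p s * p s)) 0 t :=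
    he.mul ((scalarDuhamel_ac ht hg).mul (scalarDuhamel_ac ht hg))
  -- `exp (-s) p²` has derivative at most `g²`, as `2 p g ≤ p² + g²` and `l ≥ 0`
  have hder : ∀ᵐ s, s ∈ uIcc 0 t → HasDerivAt (fun s => Real.exp (-s) * (p s * p s))
      (Real.exp (-s) * (p s * (2 * (-l * p s + g s) - p s))) s := by
    filter_upwards [scalarDuhamel_ae_hasDerivAt (l := l) (c := c) ht hg] with s hs hst
    have h1 := hs hst
    have h2 : HasDerivAt (fun s => Real.exp (-s)) (Real.exp (-s) * -1) s :=
      (hasDerivAt_neg s).exp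
    refine (h2.mul (h1.mul h1)).congr_deriv ?_
    simp only [Pi.mul_apply, ← hp]
    ring
  have hpc : ContinuousOn p (uIcc 0 t) := (scalarDuhamel_ac ht hg).continuousOn
  have hgi := intervalIntegrable_of_memLp_two hg ⟨ht, le_rfl⟩
  have hg2 := intervalIntegrable_sq_of_memLp_two hg ⟨ht, le_rfl⟩
  have hi : IntervalIntegrable (fun s => Real.exp (-s) * (p s * (2 * (-l * p s + g s) - p s)))
      volume 0 t := by
    refine IntervalIntegrable.continuousOn_mul (IntervalIntegrable.continuousOn_mul
      (((((hpc.const_mul (-l)).intervalIntegrable).add hgi).const_mul 2).sub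
        hpc.intervalIntegrable) hpc) (by fun_prop)
  have h1 := integral_eq_sub_of_ae_hasDerivAt hac hder
  have h2 : ∫ s in (0 : ℝ)..t, (Real.exp (-s) * (p s * (2 * (-l * p s + g s) - p s))) ≤
      ∫ s in (0 : ℝ)..t, g s ^ 2 :=
    intervalIntegral.integral_mono_on ht hi hg2 fun s hs => by
      have h3 : Real.exp (-s) ≤ 1 := Real.exp_le_one_iff.2 (by linarith [hs.1])
      have h4 : p s * (2 * (-l * p s + g s) - p s) ≤ g s ^ 2 := by
        nlinarith [sq_nonneg (g s - p s), mul_nonneg hl (sq_nonneg (p s))]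
      calc _ ≤ Real.exp (-s) * g s ^ 2 := by gcongr
        _ ≤ 1 * g s ^ 2 := by gcongr
        _ = _ := one_mul _
  rw [h1] at h2
  have h0 : p 0 = c := scalarDuhamel_zero
  rw [h0, neg_zero, Real.exp_zero] at h2
  have h5 : Real.exp t * Real.exp (-t) = 1 := by rw [← Real.exp_add]; simp
  calc p t ^ 2 = Real.exp t * (Real.exp (-t) * (p t * p t)) := by
        rw [← mul_assoc, h5]; ring
    _ ≤ _ := by
        gcongr
        linarith

end Scalar

section Duhamel

variable {X : Type*} [NormedAddCommGroup X] [InnerProductSpace ℝ X]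
  {b : HilbertBasis ℕ ℝ X} {lam : ℕ → ℝ} {S : ℝ → X →L[ℝ] X} {T : ℝ} {g : ℝ → X}

lemma memLp_two_coeff (hg : MemLp g 2 (volume.restrict (Ioo 0 T))) (n : ℕ) :
    MemLp (fun s => inner ℝ (b n) (g s)) 2 (volume.restrict (Ioo 0 T)) :=
  hg.const_inner (b n)

lemma IsDiagonalSemigroup.intervalIntegrable (hS : IsDiagonalSemigroup b lam S)
    (hlam : ∀ n, 0 ≤ lam n) {t : ℝ} (ht : 0 ≤ t) (hg : IntervalIntegrable g volume 0 t) :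
    IntervalIntegrable (fun s => S (t - s) (g s)) volume 0 t := by
  rw [intervalIntegrable_iff_integrableOn_Ioc_of_le ht] at hg ⊢
  refine Integrable.mono hg ?_ ?_
  · refine aestronglyMeasurable_of_coeff b fun n => ?_
    have h1 : AEStronglyMeasurable (fun s => Real.exp (-lam n * (t - s)) * inner ℝ (b n) (g s))
        (volume.restrict (Ioc 0 t)) :=
      (Continuous.aestronglyMeasurable (by fun_prop)).mul (hg.1.const_inner (c := b n))
    refine h1.congr ?_
    filter_upwards [ae_restrict_mem measurableSet_Ioc] with s hs
    rw [hS _ (by linarith [hs.2])]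
  · filter_upwards [ae_restrict_mem measurableSet_Ioc] with s hs
    exact hS.norm_le hlam (by linarith [hs.2]) _

lemma IsDiagonalSemigroup.coeff_duhamel [CompleteSpace X] (hS : IsDiagonalSemigroup b lam S)
    (hlam : ∀ n, 0 ≤ lam n) {t : ℝ} (ht : 0 ≤ t) (hg : IntervalIntegrable g volume 0 t)
    (x : X) (n : ℕ) :
    inner ℝ (b n) (S t x + ∫ s in (0 : ℝ)..t, S (t - s) (g s)) =
      scalarDuhamel (lam n) (inner ℝ (b n) x) (fun s => inner ℝ (b n) (g s)) t := by
  have h1 := (innerSL ℝ (b n)).intervalIntegral_comp_comm (hS.intervalIntegrable hlam ht hg)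
  simp only [innerSL_apply_apply] at h1
  rw [inner_add_right, hS t ht, ← h1, scalarDuhamel, mul_add, ← intervalIntegral.integral_const_mul]
  congr 1
  refine intervalIntegral.integral_congr fun s hs => ?_
  rw [uIcc_of_le ht] at hs
  rw [hS _ (by linarith [hs.2]), ← mul_assoc, ← Real.exp_add]
  congr 2
  ring

lemma summable_integral_sq_coeff (hT : 0 ≤ T) (hg : MemLp g 2 (volume.restrict (Ioo 0 T))) :
    Summable fun n => ∫ s in (0 : ℝ)..T, (inner ℝ (b n) (g s)) ^ 2 := by
  have hTT : T ∈ Icc 0 T := ⟨hT, le_rfl⟩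
  have hint : IntervalIntegrable (fun s => ‖g s‖ ^ 2) volume 0 T := by
    have := (memLp_two_iff_integrable_sq_norm hg.1).1 hg
    rwa [intervalIntegrable_iff_integrableOn_Ioo_of_le hT]
  refine summable_of_sum_le (c := ∫ s in (0 : ℝ)..T, ‖g s‖ ^ 2)
    (fun n => intervalIntegral.integral_nonneg hT fun _ _ => sq_nonneg _) fun F => ?_
  rw [← intervalIntegral.integral_finsetSum fun n _ =>
    intervalIntegrable_sq_of_memLp_two (memLp_two_coeff hg n) hTT]
  refine intervalIntegral.integral_mono_on hT (by
    simpa only [Finset.sum_fn] using IntervalIntegrable.sum F fun n _ =>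
      intervalIntegrable_sq_of_memLp_two (memLp_two_coeff (b := b) hg n) hTT) hint fun s _ => ?_
  simpa using sum_le_hasSum F (fun n _ => sq_nonneg _) (hasSum_sq_coeff b (g s))

/-- Maximal `L²` regularity for `u' = A u + g`, `A = diag (-lam n)`. The curve `v` is `A u`; the
last two conclusions give continuity in the form domain of `A`. -/
theorem IsDiagonalSemigroup.duhamel_regularity [CompleteSpace X]
    (hS : IsDiagonalSemigroup b lam S) (hlam : ∀ n, 0 ≤ lam n) (hT : 0 ≤ T)
    (hg : MemLp g 2 (volume.restrict (Ioo 0 T))) {x : X}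
    (hx : Summable fun n => lam n * (inner ℝ (b n) x) ^ 2) {u : ℝ → X}
    (hu : ∀ t ∈ Icc 0 T, u t = S t x + ∫ s in (0 : ℝ)..t, S (t - s) (g s)) :
    (∃ v : ℝ → X, MemLp v 2 (volume.restrict (Ioo 0 T)) ∧
      (∀ᵐ t ∂(volume.restrict (Ioo 0 T)), ∀ n,
        inner ℝ (b n) (v t) = -lam n * inner ℝ (b n) (u t)) ∧
      ∀ t ∈ Icc 0 T, u t = u 0 + ∫ s in (0 : ℝ)..t, (v s + g s)) ∧
    (∀ n, ContinuousOn (fun t => inner ℝ (b n) (u t)) (Icc 0 T)) ∧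
    ∃ B : ℕ → ℝ, Summable B ∧
      ∀ t ∈ Icc 0 T, ∀ n, (1 + lam n) * (inner ℝ (b n) (u t)) ^ 2 ≤ B n := by
  set c : ℕ → ℝ := fun n => inner ℝ (b n) x with hc
  set γ : ℕ → ℝ → ℝ := fun n s => inner ℝ (b n) (g s) with hγ
  set p : ℕ → ℝ → ℝ := fun n => scalarDuhamel (lam n) (c n) (γ n) with hp
  have hγL : ∀ n, MemLp (γ n) 2 (volume.restrict (Ioo 0 T)) := memLp_two_coeff hg
  have hγt : ∀ n, ∀ t ∈ Icc 0 T, MemLp (γ n) 2 (volume.restrict (Ioo 0 t)) := fun n t ht =>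
    memLp_restrict_Ioo_mono (hγL n) ht
  have hup : ∀ t ∈ Icc 0 T, ∀ n, inner ℝ (b n) (u t) = p n t := fun t ht n => by
    rw [hu t ht, hS.coeff_duhamel hlam ht.1 (intervalIntegrable_of_memLp_two hg ht)]
  have hpc : ∀ n, ContinuousOn (p n) (Icc 0 T) := fun n => scalarDuhamel_continuousOn hT (hγL n)
  have hΓ : Summable fun n => ∫ s in (0 : ℝ)..T, γ n s ^ 2 := summable_integral_sq_coeff hT hg
  have hc2 : Summable fun n => c n ^ 2 := (hasSum_sq_coeff b x).summable
  have hp_nonneg : ∀ n t, 0 ≤ t → 0 ≤ ∫ s in (0 : ℝ)..t, p n s ^ 2 := fun n t ht =>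
    intervalIntegral.integral_nonneg ht fun _ _ => sq_nonneg _
  refine ⟨?_, fun n => (hpc n).congr fun t ht => hup t ht n, ?_⟩
  -- square summability of `A u` in `L²(0, T; X)`
  · have hsum : Summable fun n => (lam n) ^ 2 * ∫ s in (0 : ℝ)..T, p n s ^ 2 := by
      refine Summable.of_nonneg_of_le (fun n => mul_nonneg (sq_nonneg _) (hp_nonneg n T hT))
        (fun n => ?_) (hx.add hΓ)
      have h1 := scalarDuhamel_energy (l := lam n) (c := c n) (hγL n) hT
      have h2 := mul_nonneg (hlam n) (sq_nonneg (p n T))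
      linarith
    set μ := volume.restrict (Ioo 0 T) with hμ
    have hpm : ∀ n, AEStronglyMeasurable (p n) μ := fun n =>
      ((hpc n).mono Ioo_subset_Icc_self).aestronglyMeasurable measurableSet_Ioo
    have hlint : ∀ n, ∫⁻ t, ENNReal.ofReal ((lam n * p n t) ^ 2) ∂μ =
        ENNReal.ofReal ((lam n) ^ 2 * ∫ s in (0 : ℝ)..T, p n s ^ 2) := by
      intro n
      rw [← ofReal_integral_eq_lintegral_ofReal]
      · rw [intervalIntegral.integral_of_le hT, integral_Ioc_eq_integral_Ioo,
          ← integral_const_mul]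
        simp only [mul_pow, hμ]
      · have h1 : IntegrableOn (fun t => (lam n * p n t) ^ 2) (Icc 0 T) :=
          ContinuousOn.integrableOn_Icc (((hpc n).const_mul _).pow 2)
        exact h1.mono_set Ioo_subset_Icc_self
      · exact Eventually.of_forall fun t => sq_nonneg _
    -- by Tonelli, for almost every `t` the numbers `-lam n * p n t` are the coefficients of a
    -- vector `v t`, and `v` is square integrable
    have htot : ∫⁻ t, ∑' n, ENNReal.ofReal ((lam n * p n t) ^ 2) ∂μ ≠ ⊤ := by
      rw [lintegral_tsum]
      · simp_rw [hlint]
        exact hsum.tsum_ofReal_ne_top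
      · exact fun n => (((hpm n).aemeasurable.const_mul _).pow_const 2).ennreal_ofReal
    have hmeas : AEMeasurable (fun t => ∑' n, ENNReal.ofReal ((lam n * p n t) ^ 2)) μ :=
      AEMeasurable.tsum fun n =>
        (((hpm n).aemeasurable.const_mul _).pow_const 2).ennreal_ofReal
    have hae : ∀ᵐ t ∂μ, Summable fun n => (-lam n * p n t) ^ 2 := by
      filter_upwards [ae_lt_top' hmeas htot] with t ht
      have := ENNReal.summable_toReal ht.ne
      refine this.congr fun n => ?_
      rw [ENNReal.toReal_ofReal (sq_nonneg _)]
      ring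
    have hex : ∀ t, ∃ y : X, (Summable fun n => (-lam n * p n t) ^ 2) →
        ∀ n, inner ℝ (b n) y = -lam n * p n t := by
      intro t
      by_cases h : Summable fun n => (-lam n * p n t) ^ 2
      · obtain ⟨y, hy⟩ := exists_coeff_eq b h
        exact ⟨y, fun _ => hy⟩
      · exact ⟨0, fun h' => absurd h' h⟩
    choose v hv using hex
    have hvae : ∀ᵐ t ∂μ, ∀ n, inner ℝ (b n) (v t) = -lam n * p n t := by
      filter_upwards [hae] with t ht using hv t ht
    have hvm : AEStronglyMeasurable v μ := by
      refine aestronglyMeasurable_of_coeff b fun n => ?_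
      refine ((hpm n).const_mul (-lam n)).congr ?_
      filter_upwards [hvae] with t ht using (ht n).symm
    have hvL : MemLp v 2 μ := by
      rw [memLp_two_iff_integrable_sq_norm hvm]
      refine ⟨(hvm.norm.pow 2), ?_⟩
      rw [hasFiniteIntegral_iff_ofReal (Eventually.of_forall fun t => sq_nonneg _)]
      refine lt_of_eq_of_lt (lintegral_congr_ae ?_) htot.lt_top
      filter_upwards [hvae, hae] with t ht hts
      rw [← (hasSum_sq_coeff b (v t)).tsum_eq, ENNReal.ofReal_tsum_of_nonneg
        (fun n => sq_nonneg _) (hasSum_sq_coeff b (v t)).summable]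
      congr 1
      ext n
      rw [ht n, neg_mul, neg_sq]
    have h0 : ∀ n, inner ℝ (b n) (u 0) = c n := fun n => by
      rw [hup 0 ⟨le_rfl, hT⟩]
      exact scalarDuhamel_zero
    refine ⟨v, hvL, ?_, fun t ht => ext_coeff b fun n => ?_⟩
    · filter_upwards [hvae, ae_restrict_mem measurableSet_Ioo] with t ht htT n
      rw [ht n, hup t (Ioo_subset_Icc_self htT)]
    -- `u` is the integral of `v + g`, coefficient by coefficient
    · have hvg : IntervalIntegrable (fun s => v s + g s) volume 0 t :=
        intervalIntegrable_of_memLp_two (hvL.add hg) ht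
      have h1 := (innerSL ℝ (b n)).intervalIntegral_comp_comm hvg
      simp only [innerSL_apply_apply] at h1
      rw [hup t ht, inner_add_right, h0, ← h1, hp]
      simp only
      rw [scalarDuhamel_eq_integral (hγt n t ht) ht.1]
      congr 1
      refine intervalIntegral.integral_congr_ae ?_
      rw [ae_restrict_iff' measurableSet_Ioo] at hvae
      have hne : ∀ᵐ s : ℝ, s ≠ t := by simp [ae_iff, measure_singleton]
      filter_upwards [hvae, hne] with s hs hst hs'
      rw [uIoc_of_le ht.1] at hs'
      rw [inner_add_right, hs ⟨hs'.1, lt_of_lt_of_le (lt_of_le_of_ne hs'.2 hst) ht.2⟩ n]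
  -- the majorant: the first summand bounds `p n t ^ 2`, the second `lam n * p n t ^ 2`
  · refine ⟨fun n => Real.exp T * (c n ^ 2 + ∫ s in (0 : ℝ)..T, γ n s ^ 2) +
      (lam n * c n ^ 2 + ∫ s in (0 : ℝ)..T, γ n s ^ 2),
      ((hc2.add hΓ).mul_left _).add (hx.add hΓ), fun t ht n => ?_⟩
    rw [hup t ht]
    have h1 := scalarDuhamel_energy (l := lam n) (c := c n) (hγt n t ht) ht.1
    have h2 := scalarDuhamel_sq_le (c := c n) (hlam n) (hγt n t ht) ht.1
    have h3 := mul_nonneg (sq_nonneg (lam n)) (hp_nonneg n t ht.1)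
    have h4 := integral_sq_le_integral_sq (hγL n) ht
    have h5 : 0 ≤ ∫ s in (0 : ℝ)..t, γ n s ^ 2 :=
      intervalIntegral.integral_nonneg ht.1 fun _ _ => sq_nonneg _
    have h6 : Real.exp t * (c n ^ 2 + ∫ s in (0 : ℝ)..t, γ n s ^ 2) ≤
        Real.exp T * (c n ^ 2 + ∫ s in (0 : ℝ)..T, γ n s ^ 2) := by
      have := Real.exp_le_exp.2 ht.2
      gcongr
    rw [add_mul, one_mul]
    linarith

end Duhamel

/-! ### The weighted Sobolev space -/

lemma measurableSet_I : MeasurableSet I := measurableSet_Ioo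

instance : IsFiniteMeasure volI := ⟨by simp [I]⟩

instance : NeBot (ae volI) := by
  rw [ae_neBot]
  intro h
  have := congrArg (fun μ : Measure ℝ => μ univ) h
  simp [I] at this
  exact absurd this (by norm_num)

lemma zero_mem_I : (0 : ℝ) ∈ I := ⟨by norm_num, by norm_num⟩

lemma uIcc_subset_I {a b : ℝ} (ha : a ∈ I) (hb : b ∈ I) : uIcc a b ⊆ I :=
  (ordConnected_Ioo (a := (-1 : ℝ)) (b := 1)).uIcc_subset ha hb

lemma mem_I_iff_abs {x : ℝ} : x ∈ I ↔ |x| < 1 := abs_lt.symm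

lemma rho_pos {ρ₀ x : ℝ} (hρ : 0 < ρ₀) (hx : x ∈ I) : 0 < rho ρ₀ x := by
  have : x ^ 2 < 1 := by
    rw [sq_lt_one_iff_abs_lt_one]
    exact mem_I_iff_abs.1 hx
  exact mul_pos hρ (by linarith)

lemma continuous_rho (ρ₀ : ℝ) : Continuous (rho ρ₀) := by
  unfold rho
  fun_prop

lemma ACLoc.continuousOn {f : ℝ → ℝ} (hf : ACLoc f) : ContinuousOn f I := by
  intro x hx
  obtain ⟨hx1, hx2⟩ : -1 < x ∧ x < 1 := hx
  have ha : (x - 1) / 2 ∈ I := ⟨by linarith, by linarith⟩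
  have hb : (x + 1) / 2 ∈ I := ⟨by linarith, by linarith⟩
  have hc := (hf _ ha _ hb).continuousOn
  rw [uIcc_of_le (by linarith)] at hc
  exact (hc.continuousAt (Icc_mem_nhds (by linarith) (by linarith))).continuousWithinAt

/-- A function whose increments are bounded by those of an absolutely continuous function is
absolutely continuous. -/
lemma absolutelyContinuousOnInterval_of_dist_le {X Y : Type*} [PseudoMetricSpace X]
    [PseudoMetricSpace Y] {f : ℝ → X} {g : ℝ → Y} {a b C : ℝ}
    (hg : AbsolutelyContinuousOnInterval g a b)
    (h : ∀ x ∈ uIcc a b, ∀ y ∈ uIcc a b, dist (f x) (f y) ≤ C * dist (g x) (g y)) :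
    AbsolutelyContinuousOnInterval f a b := by
  have h0 : Tendsto (fun E : ℕ × (ℕ → ℝ × ℝ) =>
      C * ∑ i ∈ Finset.range E.1, dist (g (E.2 i).1) (g (E.2 i).2))
      (AbsolutelyContinuousOnInterval.totalLengthFilter ⊓
        𝓟 (AbsolutelyContinuousOnInterval.disjWithin a b)) (𝓝 0) := by
    simpa using Tendsto.const_mul C hg
  refine squeeze_zero' (Eventually.of_forall fun E => Finset.sum_nonneg fun i _ => dist_nonneg)
    ?_ h0
  filter_upwards [mem_inf_of_right (mem_principal_self _)] with E hE
  rw [Finset.mul_sum]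
  exact Finset.sum_le_sum fun i hi => h _ (hE.1 i hi).1 _ (hE.1 i hi).2

lemma acLoc_of_symm {f : ℝ → ℝ}
    (h : ∀ m : ℝ, 0 < m → m < 1 → AbsolutelyContinuousOnInterval f (-m) m) : ACLoc f := by
  intro a ha b hb
  rw [mem_I_iff_abs] at ha hb
  obtain ⟨m, hm, hm1⟩ := exists_between (max_lt ha hb)
  have ham := (le_max_left |a| |b|).trans hm.le
  have hbm := (le_max_right |a| |b|).trans hm.le
  have hm0 : 0 < m := lt_of_le_of_lt (le_max_of_le_left (abs_nonneg a)) hm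
  refine (h m hm0 hm1).mono (uIcc_subset_uIcc ?_ ?_) <;>
    rw [uIcc_of_le (by linarith)]
  · exact abs_le.1 ham
  · exact abs_le.1 hbm

lemma ae_volI_of_symm {P : ℝ → Prop}
    (h : ∀ m : ℝ, 0 < m → m < 1 → ∀ᵐ x, x ∈ uIcc (-m) m → P x) : ∀ᵐ x ∂volI, P x := by
  have h1 : ∀ᵐ x : ℝ, ∀ n : ℕ, x ∈ uIcc (-(1 - 1 / ((n : ℝ) + 2))) (1 - 1 / ((n : ℝ) + 2)) →
      P x := by
    refine ae_all_iff.2 fun n => h _ ?_ ?_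
    · have : (1 : ℝ) / (n + 2) < 1 := by
        rw [div_lt_one (by positivity)]
        have : (0 : ℝ) ≤ n := Nat.cast_nonneg n
        linarith
      linarith
    · have : (0 : ℝ) < 1 / (n + 2) := by positivity
      linarith
  rw [ae_restrict_iff' measurableSet_I]
  filter_upwards [h1] with x hx hxI
  obtain ⟨n, hn⟩ := exists_nat_one_div_lt (show (0 : ℝ) < 1 - |x| by
    linarith [mem_I_iff_abs.1 hxI])
  have h3 : 1 / ((n : ℝ) + 2) ≤ 1 / ((n : ℝ) + 1) :=
    one_div_le_one_div_of_le (by positivity) (by linarith)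
  have h4 : |x| ≤ 1 - 1 / ((n : ℝ) + 2) := by linarith
  refine hx n ?_
  rw [uIcc_of_le (by linarith [abs_nonneg x])]
  exact abs_le.1 h4

lemma memLp_coe (w : L2I) : MemLp w 2 volI := Lp.memLp w

lemma integrable_coe (w : L2I) : Integrable w volI := (Lp.memLp w).integrable (by norm_num)

lemma inner_L2I (u v : L2I) : inner ℝ u v = ∫ x, u x * v x ∂volI := by
  rw [L2.inner_def]
  exact integral_congr_ae (Eventually.of_forall fun x => mul_comm _ _)

lemma integrable_mul_coe (u v : L2I) : Integrable (fun x => u x * v x) volI :=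
  (Lp.memLp u).integrable_mul (Lp.memLp v)

lemma exists_integral_abs_le : ∃ K : ℝ, 0 ≤ K ∧ ∀ p : L2I, ∫ x, |p x| ∂volI ≤ K * ‖p‖ := by
  have h1 : MemLp (fun _ : ℝ => (1 : ℝ)) 2 volI := memLp_const 1
  refine ⟨‖h1.toLp _‖, norm_nonneg _, fun p => ?_⟩
  have h2 := real_inner_le_norm (h1.toLp _) (|p|)
  rw [norm_abs_eq_norm, inner_L2I] at h2
  refine le_trans (le_of_eq (integral_congr_ae ?_)) h2
  filter_upwards [h1.coeFn_toLp, Lp.coeFn_abs p] with x hx1 hx2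
  rw [hx1, hx2, one_mul]

lemma integrable_iff_intervalIntegrable {h : ℝ → ℝ} :
    Integrable h volI ↔ IntervalIntegrable h volume (-1) 1 := by
  rw [intervalIntegrable_iff_integrableOn_Ioo_of_le (by norm_num)]
  rfl

lemma integral_volI (h : ℝ → ℝ) : ∫ x, h x ∂volI = ∫ x in (-1 : ℝ)..1, h x := by
  rw [intervalIntegral.integral_of_le (by norm_num), integral_Ioc_eq_integral_Ioo]
  rfl

/-- The primitive `∫_0^x p / √ρ`; for `p = √ρ w_x` it equals `w x - w 0`. -/
def wprim (ρ₀ : ℝ) (p : ℝ → ℝ) (x : ℝ) : ℝ := ∫ s in (0 : ℝ)..x, p s / √(rho ρ₀ s)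

section Primitive

variable {ρ₀ : ℝ}

lemma intervalIntegrable_div_sqrt_rho (hρ : 0 < ρ₀) {p : ℝ → ℝ} (hp : Integrable p volI) {a b : ℝ}
    (ha : a ∈ I) (hb : b ∈ I) : IntervalIntegrable (fun s => p s / √(rho ρ₀ s)) volume a b := by
  have h1 : IntervalIntegrable p volume a b := by
    refine (integrable_iff_intervalIntegrable.1 hp).mono_set ?_
    refine (uIcc_subset_I ha hb).trans ?_
    rw [uIcc_of_le (by norm_num)]
    exact Ioo_subset_Icc_self
  simp_rw [div_eq_mul_inv]
  refine h1.mul_continuousOn ?_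
  refine ContinuousOn.inv₀ ((continuous_rho ρ₀).sqrt.continuousOn) fun x hx => ?_
  exact (Real.sqrt_pos.2 (rho_pos hρ (uIcc_subset_I ha hb hx))).ne'

lemma acLoc_const_add_wprim (hρ : 0 < ρ₀) {p : ℝ → ℝ} (hp : Integrable p volI) (c : ℝ) :
    ACLoc (fun x => c + wprim ρ₀ p x) := by
  refine acLoc_of_symm fun m hm hm1 => ?_
  have h1 := (intervalIntegrable_div_sqrt_rho hρ hp (a := -m) (b := m) ⟨by linarith, by linarith⟩
    ⟨by linarith, by linarith⟩).absolutelyContinuousOnInterval_intervalIntegral (c := 0)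
    (by rw [uIcc_of_le (by linarith)]; exact ⟨by linarith, hm.le⟩)
  exact ((LipschitzWith.const c).lipschitzOnWith.absolutelyContinuousOnInterval).add h1

lemma ae_deriv_const_add_wprim (hρ : 0 < ρ₀) {p : ℝ → ℝ} (hp : Integrable p volI) (c : ℝ) :
    ∀ᵐ x ∂volI, deriv (fun x => c + wprim ρ₀ p x) x = p x / √(rho ρ₀ x) := by
  refine ae_volI_of_symm fun m hm hm1 => ?_
  filter_upwards [(intervalIntegrable_div_sqrt_rho hρ hp (a := -m) (b := m)
    ⟨by linarith, by linarith⟩ ⟨by linarith, by linarith⟩).ae_hasDerivAt_integral] with x hx hxm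
  exact ((hx hxm 0 (by rw [uIcc_of_le (by linarith)]; exact ⟨by linarith, hm.le⟩)).const_add
    c).deriv

/-- Recovery of a class of `V` from its weighted derivative. -/
lemma HasWeightedDeriv.eq_add_wprim (hρ : 0 < ρ₀) {w p : L2I} {f : ℝ → ℝ}
    (h : HasWeightedDeriv ρ₀ w p f) {x : ℝ} (hx : x ∈ I) : f x = f 0 + wprim ρ₀ p x := by
  rw [wprim, ← sub_eq_iff_eq_add', ← (h.1 0 zero_mem_I x hx).integral_deriv_eq_sub]
  refine intervalIntegral.integral_congr_ae ?_
  have h2 := h.2.2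
  rw [EventuallyEq, ae_restrict_iff' measurableSet_I] at h2
  filter_upwards [h2] with s hs hs'
  have hsI : s ∈ I := uIcc_subset_I zero_mem_I hx (uIoc_subset_uIcc hs')
  rw [hs hsI]
  have := (Real.sqrt_pos.2 (rho_pos hρ hsI)).ne'
  field_simp

lemma wprim_sub (hρ : 0 < ρ₀) (p q : L2I) {x : ℝ} (hx : x ∈ I) :
    wprim ρ₀ (p - q : L2I) x = wprim ρ₀ p x - wprim ρ₀ q x := by
  rw [wprim, wprim, wprim, ← intervalIntegral.integral_sub
    (intervalIntegrable_div_sqrt_rho hρ (integrable_coe p) zero_mem_I hx)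
    (intervalIntegrable_div_sqrt_rho hρ (integrable_coe q) zero_mem_I hx)]
  refine intervalIntegral.integral_congr_ae ?_
  have h2 := Lp.coeFn_sub p q
  rw [EventuallyEq, ae_restrict_iff' measurableSet_I] at h2
  filter_upwards [h2] with s hs hs'
  rw [hs (uIcc_subset_I zero_mem_I hx (uIoc_subset_uIcc hs'))]
  simp [sub_div]

/-- On a compact subinterval of `I` the weight is bounded below, so that the primitive is a bounded
function of `p ∈ L²(I)`. -/
lemma exists_abs_wprim_le (hρ : 0 < ρ₀) {m : ℝ} (hm : m < 1) :
    ∃ C : ℝ, 0 ≤ C ∧ ∀ (p : L2I) (x : ℝ), |x| ≤ m → |wprim ρ₀ p x| ≤ C * ‖p‖ := by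
  obtain ⟨K, hK, hKp⟩ := exists_integral_abs_le
  by_cases hm0 : m < 0
  · exact ⟨0, le_rfl, fun p x hx => absurd ((abs_nonneg x).trans hx) (not_le.2 hm0)⟩
  push Not at hm0
  have hmI : m ∈ I := ⟨by linarith, hm⟩
  set κ := √(rho ρ₀ m) with hκ
  have hκ0 : 0 < κ := Real.sqrt_pos.2 (rho_pos hρ hmI)
  refine ⟨K / κ, by positivity, fun p x hx => ?_⟩
  have hxI : x ∈ I := mem_I_iff_abs.2 (lt_of_le_of_lt hx hm)
  have hint : Integrable (fun s => |p s| / κ) volI := (integrable_coe p).abs.div_const κ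
  have hsub : uIoc 0 x ⊆ I := uIoc_subset_uIcc.trans (uIcc_subset_I zero_mem_I hxI)
  calc |wprim ρ₀ p x| ≤ ∫ s in uIoc 0 x, |p s / √(rho ρ₀ s)| := by
        have := intervalIntegral.norm_integral_le_integral_norm_uIoc
          (f := fun s => p s / √(rho ρ₀ s)) (a := 0) (b := x) (μ := volume)
        simpa only [wprim, Real.norm_eq_abs] using this
    _ ≤ ∫ s in uIoc 0 x, |p s| / κ := by
        refine setIntegral_mono_on ?_ ?_ measurableSet_uIoc fun s hs => ?_
        · exact (intervalIntegrable_iff.1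
            (intervalIntegrable_div_sqrt_rho hρ (integrable_coe p) zero_mem_I hxI)).abs
        · exact IntegrableOn.mono_set hint hsub
        · rw [abs_div, abs_of_nonneg (Real.sqrt_nonneg _)]
          have hs1 : |s| ≤ m := by
            have := abs_sub_left_of_mem_uIcc (uIoc_subset_uIcc hs)
            rw [sub_zero, sub_zero] at this
            exact this.trans hx
          have hs2 : s ^ 2 ≤ m ^ 2 := sq_le_sq' (abs_le.1 hs1).1 (abs_le.1 hs1).2
          have : κ ≤ √(rho ρ₀ s) := by
            apply Real.sqrt_le_sqrt
            unfold rho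
            gcongr
          gcongr
    _ ≤ ∫ s, |p s| / κ ∂volI :=
        setIntegral_mono_set hint (Eventually.of_forall fun s => by positivity)
          (Eventually.of_forall hsub)
    _ = (∫ s, |p s| ∂volI) / κ := integral_div _ _
    _ ≤ K * ‖p‖ / κ := by gcongr; exact hKp p
    _ = _ := by ring

end Primitive

namespace V

variable {ρ₀ : ℝ}

/-- The inclusion `V ⊆ L²(I)` as a continuous linear map. -/
def toL2CLM (ρ₀ : ℝ) : V ρ₀ →L[ℝ] L2I :=
  (WithLp.fstL 2 ℝ L2I L2I).comp (VGraph ρ₀).subtypeL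

@[simp] lemma toL2CLM_apply (w : V ρ₀) : toL2CLM ρ₀ w = w.toL2 := rfl

lemma toL2_sub (u v : V ρ₀) : (u - v).toL2 = u.toL2 - v.toL2 := rfl

lemma toL2_smul (c : ℝ) (u : V ρ₀) : (c • u).toL2 = c • u.toL2 := rfl

lemma wderiv_smul (c : ℝ) (u : V ρ₀) : (c • u).wderiv = c • u.wderiv := rfl

lemma norm_sq_eq (u : V ρ₀) : ‖u‖ ^ 2 = ‖u.toL2‖ ^ 2 + ‖u.wderiv‖ ^ 2 := by
  simp only [← real_inner_self_eq_norm_sq]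
  exact inner_eq u u

lemma norm_toL2_le (u : V ρ₀) : ‖u.toL2‖ ≤ ‖u‖ :=
  (abs_le_of_sq_le_sq' (by nlinarith [norm_sq_eq u, sq_nonneg ‖u.wderiv‖]) (norm_nonneg _)).2

lemma norm_wderiv_le (u : V ρ₀) : ‖u.wderiv‖ ≤ ‖u‖ :=
  (abs_le_of_sq_le_sq' (by nlinarith [norm_sq_eq u, sq_nonneg ‖u.toL2‖]) (norm_nonneg _)).2

lemma exists_of_hasWeightedDeriv {w p : L2I} {f : ℝ → ℝ} (h : HasWeightedDeriv ρ₀ w p f) :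
    ∃ u : V ρ₀, u.toL2 = w ∧ u.wderiv = p :=
  ⟨⟨WithLp.toLp 2 (w, p), f, h⟩, rfl, rfl⟩

lemma rep_eqOn {u : V ρ₀} {f : ℝ → ℝ} (hf : ACLoc f) (h : u.toL2 =ᵐ[volI] f) : EqOn u.rep f I :=
  u.rep_spec.1.eqOn_of_ae_eq hf (u.rep_spec.2.1.symm.trans h)

/-- A locally absolutely continuous `f ∈ L²(I)` with `√ρ f' ∈ L²(I)` defines an element of `V`. -/
lemma exists_rep {f : ℝ → ℝ} (hf : ACLoc f) (h2 : MemLp f 2 volI)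
    (hd : MemLp (fun x => √(rho ρ₀ x) * deriv f x) 2 volI) :
    ∃ u : V ρ₀, u.toL2 =ᵐ[volI] f ∧ EqOn u.rep f I ∧
      u.wderiv =ᵐ[volI] fun x => √(rho ρ₀ x) * deriv f x := by
  obtain ⟨u, hu1, hu2⟩ := exists_of_hasWeightedDeriv (ρ₀ := ρ₀) (w := h2.toLp f)
    (p := hd.toLp _) (f := f) ⟨hf, h2.coeFn_toLp, hd.coeFn_toLp⟩
  have h1 : u.toL2 =ᵐ[volI] f := by rw [hu1]; exact h2.coeFn_toLp
  exact ⟨u, h1, rep_eqOn hf h1, by rw [hu2]; exact hd.coeFn_toLp⟩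

lemma rep_eq_add_wprim (hρ : 0 < ρ₀) (u : V ρ₀) {x : ℝ} (hx : x ∈ I) :
    u.rep x = u.rep 0 + wprim ρ₀ u.wderiv x :=
  u.rep_spec.eq_add_wprim hρ hx

lemma rep_sub (u v : V ρ₀) {x : ℝ} (hx : x ∈ I) : (u - v).rep x = u.rep x - v.rep x := by
  refine rep_eqOn (u := u - v) (f := fun x => u.rep x - v.rep x)
    (fun a ha b hb => (u.rep_spec.1 a ha b hb).sub (v.rep_spec.1 a ha b hb)) ?_ hx
  rw [toL2_sub]
  filter_upwards [Lp.coeFn_sub u.toL2 v.toL2, u.rep_spec.2.1, v.rep_spec.2.1] with x h1 h2 h3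
  rw [h1, Pi.sub_apply, h2, h3]

/-- Point evaluations at interior points are bounded on `V`, locally uniformly. -/
lemma exists_abs_rep_le (hρ : 0 < ρ₀) {m : ℝ} (hm : m < 1) :
    ∃ C : ℝ, 0 ≤ C ∧ ∀ (u : V ρ₀) (x : ℝ), |x| ≤ m → |u.rep x| ≤ C * ‖u‖ := by
  obtain ⟨K, hK, hKp⟩ := exists_integral_abs_le
  obtain ⟨C₀, hC₀, h₀⟩ := exists_abs_wprim_le hρ (m := 1 / 2) (by norm_num)
  obtain ⟨C, hC, h⟩ := exists_abs_wprim_le hρ hm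
  refine ⟨K + C₀ + C, by positivity, fun u x hx => ?_⟩
  have hsub : Ioc (-(1 / 2) : ℝ) (1 / 2) ⊆ I := fun y hy => by
    exact ⟨by linarith [hy.1], by linarith [hy.2]⟩
  -- `|u 0|` is averaged over `[-1/2, 1/2]`, where `u` differs from `u 0` by a primitive
  have hzero : |u.rep 0| ≤ K * ‖u‖ + C₀ * ‖u‖ := by
    have h1 : ∫ _ in Ioc (-(1 / 2) : ℝ) (1 / 2), |u.rep 0| ≤
        ∫ y in Ioc (-(1 / 2) : ℝ) (1 / 2), (|u.rep y| + C₀ * ‖u‖) := by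
      have hi : IntegrableOn (fun y => |u.rep y|) (Ioc (-(1 / 2) : ℝ) (1 / 2)) :=
        IntegrableOn.mono_set ((integrable_coe u.toL2).congr u.rep_spec.2.1).abs hsub
      refine setIntegral_mono_on (integrable_const _) (hi.add (integrable_const _))
        measurableSet_Ioc fun y hy => ?_
      have h2 := rep_eq_add_wprim hρ u (hsub hy)
      have h3 := h₀ u.wderiv y (abs_le.2 ⟨hy.1.le, hy.2⟩)
      have h4 : |u.rep 0| ≤ |u.rep y| + |wprim ρ₀ u.wderiv y| := by
        have : u.rep 0 = u.rep y - wprim ρ₀ u.wderiv y := by linarith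
        rw [this]
        exact abs_sub _ _
      have h5 : C₀ * ‖u.wderiv‖ ≤ C₀ * ‖u‖ := by gcongr; exact norm_wderiv_le u
      linarith
    have h2 : ∫ y in Ioc (-(1 / 2) : ℝ) (1 / 2), (|u.rep y| + C₀ * ‖u‖) =
        (∫ y in Ioc (-(1 / 2) : ℝ) (1 / 2), |u.rep y|) + C₀ * ‖u‖ := by
      rw [integral_add]
      · simp; norm_num
      · exact IntegrableOn.mono_set ((integrable_coe u.toL2).congr u.rep_spec.2.1).abs hsub
      · exact integrable_const _
    have h3 : ∫ y in Ioc (-(1 / 2) : ℝ) (1 / 2), |u.rep y| ≤ K * ‖u‖ := by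
      calc _ ≤ ∫ y, |u.rep y| ∂volI :=
            setIntegral_mono_set ((integrable_coe u.toL2).congr u.rep_spec.2.1).abs
              (Eventually.of_forall fun s => abs_nonneg _) (Eventually.of_forall hsub)
        _ = ∫ y, |u.toL2 y| ∂volI := integral_congr_ae (by
            filter_upwards [u.rep_spec.2.1] with y hy
            rw [hy])
        _ ≤ K * ‖u.toL2‖ := hKp _
        _ ≤ K * ‖u‖ := by gcongr; exact norm_toL2_le u
    have h4 : ∫ _ in Ioc (-(1 / 2) : ℝ) (1 / 2), |u.rep 0| = |u.rep 0| := by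
      simp; norm_num
    linarith
  have h1 := rep_eq_add_wprim hρ u (mem_I_iff_abs.2 (lt_of_le_of_lt hx hm))
  have h2 : C * ‖u.wderiv‖ ≤ C * ‖u‖ := by gcongr; exact norm_wderiv_le u
  calc |u.rep x| ≤ |u.rep 0| + |wprim ρ₀ u.wderiv x| := by rw [h1]; exact abs_add_le _ _
    _ ≤ K * ‖u‖ + C₀ * ‖u‖ + C * ‖u‖ := by linarith [h u.wderiv x hx]
    _ = _ := by ring

end V

/-- `V` is complete: the operator `w ↦ √ρ w_x` is closed. -/
lemma isClosed_VGraph {ρ₀ : ℝ} (hρ : 0 < ρ₀) :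
    IsClosed (VGraph ρ₀ : Set (WithLp 2 (L2I × L2I))) := by
  refine isClosed_of_closure_subset fun z hz => ?_
  obtain ⟨zs, hzs, hlim⟩ := mem_closure_iff_seq_limit.1 hz
  choose f hf using hzs
  have h1 : Tendsto (fun k => (zs k).fst) atTop (𝓝 z.fst) :=
    ((WithLp.fstL 2 ℝ L2I L2I).continuous.tendsto z).comp hlim
  have h2 : Tendsto (fun k => (zs k).snd) atTop (𝓝 z.snd) :=
    ((WithLp.sndL 2 ℝ L2I L2I).continuous.tendsto z).comp hlim
  obtain ⟨ns, hns, hae⟩ := (tendstoInMeasure_of_tendsto_Lp h1).exists_seq_tendsto_ae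
  -- the primitives of the weighted derivatives converge at every point, the functions themselves
  -- almost everywhere along a subsequence; hence the values at `0` converge too, to `c`
  have hprim : ∀ x ∈ I, Tendsto (fun k => wprim ρ₀ (zs k).snd x) atTop
      (𝓝 (wprim ρ₀ z.snd x)) := by
    intro x hx
    obtain ⟨C, _, hC⟩ := exists_abs_wprim_le hρ (mem_I_iff_abs.1 hx)
    rw [tendsto_iff_norm_sub_tendsto_zero]
    have h3 := (tendsto_iff_norm_sub_tendsto_zero.1 h2).const_mul C
    rw [mul_zero] at h3
    refine squeeze_zero (fun _ => norm_nonneg _) (fun k => ?_) h3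
    rw [← wprim_sub hρ _ _ hx]
    exact hC _ x le_rfl
  have hall : ∀ᵐ x ∂volI, x ∈ I ∧ Tendsto (fun i => (zs (ns i)).fst x) atTop (𝓝 (z.fst x)) ∧
      ∀ k, (zs k).fst x = f k x := by
    filter_upwards [ae_restrict_mem measurableSet_I, hae, ae_all_iff.2 fun k => (hf k).2.1]
      with x h1 h2 h3 using ⟨h1, h2, h3⟩
  obtain ⟨x₀, hx₀I, hx₀, hx₀f⟩ := hall.exists
  set c := z.fst x₀ - wprim ρ₀ z.snd x₀ with hc
  have hc_lim : Tendsto (fun i => f (ns i) 0) atTop (𝓝 c) := by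
    have h3 := hx₀.sub ((hprim x₀ hx₀I).comp hns.tendsto_atTop)
    refine h3.congr fun i => ?_
    rw [hx₀f, (hf (ns i)).eq_add_wprim hρ hx₀I]
    simp
  refine ⟨fun x => c + wprim ρ₀ z.snd x, acLoc_const_add_wprim hρ (integrable_coe _) c, ?_, ?_⟩
  · filter_upwards [hall] with x hx
    obtain ⟨hxI, hx1, hx2⟩ := hx
    refine tendsto_nhds_unique hx1 ?_
    refine (hc_lim.add ((hprim x hxI).comp hns.tendsto_atTop)).congr fun i => ?_
    rw [hx2, (hf (ns i)).eq_add_wprim hρ hxI]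
    rfl
  · filter_upwards [ae_deriv_const_add_wprim hρ (integrable_coe z.snd) c,
      ae_restrict_mem measurableSet_I] with x hx hxI
    rw [hx]
    have := (Real.sqrt_pos.2 (rho_pos hρ hxI)).ne'
    field_simp

lemma completeSpace_V {ρ₀ : ℝ} (hρ : 0 < ρ₀) : CompleteSpace (V ρ₀) :=
  (isClosed_VGraph hρ).completeSpace_coe

/-! ### Integration by parts for the degenerate operator -/

/-- A function with a lower bound `c / |x - e|` near an endpoint `e` of `I` is not integrable. This
is what forces fluxes and boundary terms to vanish, without any boundary condition. -/
lemma false_of_div_abs_sub_le {h : ℝ → ℝ} (hh : Integrable h volI) {e c δ : ℝ}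
    (he : e = 1 ∨ e = -1) (hc : 0 < c) (hδ : 0 < δ)
    (hle : ∀ᵐ x ∂volI, |x - e| < δ → c / |x - e| ≤ h x) : False := by
  have key : ∀ a b : ℝ, a < b → Ioo a b ⊆ I → (∀ x ∈ Ioo a b, |x - e| < δ) →
      IntervalIntegrable (fun x => (x - e)⁻¹) volume a b := by
    intro a b hab hI hd
    rw [intervalIntegrable_iff_integrableOn_Ioo_of_le hab.le]
    have h1 : IntegrableOn (fun x => h x / c) (Ioo a b) :=
      IntegrableOn.mono_set (Integrable.div_const hh c) hI
    refine Integrable.mono h1 ?_ ?_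
    · exact (measurable_id.sub_const e).inv.aestronglyMeasurable
    · rw [ae_restrict_iff' measurableSet_I] at hle
      rw [ae_restrict_iff' measurableSet_Ioo]
      filter_upwards [hle] with x hx hxab
      have h2 := hx (hI hxab) (hd x hxab)
      rw [norm_inv, Real.norm_eq_abs, Real.norm_eq_abs, abs_div, abs_of_pos hc]
      rw [le_div_iff₀ hc]
      refine le_trans ?_ (le_abs_self _)
      rwa [inv_mul_eq_div]
  have hd1 : min δ 1 ≤ 1 := min_le_right _ _
  have hd2 : min δ 1 ≤ δ := min_le_left _ _
  have hd0 : 0 < min δ 1 := lt_min hδ one_pos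
  set d := min δ 1
  rcases he with rfl | rfl
  · have h1 := key (1 - d) 1 (by linarith) (fun x hx => ⟨by linarith [hx.1], hx.2⟩)
      (fun x hx => by rw [abs_lt]; constructor <;> linarith [hx.1, hx.2])
    rw [intervalIntegrable_sub_inv_iff] at h1
    rcases h1 with h1 | h1
    · linarith
    · exact h1 right_mem_uIcc
  · have h1 := key (-1) (-1 + d) (by linarith) (fun x hx => ⟨hx.1, by linarith [hx.2]⟩)
      (fun x hx => by rw [abs_lt]; constructor <;> linarith [hx.1, hx.2])
    rw [intervalIntegrable_sub_inv_iff] at h1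
    rcases h1 with h1 | h1
    · linarith
    · exact h1 left_mem_uIcc

lemma rho_le_abs_sub {ρ₀ x e : ℝ} (hρ : 0 < ρ₀) (he : e = 1 ∨ e = -1) (hx : x ∈ I) :
    rho ρ₀ x ≤ 2 * ρ₀ * |x - e| := by
  have h1 : 1 - x ^ 2 ≤ 2 * |x - e| := by
    rcases he with rfl | rfl
    · have := neg_abs_le (x - 1)
      nlinarith [hx.1, hx.2, abs_of_neg (show x - 1 < 0 by linarith [hx.2])]
    · nlinarith [hx.1, hx.2, abs_of_pos (show 0 < x - -1 by linarith [hx.1])]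
  unfold rho
  nlinarith

lemma endpoint_mem_Icc {e : ℝ} (he : e = 1 ∨ e = -1) : e ∈ Icc (-1 : ℝ) 1 := by
  rcases he with rfl | rfl <;> norm_num

lemma uIcc_neg_one_one : uIcc (-1 : ℝ) 1 = Icc (-1) 1 := uIcc_of_le (by norm_num)

section

variable {ρ₀ : ℝ} {u : V ρ₀} {g : ℝ → ℝ}

lemma wderiv_mul_wderiv (hρ : 0 < ρ₀) (hgu : g =ᵐ[volI] fun x => rho ρ₀ x * deriv u.rep x)
    (z : V ρ₀) : ∀ᵐ x ∂volI, u.wderiv x * z.wderiv x = g x * deriv z.rep x := by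
  filter_upwards [hgu, u.rep_spec.2.2, z.rep_spec.2.2, ae_restrict_mem measurableSet_I]
    with x h1 h2 h3 hx
  rw [h1, h2, h3]
  have := Real.mul_self_sqrt (rho_pos hρ hx).le
  linear_combination (deriv u.rep x * deriv z.rep x) * this

/-- The no-flux condition: `ρ u_x` vanishes at the endpoints. -/
lemma flux_eq_zero (hρ : 0 < ρ₀) (hg : AbsolutelyContinuousOnInterval g (-1) 1)
    (hgu : g =ᵐ[volI] fun x => rho ρ₀ x * deriv u.rep x) {e : ℝ} (he : e = 1 ∨ e = -1) :
    g e = 0 := by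
  by_contra hne
  have hcont : ContinuousWithinAt g (Icc (-1) 1) e := by
    have := hg.continuousOn
    rw [uIcc_neg_one_one] at this
    exact this e (endpoint_mem_Icc he)
  obtain ⟨δ, hδ, hδg⟩ := Metric.continuousWithinAt_iff.1 hcont (|g e| / 2) (by positivity)
  have hint : Integrable (fun x => u.wderiv x * u.wderiv x) volI := integrable_mul_coe _ _
  refine false_of_div_abs_sub_le hint (c := (|g e| / 2) ^ 2 / (2 * ρ₀)) he
    (by positivity) hδ ?_
  filter_upwards [hgu, u.rep_spec.2.2, ae_restrict_mem measurableSet_I] with x h1 h2 hx hxd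
  have h3 : dist (g x) (g e) < |g e| / 2 := hδg (Ioo_subset_Icc_self hx) hxd
  rw [Real.dist_eq] at h3
  have h4 : |g e| / 2 ≤ |g x| := by
    have := abs_sub_abs_le_abs_sub (g e) (g x)
    rw [abs_sub_comm] at this
    linarith
  have hr := rho_pos hρ hx
  have hxe : 0 < |x - e| := by
    have := rho_le_abs_sub hρ he hx
    by_contra hcon
    nlinarith
  -- `(√ρ u_x)² = g² / ρ`, and `ρ = O(|x - e|)`
  have h5 : u.wderiv x * u.wderiv x = g x ^ 2 / rho ρ₀ x := by
    rw [h2, h1, eq_div_iff hr.ne']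
    have := Real.mul_self_sqrt hr.le
    linear_combination (deriv u.rep x ^ 2 * rho ρ₀ x) * this
  rw [h5, div_div]
  have h6 : (|g e| / 2) ^ 2 ≤ g x ^ 2 := by
    rw [← sq_abs (g x)]
    gcongr
  have h7 := rho_le_abs_sub hρ he hx
  gcongr

/-- Near an endpoint where it vanishes, a function with square integrable derivative is
`O(√|x - e|)`. -/
lemma exists_sq_le_mul_abs_sub (hg : AbsolutelyContinuousOnInterval g (-1) 1)
    (hg2 : MemLp (deriv g) 2 volI) {e : ℝ} (he : e = 1 ∨ e = -1) (hge : g e = 0) :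
    ∃ Q : ℝ, 0 < Q ∧ ∀ x ∈ I, g x ^ 2 ≤ Q * |x - e| := by
  have hint : IntegrableOn (fun x => deriv g x ^ 2) (Ioc (-1) 1) := by
    rw [integrableOn_Ioc_iff_integrableOn_Ioo]
    exact hg2.integrable_sq
  set Q := ∫ x in Ioc (-1 : ℝ) 1, deriv g x ^ 2 with hQ
  have hQ0 : 0 ≤ Q := integral_nonneg fun _ => sq_nonneg _
  refine ⟨(Q + 1) ^ 2, by positivity, fun x hx => ?_⟩
  set d := |x - e| with hd
  have hd0 : 0 < d := by
    rw [hd, abs_pos]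
    rcases he with rfl | rfl
    · linarith [hx.2]
    · linarith [hx.1]
  have hs0 : 0 < √d := Real.sqrt_pos.2 hd0
  have hsub : uIcc e x ⊆ uIcc (-1) 1 := by
    rw [uIcc_neg_one_one]
    exact uIcc_subset_Icc (endpoint_mem_Icc he) (Ioo_subset_Icc_self hx)
  have hsub' : uIoc e x ⊆ Ioc (-1) 1 := by
    rcases he with rfl | rfl
    · rw [uIoc_of_ge hx.2.le]
      exact Ioc_subset_Ioc_left hx.1.le
    · rw [uIoc_of_le hx.1.le]
      exact Ioc_subset_Ioc_right hx.2.le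
  have hac := hg.mono hsub
  have h1 : g x = ∫ s in e..x, deriv g s := by rw [hac.integral_deriv_eq_sub, hge, sub_zero]
  have h2 : 2 * |g x| ≤ √d * (Q + 1) := by
    have h3 : |g x| ≤ ∫ s in uIoc e x, |deriv g s| := by
      rw [h1]
      simpa only [Real.norm_eq_abs] using
        intervalIntegral.norm_integral_le_integral_norm_uIoc (f := deriv g) (a := e) (b := x)
          (μ := volume)
    have hci : IntegrableOn (fun _ : ℝ => 1 / (2 * √d)) (uIoc e x) :=
      integrableOn_const (by simp [Real.volume_uIoc])
    -- Young's inequality with weight `√d`.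
    have h4 : ∫ s in uIoc e x, |deriv g s| ≤
        ∫ s in uIoc e x, (√d / 2 * deriv g s ^ 2 + 1 / (2 * √d)) := by
      refine integral_mono ?_ ?_ fun s => ?_
      · exact (intervalIntegrable_iff.1 hac.intervalIntegrable_deriv).abs
      · exact ((hint.mono_set hsub').const_mul _).add hci
      · have h5 : 0 ≤ (√d * |deriv g s| - 1) ^ 2 / (2 * √d) := by positivity
        have h6 : (√d * |deriv g s| - 1) ^ 2 / (2 * √d) =
            √d / 2 * deriv g s ^ 2 + 1 / (2 * √d) - |deriv g s| := by
          rw [← sq_abs (deriv g s)]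
          field_simp
          ring
        linarith
    have h7 : ∫ s in uIoc e x, (√d / 2 * deriv g s ^ 2 + 1 / (2 * √d)) =
        √d / 2 * (∫ s in uIoc e x, deriv g s ^ 2) + d * (1 / (2 * √d)) := by
      rw [integral_add ((hint.mono_set hsub').const_mul _) hci, integral_const_mul]
      congr 1
      simp [measureReal_def, Real.volume_uIoc, hd]
    have h8 : ∫ s in uIoc e x, deriv g s ^ 2 ≤ Q :=
      setIntegral_mono_set hint (Eventually.of_forall fun _ => sq_nonneg _)
        (Eventually.of_forall hsub')
    have h9 : d * (1 / (2 * √d)) = √d / 2 := by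
      have := Real.mul_self_sqrt hd0.le
      field_simp
      nlinarith
    have h10 : √d / 2 * (∫ s in uIoc e x, deriv g s ^ 2) ≤ √d / 2 * Q := by gcongr
    linarith
  have h3 : g x ^ 2 ≤ (√d * (Q + 1)) ^ 2 := by
    rw [← sq_abs]
    refine pow_le_pow_left₀ (abs_nonneg _) ?_ 2
    linarith [abs_nonneg (g x)]
  rw [mul_pow, Real.sq_sqrt hd0.le] at h3
  linarith

/-- Green's formula `(A u, z) = -(√ρ u_x, √ρ z_x)` for `u ∈ D(A)` and `z ∈ V`. -/
lemma inner_flux_deriv (hρ : 0 < ρ₀) (hg : AbsolutelyContinuousOnInterval g (-1) 1)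
    (hgu : g =ᵐ[volI] fun x => rho ρ₀ x * deriv u.rep x) {v : L2I} (hv : v =ᵐ[volI] deriv g)
    (z : V ρ₀) : inner ℝ v z.toL2 = -inner ℝ u.wderiv z.wderiv := by
  have hg2 : MemLp (deriv g) 2 volI := (memLp_coe v).ae_eq hv
  have hprod1 : ∀ᵐ x ∂volI, v x * z.toL2 x = deriv g x * z.rep x := by
    filter_upwards [hv, z.rep_spec.2.1] with x h1 h2
    rw [h1, h2]
  have hprod2 := wderiv_mul_wderiv hρ hgu z
  have hi1 : Integrable (fun x => deriv g x * z.rep x) volI :=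
    (integrable_mul_coe v z.toL2).congr hprod1
  have hi2 : Integrable (fun x => g x * deriv z.rep x) volI :=
    (integrable_mul_coe u.wderiv z.wderiv).congr hprod2
  have hi : IntervalIntegrable (fun x => deriv g x * z.rep x + g x * deriv z.rep x) volume (-1) 1 :=
    integrable_iff_intervalIntegrable.1 (hi1.add hi2)
  set P : ℝ → ℝ := fun x => ∫ s in (0 : ℝ)..x, (deriv g s * z.rep s + g s * deriv z.rep s) with hP
  have hPc : ContinuousOn P (Icc (-1) 1) := by
    have := intervalIntegral.continuousOn_primitive_interval' hi (a := 0)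
      (by rw [uIcc_neg_one_one]; norm_num)
    rwa [uIcc_neg_one_one] at this
  have hPeq : ∀ x ∈ I, P x = g x * z.rep x - g 0 * z.rep 0 := by
    intro x hx
    have hac1 : AbsolutelyContinuousOnInterval g 0 x := by
      refine hg.mono ?_
      rw [uIcc_neg_one_one]
      exact uIcc_subset_Icc (by norm_num) (Ioo_subset_Icc_self hx)
    exact hac1.integral_deriv_mul_eq_sub (z.rep_spec.1 0 zero_mem_I x hx)
  -- `P` extends `g z - (g z)(0)` continuously to the endpoints; the boundary terms of `g z` vanish
  have hend : ∀ e : ℝ, e = 1 ∨ e = -1 → P e = -(g 0 * z.rep 0) := by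
    intro e he
    -- the limit of `g z` at `e` is `L`
    set L := P e + g 0 * z.rep 0 with hL
    suffices L = 0 by linarith
    by_contra hne
    obtain ⟨Q, hQ, hgQ⟩ := exists_sq_le_mul_abs_sub hg hg2 he (flux_eq_zero hρ hg hgu he)
    obtain ⟨δ, hδ, hδP⟩ := Metric.continuousWithinAt_iff.1 (hPc e (endpoint_mem_Icc he)) (|L| / 2)
      (by positivity)
    have hint : Integrable (fun x => z.toL2 x * z.toL2 x) volI := integrable_mul_coe _ _
    refine false_of_div_abs_sub_le hint (c := (|L| / 2) ^ 2 / Q) he (by positivity) hδ ?_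
    filter_upwards [z.rep_spec.2.1, ae_restrict_mem measurableSet_I] with x h1 hx hxd
    have h3 : dist (P x) (P e) < |L| / 2 := hδP (Ioo_subset_Icc_self hx) hxd
    rw [Real.dist_eq, hPeq x hx] at h3
    have h4 : |L| / 2 ≤ |g x * z.rep x| := by
      have h5 := abs_sub_abs_le_abs_sub L (g x * z.rep x)
      have h6 : g x * z.rep x - g 0 * z.rep 0 - P e = -(L - g x * z.rep x) := by rw [hL]; ring
      rw [h6, abs_neg] at h3
      linarith
    -- if `L ≠ 0`, then `z² ≥ (L/2)² / g² ≥ c / |x - e|` near `e`, which is not integrable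
    have h5 : (|L| / 2) ^ 2 ≤ g x ^ 2 * z.rep x ^ 2 := by
      rw [← mul_pow, ← sq_abs (g x * z.rep x)]
      gcongr
    have h6 := hgQ x hx
    have h7 : (|L| / 2) ^ 2 ≤ Q * |x - e| * z.rep x ^ 2 := h5.trans (by gcongr)
    have hxe : 0 < |x - e| := by
      rw [abs_pos]
      rcases he with rfl | rfl
      · linarith [hx.2]
      · linarith [hx.1]
    rw [h1, div_div, div_le_iff₀ (by positivity)]
    linarith
  have htot : ∫ x in (-1 : ℝ)..1, (deriv g x * z.rep x + g x * deriv z.rep x) = 0 := by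
    have hm : ∀ e ∈ Icc (-1 : ℝ) 1, IntervalIntegrable
        (fun x => deriv g x * z.rep x + g x * deriv z.rep x) volume 0 e := fun e he =>
      hi.mono_set (by rw [uIcc_neg_one_one]; exact uIcc_subset_Icc (by norm_num) he)
    have h1 := intervalIntegral.integral_interval_sub_left (hm 1 (by norm_num))
      (hm (-1) (by norm_num))
    have h2 := hend 1 (Or.inl rfl)
    have h3 := hend (-1) (Or.inr rfl)
    rw [← h1]
    simp only [hP] at h2 h3
    rw [h2, h3, sub_self]
  rw [← integral_volI, integral_add hi1 hi2] at htot
  rw [inner_L2I, inner_L2I, integral_congr_ae hprod1, integral_congr_ae hprod2]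
  linarith

end

lemma OpA.inner_eq {ρ₀ : ℝ} (hρ : 0 < ρ₀) {u : V ρ₀} {v : L2I} (h : OpA ρ₀ u.toL2 v) (z : V ρ₀) :
    inner ℝ v z.toL2 = -inner ℝ u.wderiv z.wderiv := by
  obtain ⟨u', hu', g, hg, hgu, hv⟩ := h
  obtain rfl : u' = u := V.toL2_injective hu'
  exact inner_flux_deriv hρ hg hgu hv z

/-! ### The positive part -/

lemma deriv_posPart_sub {f : ℝ → ℝ} (M : ℝ) {x : ℝ} (hf : ContinuousAt f x) :
    deriv (fun y => max (f y - M) 0) x = if M < f x then deriv f x else 0 := by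
  split_ifs with h
  · have h1 : (fun y => max (f y - M) 0) =ᶠ[𝓝 x] fun y => f y - M := by
      filter_upwards [hf.eventually (lt_mem_nhds h)] with y hy
      exact max_eq_left (by linarith)
    rw [h1.deriv_eq, deriv_sub_const]
  · -- `x` is a minimum of the positive part
    refine IsLocalMin.deriv_eq_zero (Eventually.of_forall fun y => ?_)
    simp only
    rw [max_eq_right (by linarith [not_lt.1 h] : f x - M ≤ 0)]
    exact le_max_right _ _

/-- `(u - M)⁺ ∈ V` for `u ∈ V`, with `(√ρ u_x, √ρ ((u - M)⁺)_x) ≥ 0`. -/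
lemma V.exists_posPart_sub {ρ₀ : ℝ} (u : V ρ₀) (M : ℝ) :
    ∃ z : V ρ₀, z.toL2 =ᵐ[volI] (fun x => max (u.toL2 x - M) 0) ∧
      0 ≤ inner ℝ u.wderiv z.wderiv := by
  set f : ℝ → ℝ := fun x => max (u.rep x - M) 0 with hf
  have hd : ∀ x ∈ I, deriv f x = if M < u.rep x then deriv u.rep x else 0 := fun x hx =>
    deriv_posPart_sub M (u.rep_spec.1.continuousOn.continuousAt (isOpen_Ioo.mem_nhds hx))
  have hac : ACLoc f := fun a ha b hb =>
    absolutelyContinuousOnInterval_of_dist_le (C := 1) (u.rep_spec.1 a ha b hb) fun x _ y _ => by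
      rw [one_mul, Real.dist_eq, Real.dist_eq]
      refine (abs_max_sub_max_le_abs _ _ _).trans (le_of_eq ?_)
      congr 1
      ring
  have hae : (fun x => max (u.toL2 x - M) 0) =ᵐ[volI] f := by
    filter_upwards [u.rep_spec.2.1] with x hx
    rw [hx]
  have h2 : MemLp f 2 volI := by
    have h3 : MemLp (fun x => u.toL2 x - M) 2 volI := (memLp_coe _).sub (memLp_const M)
    have h4 : MemLp (fun x => max (u.toL2 x - M) 0) 2 volI :=
      h3.mono ((h3.1.aemeasurable.max aemeasurable_const).aestronglyMeasurable)
        (Eventually.of_forall fun x => by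
          rw [Real.norm_eq_abs, Real.norm_eq_abs]
          exact (abs_le.2 ⟨by linarith [le_max_right (u.toL2 x - M) 0, abs_nonneg (u.toL2 x - M)],
            max_le (le_abs_self _) (abs_nonneg _)⟩))
    exact h4.ae_eq hae
  have hdL : MemLp (fun x => √(rho ρ₀ x) * deriv f x) 2 volI := by
    refine (memLp_coe u.wderiv).mono
      ((continuous_rho ρ₀).sqrt.measurable.mul (measurable_deriv f)).aestronglyMeasurable ?_
    filter_upwards [u.rep_spec.2.2, ae_restrict_mem measurableSet_I] with x hx hxI
    rw [hx, hd x hxI, norm_mul, norm_mul]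
    gcongr
    split_ifs <;> simp
  obtain ⟨z, hz1, -, hz3⟩ := V.exists_rep hac h2 hdL
  refine ⟨z, hz1.trans hae.symm, ?_⟩
  rw [inner_L2I]
  refine integral_nonneg_of_ae ?_
  filter_upwards [u.rep_spec.2.2, hz3, ae_restrict_mem measurableSet_I] with x h1 h2 hx
  rw [h1, h2, hd x hx]
  simp only [Pi.zero_apply]
  split_ifs
  · nlinarith [mul_self_nonneg (√(rho ρ₀ x) * deriv u.rep x)]
  · simp

/-- The weak maximum principle for `A`: `(A u, (u - M)⁺) ≤ 0`. -/
lemma OpA.integral_mul_posPart_nonpos {ρ₀ : ℝ} (hρ : 0 < ρ₀) {w v : L2I} (h : OpA ρ₀ w v) (M : ℝ) :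
    ∫ x, v x * max (w x - M) 0 ∂volI ≤ 0 := by
  have h' := h
  obtain ⟨u, rfl, -⟩ := h'
  obtain ⟨z, hz1, hz2⟩ := u.exists_posPart_sub M
  have h1 := h.inner_eq hρ z
  rw [inner_L2I] at h1
  have h2 : ∫ x, v x * max (u.toL2 x - M) 0 ∂volI = ∫ x, v x * z.toL2 x ∂volI := by
    refine integral_congr_ae ?_
    filter_upwards [hz1] with x hx
    rw [hx]
  rw [h2, h1]
  linarith

/-! ### Polynomial eigenfunctions -/

section Polynomials

open Polynomial

lemma memLp_polynomial (p : ℝ[X]) : MemLp (fun x => p.eval x) 2 volI := by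
  obtain ⟨C, hC⟩ := isCompact_Icc.exists_bound_of_continuousOn (s := Icc (-1 : ℝ) 1)
    p.continuous.continuousOn
  refine MemLp.of_bound p.continuous.aestronglyMeasurable C ?_
  filter_upwards [ae_restrict_mem measurableSet_I] with x hx using hC x (Ioo_subset_Icc_self hx)

/-- The class of a polynomial in `L²(I)`. -/
def polyL2 : ℝ[X] →ₗ[ℝ] L2I where
  toFun p := (memLp_polynomial p).toLp _
  map_add' p q := by
    rw [← MemLp.toLp_add]
    congr 1
    ext x
    simp
  map_smul' c p := by
    rw [RingHom.id_apply, ← MemLp.toLp_const_smul]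
    congr 1
    ext x
    simp

lemma coeFn_polyL2 (p : ℝ[X]) : polyL2 p =ᵐ[volI] fun x => p.eval x :=
  (memLp_polynomial p).coeFn_toLp

lemma polyL2_injective : Function.Injective polyL2 := by
  intro p q h
  have h1 : (fun x => p.eval x) =ᵐ[volI] fun x => q.eval x :=
    (coeFn_polyL2 p).symm.trans (h ▸ coeFn_polyL2 q)
  have h2 : EqOn (fun x => p.eval x) (fun x => q.eval x) I :=
    Measure.eqOn_open_of_ae_eq h1 isOpen_Ioo p.continuous.continuousOn q.continuous.continuousOn
  exact Polynomial.eq_of_infinite_eval_eq p q ((Ioo_infinite (by norm_num : (-1 : ℝ) < 1)).mono h2)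

/-- Continuous bounded functions are dense in `L²(I)`, and polynomials approximate them uniformly
on `[-1, 1]`. -/
lemma dense_range_polyL2 : Dense (range polyL2) := by
  intro w
  rw [Metric.mem_closure_iff]
  intro δ hδ
  have hd := Lp.boundedContinuousFunction_dense ℝ (μ := volI) (p := 2) (by norm_num)
  obtain ⟨y, hy, hwy⟩ := Metric.mem_closure_iff.1 (hd w) (δ / 2) (by positivity)
  obtain ⟨f, hf⟩ := (Lp.mem_boundedContinuousFunction_iff).1 hy
  set κ : ℝ := (measureUnivNNReal volI : ℝ) ^ (2 : ℝ≥0∞).toReal⁻¹ with hκ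
  have hκ0 : 0 ≤ κ := by positivity
  obtain ⟨p, hp⟩ := exists_polynomial_near_of_continuousOn (-1) 1 f f.continuous.continuousOn
    (δ / (2 * (κ + 1))) (by positivity)
  refine ⟨polyL2 p, mem_range_self p, ?_⟩
  have h1 : dist y (polyL2 p) ≤ κ * (δ / (2 * (κ + 1))) := by
    rw [dist_eq_norm]
    refine (Lp.norm_le_of_ae_bound (C := δ / (2 * (κ + 1))) (by positivity) ?_).trans (le_of_eq ?_)
    · have hyf : y =ᵐ[volI] f := by
        have := ContinuousMap.coeFn_toAEEqFun volI f.toContinuousMap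
        rw [hf] at this
        exact this
      filter_upwards [Lp.coeFn_sub y (polyL2 p), hyf, coeFn_polyL2 p,
        ae_restrict_mem measurableSet_I] with x h1 h2 h3 hx
      rw [h1, Pi.sub_apply, h2, h3, norm_sub_rev]
      exact (hp x (Ioo_subset_Icc_self hx)).le
    · rw [hκ]
  have h2 : κ * (δ / (2 * (κ + 1))) ≤ δ / 2 := by
    rw [mul_div_assoc', div_le_div_iff₀ (by positivity) (by positivity)]
    nlinarith
  calc dist w (polyL2 p) ≤ dist w y + dist y (polyL2 p) := dist_triangle _ _ _
    _ < δ := by linarith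

/-- The operator `p ↦ (ρ p')'` on polynomials. -/
def polyA (ρ₀ : ℝ) (p : ℝ[X]) : ℝ[X] := derivative (C ρ₀ * (1 - X ^ 2) * derivative p)

lemma natDegree_polyA_le (ρ₀ : ℝ) {p : ℝ[X]} {n : ℕ} (hp : p.natDegree ≤ n) :
    (polyA ρ₀ p).natDegree ≤ n := by
  have h1 : (C ρ₀ * (1 - X ^ 2) : ℝ[X]).natDegree ≤ 2 := by
    compute_degree
  by_cases h0 : p.natDegree = 0
  · have : derivative p = 0 := by
      rw [Polynomial.eq_C_of_natDegree_eq_zero h0, derivative_C]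
    simp [polyA, this]
  · have h2 := natDegree_derivative_le p
    have h3 := natDegree_derivative_le (C ρ₀ * (1 - X ^ 2) * derivative p)
    have h4 := natDegree_mul_le (p := (C ρ₀ * (1 - X ^ 2) : ℝ[X])) (q := derivative p)
    unfold polyA
    omega

lemma contDiff_polynomial_eval (p : ℝ[X]) : ContDiff ℝ 1 fun x => p.eval x := by
  simpa using p.contDiff_aeval (R := ℝ) (𝕜 := ℝ) 1

lemma acLoc_polynomial (p : ℝ[X]) : ACLoc fun x => p.eval x := fun _ _ _ _ =>
  ContDiffOn.absolutelyContinuousOnInterval (contDiff_polynomial_eval p).contDiffOn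

lemma exists_polyV {ρ₀ : ℝ} (p : ℝ[X]) :
    ∃ u : V ρ₀, u.toL2 = polyL2 p ∧ OpA ρ₀ (polyL2 p) (polyL2 (polyA ρ₀ p)) := by
  have hd : MemLp (fun x => √(rho ρ₀ x) * deriv (fun x => p.eval x) x) 2 volI := by
    obtain ⟨C, hC⟩ := isCompact_Icc.exists_bound_of_continuousOn (s := Icc (-1 : ℝ) 1)
      (f := fun x => √(rho ρ₀ x) * (derivative p).eval x)
      (((continuous_rho ρ₀).sqrt.mul (derivative p).continuous).continuousOn)
    simp only [Polynomial.deriv]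
    refine MemLp.of_bound
      ((continuous_rho ρ₀).sqrt.mul (derivative p).continuous).aestronglyMeasurable C ?_
    filter_upwards [ae_restrict_mem measurableSet_I] with x hx using hC x (Ioo_subset_Icc_self hx)
  obtain ⟨u, hu1, hu2, -⟩ := V.exists_rep (acLoc_polynomial p) (memLp_polynomial p) hd
  have hu : u.toL2 = polyL2 p := Lp.ext (hu1.trans (coeFn_polyL2 p).symm)
  have hg : (fun x => rho ρ₀ x * (derivative p).eval x) =
      fun x => (C ρ₀ * (1 - X ^ 2) * derivative p).eval x := by
    ext x
    simp [rho]
  refine ⟨u, hu, u, hu, fun x => rho ρ₀ x * (derivative p).eval x, ?_, ?_, ?_⟩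
  · rw [hg]
    exact ContDiffOn.absolutelyContinuousOnInterval (contDiff_polynomial_eval _).contDiffOn
  · filter_upwards [ae_restrict_mem measurableSet_I] with x hx
    rw [(hu2.eventuallyEq_of_mem (isOpen_Ioo.mem_nhds hx)).deriv_eq, Polynomial.deriv]
  · rw [hg]
    refine (coeFn_polyL2 _).trans (Eventually.of_forall fun x => ?_)
    rw [Polynomial.deriv]
    rfl

lemma inner_polyA_comm {ρ₀ : ℝ} (hρ : 0 < ρ₀) (p q : ℝ[X]) :
    inner ℝ (polyL2 (polyA ρ₀ p)) (polyL2 q) = inner ℝ (polyL2 p) (polyL2 (polyA ρ₀ q)) := by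
  obtain ⟨u, hu, hAu⟩ := exists_polyV (ρ₀ := ρ₀) p
  obtain ⟨z, hz, hAz⟩ := exists_polyV (ρ₀ := ρ₀) q
  rw [real_inner_comm (polyL2 (polyA ρ₀ q)), ← hu, ← hz,
    OpA.inner_eq hρ (hu ▸ hAu : OpA ρ₀ u.toL2 _), OpA.inner_eq hρ (hz ▸ hAz : OpA ρ₀ z.toL2 _),
    real_inner_comm]

/-- The monomials in `L²(I)`. -/
def monomialL2 (n : ℕ) : L2I := polyL2 (X ^ n)

lemma linearIndependent_monomialL2 : LinearIndependent ℝ monomialL2 := by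
  have h := (Polynomial.basisMonomials ℝ).linearIndependent.map' polyL2
    (LinearMap.ker_eq_bot.2 polyL2_injective)
  have h1 : monomialL2 = polyL2 ∘ Polynomial.basisMonomials ℝ := by
    ext1 n
    simp [monomialL2, Polynomial.X_pow_eq_monomial]
  rw [h1]
  exact h

lemma polyL2_mem_span (p : ℝ[X]) : polyL2 p ∈ Submodule.span ℝ (range monomialL2) := by
  rw [p.as_sum_range_C_mul_X_pow, map_sum]
  refine Submodule.sum_mem _ fun i _ => ?_
  rw [← Polynomial.smul_eq_C_mul, map_smul]
  exact Submodule.smul_mem _ _ (Submodule.subset_span (mem_range_self i))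

open InnerProductSpace in
/-- Orthonormalising the monomials gives an eigenbasis of `A`: the operator `(ρ p')'` is symmetric
and does not raise degrees, so it maps the `n`-th orthonormal polynomial to a multiple of itself. -/
theorem exists_eigenbasis {ρ₀ : ℝ} (hρ : 0 < ρ₀) :
    ∃ (b : HilbertBasis ℕ ℝ L2I) (lam : ℕ → ℝ) (E : ℕ → V ρ₀), (∀ n, 0 ≤ lam n) ∧
      (∀ n, (E n).toL2 = b n) ∧ ∀ n, OpA ρ₀ (b n) (-lam n • b n) := by
  set e : ℕ → L2I := gramSchmidtNormed ℝ monomialL2 with he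
  have hon : Orthonormal ℝ e := gramSchmidtNormed_orthonormal linearIndependent_monomialL2
  have hspan : ⊤ ≤ (Submodule.span ℝ (range e)).topologicalClosure := by
    rw [he, span_gramSchmidtNormed_range, span_gramSchmidt]
    intro x _
    refine closure_mono ?_ (dense_range_polyL2 x)
    rintro _ ⟨p, rfl⟩
    exact polyL2_mem_span p
  set b := HilbertBasis.mk hon hspan with hb
  have hbe : ∀ n, b n = e n := fun n => by rw [hb, HilbertBasis.coe_mk]
  -- `b n` is orthogonal to polynomials of smaller degree
  have horth : ∀ (n : ℕ) (p : ℝ[X]), p.natDegree < n → inner ℝ (b n) (polyL2 p) = 0 := by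
    intro n p hp
    rw [p.as_sum_range_C_mul_X_pow, map_sum, inner_sum]
    refine Finset.sum_eq_zero fun i hi => ?_
    have hin : i < n := by
      have := Finset.mem_range.1 hi
      omega
    rw [← Polynomial.smul_eq_C_mul, map_smul, inner_smul_right, hbe, he, gramSchmidtNormed,
      inner_smul_left]
    have : inner ℝ (gramSchmidt ℝ monomialL2 n) (polyL2 (X ^ i)) = 0 :=
      gramSchmidt_inv_triangular (𝕜 := ℝ) monomialL2 hin
    rw [this, mul_zero, mul_zero]
  -- `b n` is a polynomial of degree at most `n`
  have hpoly : ∀ n, ∃ p : ℝ[X], p.natDegree ≤ n ∧ polyL2 p = b n := by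
    intro n
    have h1 : e n ∈ Submodule.span ℝ (monomialL2 '' Iic n) := by
      rw [he, gramSchmidtNormed]
      exact Submodule.smul_mem _ _ (gramSchmidt_mem_span ℝ monomialL2 le_rfl)
    have h2 : Submodule.span ℝ (monomialL2 '' Iic n) ≤ (degreeLE ℝ n).map polyL2 := by
      rw [Submodule.span_le]
      rintro _ ⟨i, hi, rfl⟩
      refine ⟨X ^ i, ?_, rfl⟩
      rw [SetLike.mem_coe, mem_degreeLE]
      exact (degree_X_pow_le i).trans (by exact_mod_cast hi)
    obtain ⟨p, hp, hpe⟩ := h2 h1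
    refine ⟨p, ?_, by rw [hbe, hpe]⟩
    rw [SetLike.mem_coe, mem_degreeLE] at hp
    exact natDegree_le_of_degree_le hp
  choose P hPdeg hPb using hpoly
  -- off-diagonal coefficients vanish, by symmetry for `m < n` and by degree for `m > n`
  have hzero : ∀ n m, m ≠ n → inner ℝ (b m) (polyL2 (polyA ρ₀ (P n))) = 0 := by
    intro n m hmn
    rcases lt_or_gt_of_ne hmn with h | h
    · rw [← hPb m, ← inner_polyA_comm hρ, hPb n, real_inner_comm]
      exact horth n _ (lt_of_le_of_lt (natDegree_polyA_le ρ₀ (hPdeg m)) h)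
    · exact horth m _ (lt_of_le_of_lt (natDegree_polyA_le ρ₀ (hPdeg n)) h)
  choose E hE hAE using fun n => exists_polyV (ρ₀ := ρ₀) (P n)
  have hEb : ∀ n, (E n).toL2 = b n := fun n => by rw [hE, hPb]
  -- the eigenvalue is minus the Dirichlet form of `b n`, by Green's formula
  have heig : ∀ n, polyL2 (polyA ρ₀ (P n)) = -(‖(E n).wderiv‖ ^ 2) • b n := by
    intro n
    refine ext_coeff b fun m => ?_
    rw [inner_smul_right]
    by_cases hmn : m = n
    · subst hmn
      have h1 : OpA ρ₀ (E m).toL2 (polyL2 (polyA ρ₀ (P m))) := by rw [hE]; exact hAE m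
      have h2 := h1.inner_eq hρ (E m)
      rw [hEb, real_inner_self_eq_norm_sq] at h2
      rw [real_inner_comm, h2, real_inner_self_eq_norm_sq, b.orthonormal.1 m]
      ring
    · rw [hzero n m hmn, b.orthonormal.2 hmn, mul_zero]
  refine ⟨b, fun n => ‖(E n).wderiv‖ ^ 2, E, fun n => sq_nonneg _, hEb, fun n => ?_⟩
  rw [← heig n, ← hPb n]
  exact hAE n

end Polynomials

/-! ### Spectral description of the operator -/

/-- If `∫ v = 0`, the equation `(ρ u_x)_x = v` is solved by two integrations, up to a constant `κ`.
The flux `g = ∫_{-1}^x v` vanishes at both endpoints, hence `g² = O(1 - x²)` and `√ρ u_x = g / √ρ` is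
bounded. -/
lemma exists_opA_of_integral_eq_zero {ρ₀ : ℝ} (hρ : 0 < ρ₀) {v : L2I} (hv : ∫ x, v x ∂volI = 0) :
    ∃ F : ℝ → ℝ, ∀ κ : ℝ, ∃ w : L2I, OpA ρ₀ w v ∧ w =ᵐ[volI] fun x => κ + F x := by
  have hvi : IntervalIntegrable v volume (-1) 1 :=
    integrable_iff_intervalIntegrable.1 (integrable_coe v)
  set g : ℝ → ℝ := fun x => ∫ s in (-1 : ℝ)..x, v s with hg
  have hgac : AbsolutelyContinuousOnInterval g (-1) 1 :=
    hvi.absolutelyContinuousOnInterval_intervalIntegral left_mem_uIcc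
  have hgv : v =ᵐ[volI] deriv g := by
    rw [EventuallyEq, ae_restrict_iff' measurableSet_I]
    filter_upwards [hvi.ae_hasDerivAt_integral] with x hx hxI
    exact ((hx (by rw [uIcc_neg_one_one]; exact Ioo_subset_Icc_self hxI) (-1)
      left_mem_uIcc).deriv).symm
  have hg1 : g 1 = 0 := by rw [hg]; simp only; rw [← integral_volI, hv]
  have hg0 : g (-1) = 0 := by simp [hg]
  have hdg : MemLp (deriv g) 2 volI := (memLp_coe v).ae_eq hgv
  obtain ⟨Q₁, hQ₁, h₁⟩ := exists_sq_le_mul_abs_sub hgac hdg (Or.inl rfl) hg1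
  obtain ⟨Q₂, hQ₂, h₂⟩ := exists_sq_le_mul_abs_sub hgac hdg (Or.inr rfl) hg0
  set Q := Q₁ + Q₂ with hQ
  have hgQ : ∀ x ∈ I, g x ^ 2 ≤ Q * (1 - x ^ 2) := by
    intro x hx
    have e1 := h₁ x hx
    have e2 := h₂ x hx
    rw [abs_of_neg (by linarith [hx.2])] at e1
    rw [abs_of_pos (by linarith [hx.1])] at e2
    have hx1 := hx.1
    have hx2 := hx.2
    rcases le_total 0 x with h | h
    · have h3 : -(x - 1) ≤ 1 - x ^ 2 := by nlinarith
      have h4 : 0 ≤ Q₂ * (1 - x ^ 2) := mul_nonneg hQ₂.le (by nlinarith)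
      nlinarith
    · have h3 : x - -1 ≤ 1 - x ^ 2 := by nlinarith
      have h4 : 0 ≤ Q₁ * (1 - x ^ 2) := mul_nonneg hQ₁.le (by nlinarith)
      nlinarith
  set p : ℝ → ℝ := fun x => g x / √(rho ρ₀ x) with hp
  have hgcont : ContinuousOn g (Icc (-1) 1) := by
    have := hgac.continuousOn
    rwa [uIcc_neg_one_one] at this
  have hsq : ∀ x ∈ I, 0 < √(rho ρ₀ x) := fun x hx => Real.sqrt_pos.2 (rho_pos hρ hx)
  have hpcont : ContinuousOn p I := (hgcont.mono Ioo_subset_Icc_self).div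
    (continuous_rho ρ₀).sqrt.continuousOn fun x hx => (hsq x hx).ne'
  have hpb : ∀ x ∈ I, |p x| ≤ √(Q / ρ₀) := by
    intro x hx
    rw [← Real.sqrt_sq_eq_abs]
    apply Real.sqrt_le_sqrt
    rw [hp]
    simp only
    rw [div_pow, Real.sq_sqrt (rho_pos hρ hx).le, div_le_div_iff₀ (rho_pos hρ hx) hρ]
    have := hgQ x hx
    unfold rho
    nlinarith
  have hpL : MemLp p 2 volI := MemLp.of_bound (hpcont.aestronglyMeasurable measurableSet_I) _ (by
    filter_upwards [ae_restrict_mem measurableSet_I] with x hx using hpb x hx)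
  have hpint : Integrable p volI := hpL.integrable (by norm_num)
  -- the primitive is bounded by a multiple of `arcsin`
  have hFb : ∀ x ∈ I, |wprim ρ₀ p x| ≤ √(Q / ρ₀) / √ρ₀ * (Real.pi / 2) := by
    intro x hx
    have hsub := uIcc_subset_I zero_mem_I hx
    have hder : ∀ s ∈ uIcc 0 x, HasDerivAt Real.arcsin (1 / √(1 - s ^ 2)) s := fun s hs =>
      Real.hasDerivAt_arcsin (hsub hs).1.ne' (hsub hs).2.ne
    have hpos : ∀ s ∈ uIcc 0 x, 0 < √(1 - s ^ 2) := fun s hs => Real.sqrt_pos.2 (by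
      nlinarith [(hsub hs).1, (hsub hs).2])
    have hci : ContinuousOn (fun s : ℝ => 1 / √(1 - s ^ 2)) (uIcc 0 x) :=
      continuousOn_const.div (by fun_prop) fun s hs => (hpos s hs).ne'
    have hint := intervalIntegral.integral_eq_sub_of_hasDerivAt hder hci.intervalIntegrable
    rw [Real.arcsin_zero, sub_zero] at hint
    have hle : |wprim ρ₀ p x| ≤
        |∫ s in (0 : ℝ)..x, √(Q / ρ₀) / √ρ₀ * (1 / √(1 - s ^ 2))| := by
      refine intervalIntegral.norm_integral_le_abs_of_norm_le (μ := volume)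
        (f := fun s => p s / √(rho ρ₀ s)) (g := fun s => √(Q / ρ₀) / √ρ₀ * (1 / √(1 - s ^ 2))) ?_
        (hci.const_mul _).intervalIntegrable
      refine (ae_restrict_iff' measurableSet_uIoc).2 (Eventually.of_forall fun s hs => ?_)
      have hs' := uIoc_subset_uIcc hs
      rw [Real.norm_eq_abs, abs_div, abs_of_pos (hsq s (hsub hs'))]
      have h3 : √(rho ρ₀ s) = √ρ₀ * √(1 - s ^ 2) := by
        rw [rho, Real.sqrt_mul hρ.le]
      rw [h3, div_mul_div_comm, mul_one]
      have := hpos s hs'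
      have := hpb s (hsub hs')
      have := Real.sqrt_pos.2 hρ
      gcongr
    rw [intervalIntegral.integral_const_mul, hint, abs_mul,
      abs_of_nonneg (by positivity : 0 ≤ √(Q / ρ₀) / √ρ₀)] at hle
    refine hle.trans ?_
    gcongr
    exact abs_le.2 ⟨Real.neg_pi_div_two_le_arcsin x, Real.arcsin_le_pi_div_two x⟩
  refine ⟨wprim ρ₀ p, fun κ => ?_⟩
  have hac := acLoc_const_add_wprim hρ hpint κ
  have hder := ae_deriv_const_add_wprim hρ hpint κ
  have hL : MemLp (fun x => κ + wprim ρ₀ p x) 2 volI := by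
    refine MemLp.of_bound (hac.continuousOn.aestronglyMeasurable measurableSet_I)
      (|κ| + √(Q / ρ₀) / √ρ₀ * (Real.pi / 2)) ?_
    filter_upwards [ae_restrict_mem measurableSet_I] with x hx
    exact (abs_add_le _ _).trans (by gcongr; exact hFb x hx)
  have hdL : MemLp (fun x => √(rho ρ₀ x) * deriv (fun x => κ + wprim ρ₀ p x) x) 2 volI := by
    refine hpL.ae_eq ?_
    filter_upwards [hder, ae_restrict_mem measurableSet_I] with x hx hxI
    rw [hx]
    have := (hsq x hxI).ne'
    field_simp
  obtain ⟨u, hu1, hu2, -⟩ := V.exists_rep hac hL hdL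
  refine ⟨u.toL2, ⟨u, rfl, g, hgac, ?_, hgv⟩, hu1⟩
  filter_upwards [hder, ae_restrict_mem measurableSet_I] with x hx hxI
  rw [(hu2.eventuallyEq_of_mem (isOpen_Ioo.mem_nhds hxI)).deriv_eq, hx, hp]
  have h3 := (hsq x hxI).ne'
  have h4 := Real.mul_self_sqrt (rho_pos hρ hxI).le
  simp only
  rw [div_div, h4]
  have := (rho_pos hρ hxI).ne'
  field_simp

section Spectral

variable {ρ₀ : ℝ} {b : HilbertBasis ℕ ℝ L2I} {lam : ℕ → ℝ} {E : ℕ → V ρ₀}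

lemma inner_wderiv_eigen (hρ : 0 < ρ₀) (hE : ∀ n, (E n).toL2 = b n)
    (hA : ∀ n, OpA ρ₀ (b n) (-lam n • b n)) (n : ℕ) (z : V ρ₀) :
    inner ℝ (E n).wderiv z.wderiv = lam n * inner ℝ (b n) z.toL2 := by
  have h1 : OpA ρ₀ (E n).toL2 (-lam n • b n) := by rw [hE]; exact hA n
  have h2 := h1.inner_eq hρ z
  rw [inner_smul_left] at h2
  simp only [neg_mul, map_neg, conj_trivial] at h2
  linarith

lemma OpA.coeff_eq (hρ : 0 < ρ₀) (hE : ∀ n, (E n).toL2 = b n)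
    (hA : ∀ n, OpA ρ₀ (b n) (-lam n • b n)) {w v : L2I} (h : OpA ρ₀ w v) (n : ℕ) :
    inner ℝ (b n) v = -lam n * inner ℝ (b n) w := by
  obtain ⟨u, rfl, -⟩ := id h
  have h2 := h.inner_eq hρ (E n)
  rw [real_inner_comm, ← hE n, h2, real_inner_comm, inner_wderiv_eigen hρ hE hA n u, hE]
  ring

/-- `A` is the diagonal operator with eigenvalues `-lam n`: it has no proper diagonal extension. If
the coefficients of `v` are `-lam n` times those of `w`, then `∫ v = 0`, the equation
`(ρ u_x)_x = v` is solved by two integrations, and `w` differs from the solution by a constant. -/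
theorem opA_iff_coeff (hρ : 0 < ρ₀) (hE : ∀ n, (E n).toL2 = b n)
    (hA : ∀ n, OpA ρ₀ (b n) (-lam n • b n)) (w v : L2I) :
    OpA ρ₀ w v ↔ ∀ n, inner ℝ (b n) v = -lam n * inner ℝ (b n) w := by
  refine ⟨fun h n => h.coeff_eq hρ hE hA n, fun h => ?_⟩
  obtain ⟨one, hone, hAone⟩ := exists_polyV (ρ₀ := ρ₀) (1 : Polynomial ℝ)
  have hone1 : one.toL2 =ᵐ[volI] fun _ => (1 : ℝ) := by
    rw [hone]
    simpa using coeFn_polyL2 (1 : Polynomial ℝ)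
  have hcoeff1 : ∀ n, lam n * inner ℝ (b n) one.toL2 = 0 := by
    intro n
    have h1 := OpA.coeff_eq hρ hE hA hAone n
    have h2 : polyA ρ₀ 1 = 0 := by simp [polyA]
    rw [h2, map_zero, inner_zero_right, ← hone] at h1
    linarith
  -- `1` is in the kernel of `A`, which makes `v` orthogonal to it
  have hint : ∫ x, v x ∂volI = 0 := by
    have h1 : ∫ x, v x ∂volI = inner ℝ v one.toL2 := by
      rw [inner_L2I]
      refine integral_congr_ae ?_
      filter_upwards [hone1] with x hx
      rw [hx, mul_one]
    rw [h1, ← (b.hasSum_inner_mul_inner v one.toL2).tsum_eq]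
    refine (tsum_congr fun n => ?_).trans tsum_zero
    rw [real_inner_comm, h n]
    linear_combination -inner ℝ (b n) w * hcoeff1 n
  obtain ⟨F, hF⟩ := exists_opA_of_integral_eq_zero hρ hint
  obtain ⟨w₀, hw₀, hw₀F⟩ := hF 0
  -- `κ` makes `w - w₀ - κ` orthogonal to the constants; its other coefficients vanish because
  -- `lam n ≠ 0` there
  set κ := inner ℝ one.toL2 (w - w₀) / inner ℝ one.toL2 one.toL2 with hκ
  have hone_ne : inner ℝ one.toL2 one.toL2 ≠ 0 := by
    rw [Ne, inner_self_eq_zero]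
    intro h0
    have h1 : (0 : ℝ → ℝ) =ᵐ[volI] fun _ => (1 : ℝ) := by
      refine (Lp.coeFn_zero ℝ 2 volI).symm.trans ?_
      rw [← h0]
      exact hone1
    obtain ⟨x, hx⟩ := h1.exists
    simp at hx
  have hperp : inner ℝ one.toL2 (w - w₀ - κ • one.toL2) = 0 := by
    rw [inner_sub_right, inner_smul_right, hκ, div_mul_cancel₀ _ hone_ne, sub_self]
  have hw : w - w₀ - κ • one.toL2 = 0 := by
    refine ext_coeff b fun n => ?_
    rw [inner_zero_right]
    by_cases hn : lam n = 0
    · -- an eigenfunction with eigenvalue `0` is constant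
      have h1 : (E n).wderiv = 0 := by
        have := inner_wderiv_eigen hρ hE hA n (E n)
        rwa [hn, zero_mul, inner_self_eq_zero] at this
      have h2 : b n = (E n).rep 0 • one.toL2 := by
        rw [← hE]
        apply Lp.ext
        filter_upwards [(E n).rep_spec.2.1, Lp.coeFn_smul ((E n).rep 0) one.toL2, hone1,
          ae_restrict_mem measurableSet_I] with x h3 h4 h5 hx
        rw [h3, h4, Pi.smul_apply, h5, V.rep_eq_add_wprim hρ _ hx]
        obtain ⟨C, _, hC⟩ := exists_abs_wprim_le hρ (mem_I_iff_abs.1 hx)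
        have h6 := hC (E n).wderiv x le_rfl
        rw [h1, norm_zero, mul_zero] at h6
        rw [h1, abs_nonpos_iff.1 h6]
        simp
      rw [h2, inner_smul_left, hperp, mul_zero]
    · have h1 := (mul_eq_zero.1 (hcoeff1 n)).resolve_left hn
      have h2 : lam n * inner ℝ (b n) (w - w₀) = 0 := by
        rw [inner_sub_right]
        linear_combination h n - hw₀.coeff_eq hρ hE hA n
      rw [inner_sub_right, inner_smul_right, h1, (mul_eq_zero.1 h2).resolve_left hn]
      simp
  obtain ⟨w', hw', hw'F⟩ := hF κ
  have : w = w' := by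
    rw [sub_sub, sub_eq_zero] at hw
    rw [hw]
    apply Lp.ext
    filter_upwards [Lp.coeFn_add w₀ (κ • one.toL2), Lp.coeFn_smul κ one.toL2, hone1, hw₀F, hw'F]
      with x h1 h2 h3 h4 h5
    rw [h1, Pi.add_apply, h2, Pi.smul_apply, h3, h4, h5]
    simp [add_comm]
  rw [this]
  exact hw'

/-- A curve in `L²(I)` whose coefficients are continuous, with `(1 + lam n) * (u n)²` dominated by a
summable sequence, is a continuous curve in `V`. -/
theorem exists_continuousOn_V (hρ : 0 < ρ₀) (hlam : ∀ n, 0 ≤ lam n) (hE : ∀ n, (E n).toL2 = b n)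
    (hA : ∀ n, OpA ρ₀ (b n) (-lam n • b n)) {u : ℝ → L2I} {s : Set ℝ}
    (hu : ∀ n, ContinuousOn (fun t => inner ℝ (b n) (u t)) s) {B : ℕ → ℝ} (hB : Summable B)
    (huB : ∀ t ∈ s, ∀ n, (1 + lam n) * (inner ℝ (b n) (u t)) ^ 2 ≤ B n) :
    ∃ U : ℝ → V ρ₀, ContinuousOn U s ∧ ∀ t ∈ s, (U t).toL2 = u t := by
  have := completeSpace_V hρ
  have hpos : ∀ n, 0 < 1 + lam n := fun n => by linarith [hlam n]
  set σ : ℕ → ℝ := fun n => √(1 + lam n) with hσ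
  have hσ0 : ∀ n, 0 < σ n := fun n => Real.sqrt_pos.2 (hpos n)
  have hσ2 : ∀ n, σ n * σ n = 1 + lam n := fun n => Real.mul_self_sqrt (hpos n).le
  have hinner : ∀ n m, inner ℝ (E n) (E m) = if n = m then 1 + lam n else 0 := by
    intro n m
    rw [V.inner_eq, inner_wderiv_eigen hρ hE hA, hE, hE]
    split_ifs with h
    · rw [h, real_inner_self_eq_norm_sq, b.orthonormal.1 m]
      ring
    · rw [b.orthonormal.2 h]
      ring
  have hon : Orthonormal ℝ fun n => (σ n)⁻¹ • E n := by
    rw [orthonormal_iff_ite]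
    intro n m
    have h1 : inner ℝ ((σ n)⁻¹ • E n) ((σ m)⁻¹ • E m) =
        (σ n)⁻¹ * ((σ m)⁻¹ * inner ℝ (E n) (E m)) := by
      refine (V.inner_eq _ _).trans ?_
      rw [V.inner_eq, V.toL2_smul, V.wderiv_smul, V.toL2_smul, V.wderiv_smul, inner_smul_left,
        inner_smul_left, inner_smul_right, inner_smul_right, conj_trivial]
      ring
    rw [h1, hinner]
    split_ifs with h
    · rw [← h, ← hσ2]
      have := (hσ0 n).ne'
      field_simp
    · simp
  -- `J` maps the basis `b` of `L²(I)` to the orthonormal system of the normalised `E n` in `V`;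
  -- the curve is `J` applied to the curve `a` with coefficients `√(1 + lam n) * u n`
  set J : L2I →L[ℝ] V ρ₀ :=
    (hon.orthogonalFamily.linearIsometry.toContinuousLinearMap).comp
      (b.repr.toContinuousLinearEquiv : L2I →L[ℝ] _) with hJ
  have hJb : ∀ n, J (b n) = (σ n)⁻¹ • E n := by
    intro n
    have : J (b n) = hon.orthogonalFamily.linearIsometry (b.repr (b n)) := rfl
    rw [this, b.repr_self, OrthogonalFamily.linearIsometry_apply_single]
    simp
  have hcoeff : ∀ x n, inner ℝ (b n) (J x).toL2 = (σ n)⁻¹ * inner ℝ (b n) x := by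
    intro x n
    have h1 : (innerSL ℝ (b n)).comp ((V.toL2CLM ρ₀).comp J) = (σ n)⁻¹ • innerSL ℝ (b n) := by
      refine clm_ext_basis b fun m => ?_
      simp only [ContinuousLinearMap.comp_apply, hJb, V.toL2CLM_apply, V.toL2_smul, hE,
        innerSL_apply_apply, inner_smul_right, _root_.smul_apply, smul_eq_mul]
      by_cases h : n = m
      · rw [h]
      · rw [b.orthonormal.2 h]
        simp
    exact congrArg (fun L => L x) h1
  have hex : ∀ t, ∃ a : L2I, t ∈ s → ∀ n, inner ℝ (b n) a = σ n * inner ℝ (b n) (u t) := by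
    intro t
    by_cases ht : t ∈ s
    · obtain ⟨a, ha⟩ := exists_coeff_eq b (c := fun n => σ n * inner ℝ (b n) (u t))
        (Summable.of_nonneg_of_le (fun n => sq_nonneg _) (fun n => by
          rw [mul_pow, sq (σ n), hσ2]
          exact huB t ht n) hB)
      exact ⟨a, fun _ => ha⟩
    · exact ⟨0, fun h => absurd h ht⟩
  choose a ha using hex
  have hac : ContinuousOn a s := by
    refine continuousOn_of_coeff b (fun n => ?_) hB fun t ht n => ?_
    · exact ((hu n).const_mul (σ n)).congr fun t ht => ha t ht n
    · rw [ha t ht, mul_pow, sq (σ n), hσ2]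
      exact huB t ht n
  refine ⟨fun t => J (a t), J.continuous.comp_continuousOn hac, fun t ht => ?_⟩
  refine ext_coeff b fun n => ?_
  rw [hcoeff, ha t ht, ← mul_assoc, inv_mul_cancel₀ (hσ0 n).ne', one_mul]

end Spectral

/-! ### The parabolic maximum principle -/

lemma memLp_posPart_sub (M : ℝ) (w : L2I) : MemLp (fun x => max (w x - M) 0) 2 volI := by
  have h3 : MemLp (fun x => w x - M) 2 volI := (memLp_coe _).sub (memLp_const M)
  refine h3.mono ((h3.1.aemeasurable.max aemeasurable_const).aestronglyMeasurable)
    (Eventually.of_forall fun x => ?_)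
  rw [Real.norm_eq_abs, Real.norm_eq_abs]
  exact abs_le.2 ⟨by linarith [le_max_right (w x - M) 0, abs_nonneg (w x - M)],
    max_le (le_abs_self _) (abs_nonneg _)⟩

/-- `(w - M)⁺` in `L²(I)`. -/
def posPartSub (M : ℝ) (w : L2I) : L2I := (memLp_posPart_sub M w).toLp _

lemma coeFn_posPartSub (M : ℝ) (w : L2I) :
    posPartSub M w =ᵐ[volI] fun x => max (w x - M) 0 :=
  (memLp_posPart_sub M w).coeFn_toLp

lemma norm_posPartSub_le (M : ℝ) :
    ∃ K : ℝ, 0 ≤ K ∧ ∀ w : L2I, ‖posPartSub M w‖ ≤ ‖w‖ + K := by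
  have hc : MemLp (fun _ : ℝ => M) 2 volI := memLp_const M
  refine ⟨‖hc.toLp _‖, norm_nonneg _, fun w => ?_⟩
  refine le_trans ?_ (norm_sub_le w (hc.toLp _))
  refine Lp.norm_le_norm_of_ae_le ?_
  filter_upwards [coeFn_posPartSub M w, Lp.coeFn_sub w (hc.toLp _), hc.coeFn_toLp] with x h1 h2 h3
  rw [h1, h2, Pi.sub_apply, h3, Real.norm_eq_abs, Real.norm_eq_abs]
  exact abs_le.2 ⟨by linarith [le_max_right (w x - M) 0, abs_nonneg (w x - M)],
    max_le (le_abs_self _) (abs_nonneg _)⟩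

lemma norm_sq_L2I (w : L2I) : ‖w‖ ^ 2 = ∫ x, w x * w x ∂volI := by
  rw [← real_inner_self_eq_norm_sq, inner_L2I]

/-- First order expansion of `w ↦ ‖(w - M)⁺‖²`, with gradient `2 (w - M)⁺`. -/
lemma abs_norm_sq_posPartSub_sub_le (M : ℝ) (a c : L2I) :
    |‖posPartSub M c‖ ^ 2 - ‖posPartSub M a‖ ^ 2 - 2 * inner ℝ (posPartSub M a) (c - a)| ≤
      ‖c - a‖ ^ 2 := by
  set p := posPartSub M a with hp
  set q := posPartSub M c with hq
  have h1 : ‖q‖ ^ 2 - ‖p‖ ^ 2 - 2 * inner ℝ p (c - a) =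
      ∫ x, (q x * q x - p x * p x - 2 * (p x * (c - a : L2I) x)) ∂volI := by
    have hi : Integrable (fun x => q x * q x - p x * p x) volI :=
      (integrable_mul_coe q q).sub (integrable_mul_coe p p)
    rw [integral_sub hi
      ((integrable_mul_coe p _).const_mul 2), integral_sub (integrable_mul_coe q q)
      (integrable_mul_coe p p), integral_const_mul, norm_sq_L2I, norm_sq_L2I, inner_L2I]
  rw [h1, norm_sq_L2I (c - a)]
  refine abs_integral_le_integral_abs.trans (integral_mono_ae ?_ (integrable_mul_coe _ _) ?_)
  · exact (((integrable_mul_coe q q).sub (integrable_mul_coe p p)).sub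
      ((integrable_mul_coe p _).const_mul 2)).abs
  · filter_upwards [coeFn_posPartSub M a, coeFn_posPartSub M c, Lp.coeFn_sub c a] with x h1 h2 h3
    rw [hp, hq, h1, h2, h3, Pi.sub_apply]
    -- `s ↦ (s⁺)²` has the Lipschitz derivative `2 s⁺`; the expansion holds pointwise
    rcases le_total (a x - M) 0 with h4 | h4 <;> rcases le_total (c x - M) 0 with h5 | h5
    · rw [max_eq_right h4, max_eq_right h5]
      simp only [mul_zero, zero_mul, sub_zero, abs_zero]
      exact mul_self_nonneg _
    · rw [max_eq_right h4, max_eq_left h5, abs_le]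
      constructor <;> nlinarith
    · rw [max_eq_left h4, max_eq_right h5, abs_le]
      constructor <;> nlinarith
    · rw [max_eq_left h4, max_eq_left h5, abs_le]
      constructor <;> nlinarith [sq_nonneg (c x - a x)]

lemma hasFDerivAt_norm_sq_posPartSub (M : ℝ) (a : L2I) :
    HasFDerivAt (fun w => ‖posPartSub M w‖ ^ 2) ((2 : ℝ) • innerSL ℝ (posPartSub M a)) a := by
  refine HasFDerivAt.of_isLittleO ?_
  have h1 : (fun w : L2I => ‖posPartSub M w‖ ^ 2 - ‖posPartSub M a‖ ^ 2 -
      ((2 : ℝ) • innerSL ℝ (posPartSub M a)) (w - a)) =O[𝓝 a] fun w => ‖w - a‖ ^ 2 := by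
    refine Asymptotics.IsBigO.of_bound 1 (Eventually.of_forall fun w => ?_)
    rw [one_mul, Real.norm_eq_abs, Real.norm_of_nonneg (sq_nonneg _)]
    exact abs_norm_sq_posPartSub_sub_le M a w
  refine h1.trans_isLittleO ?_
  have h2 : Tendsto (fun w : L2I => w - a) (𝓝 a) (𝓝 0) := by
    rw [← sub_self a]
    exact (continuous_id.sub continuous_const).tendsto a
  exact ((Asymptotics.isLittleO_norm_pow_id (E' := L2I) one_lt_two).comp_tendsto h2)

/-- If `u' = A u + g` almost everywhere, `u 0 ≤ M`, and `g ≤ 0` where `u > M`, then `u ≤ M`: the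
absolutely continuous function `‖(u - M)⁺‖²` has nonpositive derivative. -/
theorem le_of_forcing_nonpos {ρ₀ : ℝ} (hρ : 0 < ρ₀) {T : ℝ} (hT : 0 ≤ T) {u v g : ℝ → L2I}
    (hv : MemLp v 2 (volume.restrict (Ioo 0 T))) (hg : MemLp g 2 (volume.restrict (Ioo 0 T)))
    (hA : ∀ᵐ t ∂(volume.restrict (Ioo 0 T)), OpA ρ₀ (u t) (v t))
    (hu : ∀ t ∈ Icc 0 T, u t = u 0 + ∫ s in (0 : ℝ)..t, (v s + g s)) {M : ℝ}
    (h0 : ∀ᵐ x ∂volI, u 0 x ≤ M)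
    (hgM : ∀ᵐ t ∂(volume.restrict (Ioo 0 T)), ∀ᵐ x ∂volI, M < u t x → g t x ≤ 0) :
    ∀ t ∈ Icc 0 T, ∀ᵐ x ∂volI, u t x ≤ M := by
  have hint : IntervalIntegrable (fun s => v s + g s) volume 0 T :=
    intervalIntegrable_of_memLp_two (hv.add hg) ⟨hT, le_rfl⟩
  have hintt : ∀ t ∈ Icc 0 T, IntervalIntegrable (fun s => v s + g s) volume 0 t := fun t ht =>
    intervalIntegrable_of_memLp_two (hv.add hg) ht
  -- `u` is absolutely continuous, hence bounded, and so is `t ↦ ‖(u t - M)⁺‖²`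
  set G : ℝ → ℝ := fun t => ∫ s in (0 : ℝ)..t, ‖v s + g s‖ with hG
  have hGac : AbsolutelyContinuousOnInterval G 0 T :=
    hint.norm.absolutelyContinuousOnInterval_intervalIntegral left_mem_uIcc
  have hdist : ∀ s ∈ uIcc 0 T, ∀ t ∈ uIcc 0 T, dist (u s) (u t) ≤ 1 * dist (G s) (G t) := by
    rw [uIcc_of_le hT]
    intro s hs t ht
    rw [one_mul, dist_comm, dist_comm (G s), dist_eq_norm, Real.dist_eq, hu s hs, hu t ht,
      add_sub_add_left_eq_sub, intervalIntegral.integral_interval_sub_left (hintt t ht)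
        (hintt s hs), hG]
    simp only
    rw [intervalIntegral.integral_interval_sub_left (hintt t ht).norm (hintt s hs).norm]
    exact intervalIntegral.norm_integral_le_abs_integral_norm
  have huac : AbsolutelyContinuousOnInterval u 0 T :=
    absolutelyContinuousOnInterval_of_dist_le hGac hdist
  obtain ⟨R, hR⟩ := huac.exists_bound
  obtain ⟨K, hK, hKp⟩ := norm_posPartSub_le M
  set Φ : L2I → ℝ := fun w => ‖posPartSub M w‖ ^ 2 with hΦ
  have hFac : AbsolutelyContinuousOnInterval (fun t => Φ (u t)) 0 T := by
    refine absolutelyContinuousOnInterval_of_dist_le (C := 2 * (R + K) + 2 * R) huac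
      fun s hs t ht => ?_
    have h1 := abs_norm_sq_posPartSub_sub_le M (u t) (u s)
    have h2 := abs_real_inner_le_norm (posPartSub M (u t)) (u s - u t)
    have h3 : ‖posPartSub M (u t)‖ ≤ R + K := (hKp _).trans (by linarith [hR t ht])
    have h4 : ‖u s - u t‖ ≤ 2 * R := (norm_sub_le _ _).trans (by linarith [hR t ht, hR s hs])
    rw [Real.dist_eq, dist_eq_norm]
    have h5 : |inner ℝ (posPartSub M (u t)) (u s - u t)| ≤ (R + K) * ‖u s - u t‖ :=
      h2.trans (by gcongr)
    have h6 : ‖u s - u t‖ ^ 2 ≤ 2 * R * ‖u s - u t‖ := by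
      rw [sq]
      gcongr
    rw [abs_le] at h1 h5 ⊢
    constructor <;> nlinarith [h1.1, h1.2, h5.1, h5.2]
  have hne : ∀ a : ℝ, ∀ᵐ t : ℝ, t ≠ a := fun a => by simp [ae_iff, measure_singleton]
  have hder : ∀ᵐ t, t ∈ uIcc 0 T → HasDerivAt (fun t => Φ (u t))
      (2 * inner ℝ (posPartSub M (u t)) (v t + g t)) t := by
    filter_upwards [hint.ae_hasDerivAt_integral, hne 0, hne T] with t ht ht0 htT htm
    have h1 := ht htm 0 left_mem_uIcc
    rw [uIcc_of_le hT] at htm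
    have h2 : HasDerivAt u (v t + g t) t := by
      refine (h1.const_add (u 0)).congr_of_eventuallyEq ?_
      filter_upwards [Icc_mem_nhds (lt_of_le_of_ne htm.1 ht0.symm) (lt_of_le_of_ne htm.2 htT)]
        with s hs using hu s hs
    exact (hasFDerivAt_norm_sq_posPartSub M (u t)).comp_hasDerivAt t h2
  have hneg : ∀ᵐ t ∂(volume.restrict (Ioo 0 T)),
      2 * inner ℝ (posPartSub M (u t)) (v t + g t) ≤ 0 := by
    filter_upwards [hA, hgM] with t h1 h2
    have h3 := h1.integral_mul_posPart_nonpos hρ M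
    have h4 : inner ℝ (posPartSub M (u t)) (v t) ≤ 0 := by
      rw [real_inner_comm, inner_L2I]
      refine le_trans (le_of_eq (integral_congr_ae ?_)) h3
      filter_upwards [coeFn_posPartSub M (u t)] with x hx
      rw [hx]
    have h5 : inner ℝ (posPartSub M (u t)) (g t) ≤ 0 := by
      rw [inner_L2I]
      refine integral_nonpos_of_ae ?_
      filter_upwards [coeFn_posPartSub M (u t), h2] with x hx hgx
      rw [hx]
      simp only [Pi.zero_apply]
      rcases le_or_gt (u t x) M with h | h
      · rw [max_eq_right (by linarith), zero_mul]
      · exact mul_nonpos_of_nonneg_of_nonpos (le_max_right _ _) (hgx h)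
    rw [inner_add_right]
    linarith
  have hΦ0 : Φ (u 0) = 0 := by
    have : posPartSub M (u 0) = 0 := by
      apply Lp.ext
      filter_upwards [coeFn_posPartSub M (u 0), h0, Lp.coeFn_zero ℝ 2 volI] with x h1 h2 h3
      rw [h1, h3, Pi.zero_apply, max_eq_right (by linarith)]
    rw [hΦ]
    simp [this]
  intro t ht
  have hsub : uIcc 0 t ⊆ uIcc 0 T := by
    rw [uIcc_of_le hT, uIcc_of_le ht.1]
    exact Icc_subset_Icc_right ht.2
  have h1 := integral_eq_sub_of_ae_hasDerivAt (hFac.mono hsub) (by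
    filter_upwards [hder] with s hs hst using hs (hsub hst))
  have h2 : ∫ s in (0 : ℝ)..t, 2 * inner ℝ (posPartSub M (u s)) (v s + g s) ≤ 0 := by
    rw [intervalIntegral.integral_of_le ht.1, integral_Ioc_eq_integral_Ioo]
    exact integral_nonpos_of_ae
      (ae_mono (Measure.restrict_mono (Ioo_subset_Ioo_right ht.2) le_rfl) hneg)
  rw [h1, hΦ0, sub_zero] at h2
  have h3 : posPartSub M (u t) = 0 := by
    rw [← norm_eq_zero]
    exact pow_eq_zero_iff (two_ne_zero) |>.1 (le_antisymm h2 (sq_nonneg _))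
  filter_upwards [coeFn_posPartSub M (u t), Lp.coeFn_zero ℝ 2 volI] with x h4 h5
  rw [h3, h5, Pi.zero_apply] at h4
  have := le_max_left (u t x - M) 0
  linarith

lemma OpA.neg {ρ₀ : ℝ} (hρ : 0 < ρ₀) {w v : L2I} (h : OpA ρ₀ w v) : OpA ρ₀ (-w) (-v) := by
  -- the coefficients avoid the chosen representatives in the definition of `OpA`
  obtain ⟨b, lam, E, -, hE, hA⟩ := exists_eigenbasis hρ
  rw [opA_iff_coeff hρ hE hA] at h ⊢
  intro n
  rw [inner_neg_right, inner_neg_right, h n]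
  ring

theorem ge_of_forcing_nonneg {ρ₀ : ℝ} (hρ : 0 < ρ₀) {T : ℝ} (hT : 0 ≤ T) {u v g : ℝ → L2I}
    (hv : MemLp v 2 (volume.restrict (Ioo 0 T))) (hg : MemLp g 2 (volume.restrict (Ioo 0 T)))
    (hA : ∀ᵐ t ∂(volume.restrict (Ioo 0 T)), OpA ρ₀ (u t) (v t))
    (hu : ∀ t ∈ Icc 0 T, u t = u 0 + ∫ s in (0 : ℝ)..t, (v s + g s)) {M : ℝ}
    (h0 : ∀ᵐ x ∂volI, -M ≤ u 0 x)
    (hgM : ∀ᵐ t ∂(volume.restrict (Ioo 0 T)), ∀ᵐ x ∂volI, u t x < -M → 0 ≤ g t x) :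
    ∀ t ∈ Icc 0 T, ∀ᵐ x ∂volI, -M ≤ u t x := by
  have h1 := le_of_forcing_nonpos hρ hT (u := fun t => -u t) (v := fun t => -v t)
    (g := fun t => -g t) (M := M) hv.neg hg.neg
    (by filter_upwards [hA] with t ht using ht.neg hρ)
    (fun t ht => by
      rw [hu t ht, neg_add, ← intervalIntegral.integral_neg]
      simp only [neg_add])
    (by
      filter_upwards [Lp.coeFn_neg (u 0), h0] with x hx hx0
      rw [hx, Pi.neg_apply]
      linarith)
    (by
      filter_upwards [hgM] with t ht
      filter_upwards [Lp.coeFn_neg (u t), Lp.coeFn_neg (g t), ht] with x h1 h2 h3 h4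
      rw [h1, Pi.neg_apply] at h4
      rw [h2, Pi.neg_apply]
      linarith [h3 (by linarith)])
  intro t ht
  filter_upwards [h1 t ht, Lp.coeFn_neg (u t)] with x h2 h3
  rw [h3, Pi.neg_apply] at h2
  linarith

/-! ### Semilinear Cauchy problems with causal Lipschitz forcing -/

lemma memLp_two_of_continuousOn {X : Type*} [NormedAddCommGroup X] {T : ℝ} {g : ℝ → X}
    (hg : ContinuousOn g (Icc 0 T)) :
    MemLp g 2 (volume.restrict (Ioo 0 T)) := by
  obtain ⟨C, hC⟩ := isCompact_Icc.exists_bound_of_continuousOn hg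
  refine MemLp.of_bound ((hg.mono Ioo_subset_Icc_self).aestronglyMeasurable measurableSet_Ioo) C ?_
  filter_upwards [ae_restrict_mem measurableSet_Ioo] with t ht using hC t (Ioo_subset_Icc_self ht)

section Volterra

variable {X : Type*} [NormedAddCommGroup X] [InnerProductSpace ℝ X]
  {b : HilbertBasis ℕ ℝ X} {lam : ℕ → ℝ} {S : ℝ → X →L[ℝ] X} {T L : ℝ} {x : X}
  {Ψ : (ℝ → X) → ℝ → X}

/-- `Ψ` maps continuous curves on `[0, T]` to continuous curves, and `Ψ z t` depends on `z` through
its values on `[0, t]` only, with Lipschitz constant `L` in the supremum norm. -/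
structure IsCausalLipschitz (T L : ℝ) (Ψ : (ℝ → X) → ℝ → X) : Prop where
  nonneg : 0 ≤ L
  continuousOn : ∀ z, ContinuousOn z (Icc 0 T) → ContinuousOn (Ψ z) (Icc 0 T)
  norm_sub_le : ∀ z w, ContinuousOn z (Icc 0 T) → ContinuousOn w (Icc 0 T) → ∀ t ∈ Icc 0 T,
    ∀ δ : ℝ, (∀ s ∈ Icc 0 t, ‖z s - w s‖ ≤ δ) → ‖Ψ z t - Ψ w t‖ ≤ L * δ

/-- The Duhamel map `z ↦ S t x + ∫_0^t S (t - s) (Ψ z s) ds`. -/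
def duhamelMap (S : ℝ → X →L[ℝ] X) (x : X) (Ψ : (ℝ → X) → ℝ → X) (z : ℝ → X) (t : ℝ) : X :=
  S t x + ∫ s in (0 : ℝ)..t, S (t - s) (Ψ z s)

/-- One step of the Volterra iteration. -/
lemma IsCausalLipschitz.norm_duhamelMap_sub_le (hΨ : IsCausalLipschitz T L Ψ)
    (hS : IsDiagonalSemigroup b lam S) (hlam : ∀ n, 0 ≤ lam n) {z w : ℝ → X}
    (hz : ContinuousOn z (Icc 0 T)) (hw : ContinuousOn w (Icc 0 T)) {C : ℝ} (hC : 0 ≤ C) {n : ℕ}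
    (h : ∀ t ∈ Icc 0 T, ‖z t - w t‖ ≤ C * ((L * t) ^ n / n.factorial)) :
    ∀ t ∈ Icc 0 T, ‖duhamelMap S x Ψ z t - duhamelMap S x Ψ w t‖ ≤
      C * ((L * t) ^ (n + 1) / (n + 1).factorial) := by
  intro t ht
  have hL := hΨ.nonneg
  have hi : ∀ z, ContinuousOn z (Icc 0 T) → IntervalIntegrable (Ψ z) volume 0 t := fun z hz =>
    ((hΨ.continuousOn z hz).mono
      (by rw [uIcc_of_le ht.1]; exact Icc_subset_Icc_right ht.2)).intervalIntegrable
  have h1 : duhamelMap S x Ψ z t - duhamelMap S x Ψ w t =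
      ∫ s in (0 : ℝ)..t, (S (t - s) (Ψ z s) - S (t - s) (Ψ w s)) := by
    rw [intervalIntegral.integral_sub (hS.intervalIntegrable hlam ht.1 (hi z hz))
      (hS.intervalIntegrable hlam ht.1 (hi w hw)), duhamelMap, duhamelMap]
    abel
  have h2 : ∀ s ∈ Ioc 0 t, ‖S (t - s) (Ψ z s) - S (t - s) (Ψ w s)‖ ≤
      L * (C * ((L * s) ^ n / n.factorial)) := by
    intro s hs
    rw [← map_sub]
    refine (hS.norm_le hlam (by linarith [hs.2]) _).trans ?_
    refine hΨ.norm_sub_le z w hz hw s ⟨hs.1.le, hs.2.trans ht.2⟩ _ fun r hr => ?_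
    refine (h r ⟨hr.1, hr.2.trans (hs.2.trans ht.2)⟩).trans ?_
    have : 0 ≤ r := hr.1
    have : r ≤ s := hr.2
    gcongr
  have h3 : ∫ s in (0 : ℝ)..t, L * (C * ((L * s) ^ n / n.factorial)) =
      C * ((L * t) ^ (n + 1) / (n + 1).factorial) := by
    have : ∀ s : ℝ, L * (C * ((L * s) ^ n / n.factorial)) =
        (C * L ^ (n + 1) / n.factorial) * s ^ n := fun s => by rw [mul_pow]; ring
    simp_rw [this]
    rw [intervalIntegral.integral_const_mul, integral_pow, Nat.factorial_succ, mul_pow]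
    push_cast
    have hn : ((n : ℝ) + 1) ≠ 0 := by positivity
    have hf : (n.factorial : ℝ) ≠ 0 := by positivity
    field_simp
    ring
  rw [h1, ← h3]
  refine intervalIntegral.norm_integral_le_of_norm_le ht.1 ?_
    (Continuous.intervalIntegrable (by fun_prop) _ _)
  exact Eventually.of_forall h2

lemma tendsto_mul_pow_div_factorial (C a : ℝ) :
    Tendsto (fun n : ℕ => C * (a ^ n / n.factorial)) atTop (𝓝 0) := by
  simpa using (FloorSemiring.tendsto_pow_div_factorial_atTop a).const_mul C

theorem IsCausalLipschitz.eqOn (hΨ : IsCausalLipschitz T L Ψ)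
    (hS : IsDiagonalSemigroup b lam S) (hlam : ∀ n, 0 ≤ lam n) {z w : ℝ → X}
    (hz : ContinuousOn z (Icc 0 T)) (hw : ContinuousOn w (Icc 0 T))
    (hz' : ∀ t ∈ Icc 0 T, z t = duhamelMap S x Ψ z t)
    (hw' : ∀ t ∈ Icc 0 T, w t = duhamelMap S x Ψ w t) : EqOn z w (Icc 0 T) := by
  obtain ⟨C, hC⟩ := isCompact_Icc.exists_bound_of_continuousOn (hz.sub hw)
  have key : ∀ n : ℕ, ∀ t ∈ Icc 0 T, ‖z t - w t‖ ≤ |C| * ((L * t) ^ n / n.factorial) := by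
    intro n
    induction n with
    | zero =>
      intro t ht
      simpa using (hC t ht).trans (le_abs_self C)
    | succ n ih =>
      intro t ht
      rw [hz' t ht, hw' t ht]
      exact hΨ.norm_duhamelMap_sub_le hS hlam hz hw (abs_nonneg C) ih t ht
  intro t ht
  have h1 : ‖z t - w t‖ ≤ 0 :=
    ge_of_tendsto' (tendsto_mul_pow_div_factorial |C| (L * t)) fun n => key n t ht
  exact sub_eq_zero.1 (norm_le_zero_iff.1 h1)

variable [CompleteSpace X]

lemma IsCausalLipschitz.duhamelMap_continuousOn (hΨ : IsCausalLipschitz T L Ψ)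
    (hS : IsDiagonalSemigroup b lam S) (hlam : ∀ n, 0 ≤ lam n) (hT : 0 ≤ T)
    (hx : Summable fun n => lam n * (inner ℝ (b n) x) ^ 2) {z : ℝ → X}
    (hz : ContinuousOn z (Icc 0 T)) : ContinuousOn (duhamelMap S x Ψ z) (Icc 0 T) := by
  obtain ⟨-, h1, B, hB, h2⟩ := hS.duhamel_regularity hlam hT
    (memLp_two_of_continuousOn (hΨ.continuousOn z hz)) hx (u := duhamelMap S x Ψ z)
    fun t _ => rfl
  refine continuousOn_of_coeff b h1 hB fun t ht n => ?_
  refine le_trans ?_ (h2 t ht n)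
  nlinarith [mul_nonneg (hlam n) (sq_nonneg (inner ℝ (b n) (duhamelMap S x Ψ z t)))]

theorem IsCausalLipschitz.exists_fixedPoint (hΨ : IsCausalLipschitz T L Ψ)
    (hS : IsDiagonalSemigroup b lam S) (hlam : ∀ n, 0 ≤ lam n) (hT : 0 ≤ T)
    (hx : Summable fun n => lam n * (inner ℝ (b n) x) ^ 2) :
    ∃ z : ℝ → X, ContinuousOn z (Icc 0 T) ∧ ∀ t ∈ Icc 0 T, z t = duhamelMap S x Ψ z t := by
  have hext : ∀ f : C(Icc 0 T, X), ContinuousOn (IccExtend hT f) (Icc 0 T) := fun f =>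
    (f.continuous.Icc_extend' (h := hT)).continuousOn
  set Φ : C(Icc 0 T, X) → C(Icc 0 T, X) := fun f =>
    ⟨fun t => duhamelMap S x Ψ (IccExtend hT f) t, continuousOn_iff_continuous_domRestrict.1
      (hΨ.duhamelMap_continuousOn hS hlam hT hx (hext f))⟩ with hΦ
  have hΦapp : ∀ f, ∀ t ∈ Icc 0 T, IccExtend hT (Φ f) t =
      duhamelMap S x Ψ (IccExtend hT f) t := fun f t ht => by
    rw [IccExtend_of_mem hT _ ht]
    rfl
  have hiter : ∀ f g : C(Icc 0 T, X), ∀ n : ℕ, ∀ t ∈ Icc 0 T,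
      ‖IccExtend hT (Φ^[n] f) t - IccExtend hT (Φ^[n] g) t‖ ≤
        dist f g * ((L * t) ^ n / n.factorial) := by
    intro f g n
    induction n with
    | zero =>
      intro t ht
      rw [IccExtend_of_mem hT _ ht, IccExtend_of_mem hT _ ht, ← dist_eq_norm]
      simpa using ContinuousMap.dist_apply_le_dist (⟨t, ht⟩ : Icc 0 T)
    | succ n ih =>
      intro t ht
      rw [Function.iterate_succ_apply', Function.iterate_succ_apply', hΦapp _ t ht, hΦapp _ t ht]
      exact hΨ.norm_duhamelMap_sub_le hS hlam (hext _) (hext _) dist_nonneg ih t ht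
  -- some iterate of the Duhamel map is a contraction of `C([0, T]; X)`
  obtain ⟨n, hn⟩ := ((tendsto_mul_pow_div_factorial 1 (L * T)).eventually
    (gt_mem_nhds (by norm_num : (0 : ℝ) < 1 / 2))).exists
  have hcontr : ContractingWith (1 / 2) Φ^[n] := by
    refine ⟨by rw [← NNReal.coe_lt_coe]; norm_num, LipschitzWith.of_dist_le_mul fun f g => ?_⟩
    rw [ContinuousMap.dist_le (by positivity)]
    intro t
    have h1 := hiter f g n t t.2
    rw [IccExtend_val, IccExtend_val, ← dist_eq_norm] at h1
    refine h1.trans ?_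
    have h2 : (L * t) ^ n / n.factorial ≤ (L * T) ^ n / n.factorial := by
      have := hΨ.nonneg
      have := t.2.1
      have := t.2.2
      gcongr
    rw [mul_comm]
    gcongr
    push_cast
    linarith
  have : Nonempty C(Icc 0 T, X) := ⟨0⟩
  set f := ContractingWith.fixedPoint Φ^[n] hcontr with hf
  have hfix : Φ f = f := hcontr.isFixedPt_fixedPoint_iterate
  refine ⟨IccExtend hT f, hext f, fun t ht => ?_⟩
  rw [← hΦapp f t ht, hfix]

end Volterra

/-! ### The truncated forcing -/

lemma exists_ae_abs_le {f : ℝ → ℝ} (hf : MemLp f ⊤ volI) :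
    ∃ C : ℝ, 0 ≤ C ∧ ∀ᵐ x ∂volI, |f x| ≤ C := by
  refine ⟨(eLpNormEssSup f volI).toReal, ENNReal.toReal_nonneg, ?_⟩
  have hfin : eLpNormEssSup f volI ≠ ⊤ := by
    have := hf.2
    rw [eLpNorm_exponent_top] at this
    exact this.ne
  filter_upwards [ae_le_eLpNormEssSup (f := f) (μ := volI)] with x hx
  rw [← Real.norm_eq_abs, ← toReal_enorm]
  exact ENNReal.toReal_mono hfin hx

lemma abs_sub_le_of_deriv_bound {f : ℝ → ℝ} (hf : Differentiable ℝ f) {C : ℝ}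
    (hC : ∀ y, |deriv f y| ≤ C) (a c : ℝ) : |f a - f c| ≤ C * |a - c| :=
  convex_univ.norm_image_sub_le_of_norm_deriv_le (fun x _ => hf x) (fun x _ => hC x)
    (mem_univ c) (mem_univ a)

lemma norm_le_of_ae_abs_le : ∃ K : ℝ, 0 ≤ K ∧ ∀ (y u v : L2I) (a c d : ℝ), 0 ≤ a → 0 ≤ c → 0 ≤ d →
    (∀ᵐ x ∂volI, |y x| ≤ a + c * |u x| + d * |v x|) → ‖y‖ ≤ K * a + c * ‖u‖ + d * ‖v‖ := by
  have h1 : MemLp (fun _ : ℝ => (1 : ℝ)) 2 volI := memLp_const 1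
  set one : L2I := h1.toLp _ with hone
  refine ⟨‖one‖, norm_nonneg _, fun y u v a c d ha hc hd h => ?_⟩
  have h2 : ‖y‖ ≤ ‖a • one + c • |u| + d • |v|‖ := by
    refine Lp.norm_le_norm_of_ae_le ?_
    filter_upwards [h, Lp.coeFn_add (a • one + c • |u|) (d • |v|), Lp.coeFn_add (a • one) (c • |u|),
      Lp.coeFn_smul a one, Lp.coeFn_smul c |u|, Lp.coeFn_smul d |v|, Lp.coeFn_abs u,
      Lp.coeFn_abs v, h1.coeFn_toLp] with x g0 g1 g2 g3 g4 g5 g6 g7 g8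
    rw [g1, Pi.add_apply, g2, Pi.add_apply, g3, g4, g5, Pi.smul_apply, Pi.smul_apply, Pi.smul_apply,
      g6, g7, g8, Real.norm_eq_abs]
    refine g0.trans (le_trans (le_of_eq ?_) (le_abs_self _))
    simp
  refine h2.trans ((norm_add₃_le).trans (le_of_eq ?_))
  rw [norm_smul, norm_smul, norm_smul, norm_abs_eq_norm, norm_abs_eq_norm, Real.norm_of_nonneg ha,
    Real.norm_of_nonneg hc, Real.norm_of_nonneg hd, mul_comm a]

/-- The class in `L²(I)` of a function, `0` if it is not square integrable. -/
def classL2 (f : ℝ → ℝ) : L2I := open Classical in if h : MemLp f 2 volI then h.toLp f else 0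

lemma coeFn_classL2 {f : ℝ → ℝ} (hf : MemLp f 2 volI) : classL2 f =ᵐ[volI] f := by
  rw [classL2, dif_pos hf]
  exact hf.coeFn_toLp

/-- Truncation of the values to `[-M, M]`. -/
def clamp (M y : ℝ) : ℝ := max (-M) (min y M)

lemma abs_clamp_sub_le (M y z : ℝ) : |clamp M y - clamp M z| ≤ |y - z| := by
  refine (abs_max_sub_max_le_max _ _ _ _).trans ?_
  rw [sub_self, abs_zero, max_eq_right (abs_nonneg _)]
  refine (abs_min_sub_min_le_max _ _ _ _).trans ?_
  rw [sub_self, abs_zero, max_eq_left (abs_nonneg _)]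

lemma abs_clamp_le {M : ℝ} (hM : 0 ≤ M) (y : ℝ) : |clamp M y| ≤ M :=
  abs_le.2 ⟨le_max_left _ _, max_le (by linarith) (min_le_right _ _)⟩

lemma clamp_eq_self {M y : ℝ} (h1 : -M ≤ y) (h2 : y ≤ M) : clamp M y = y := by
  rw [clamp, min_eq_left h2, max_eq_right h1]

lemma clamp_of_ge {M y : ℝ} (hM : 0 ≤ M) (h : M ≤ y) : clamp M y = M := by
  rw [clamp, min_eq_right h, max_eq_right (by linarith)]

lemma clamp_of_le {M y : ℝ} (hM : 0 ≤ M) (h : y ≤ -M) : clamp M y = -M := by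
  rw [clamp, min_eq_left (by linarith), max_eq_left h]

lemma continuous_clamp (M : ℝ) : Continuous (clamp M) := by
  unfold clamp
  fun_prop

namespace Data

variable {D : Data}

/-- The right-hand side of the model as a function of `t`, `x`, the temperature `y`, and the value
`m` of the history function. -/
def reaction (D : Data) (t x y m : ℝ) : ℝ :=
  D.r t * D.q x * D.β y - D.ε y * |y| ^ 3 * y + D.f m

lemma Admissible.exists_reaction_sign (hD : D.Admissible) {Cq : ℝ} (hCq : 0 ≤ Cq) :
    ∃ M₀ : ℝ, 0 ≤ M₀ ∧ ∀ t x y m M : ℝ, 0 ≤ t → |D.q x| ≤ Cq → M₀ ≤ M →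
      (M ≤ y → D.reaction t x y m ≤ 0) ∧ (y ≤ -M → 0 ≤ D.reaction t x y m) := by
  obtain ⟨Cr, hCr⟩ := hD.r_bdd
  obtain ⟨Cβ, hCβ⟩ := hD.β_bdd
  obtain ⟨Cf, hCf⟩ := hD.f_bdd
  obtain ⟨ε₁, hε₁, hε⟩ := hD.ε_lower
  set C := Cr * Cq * Cβ + Cf with hC
  -- for `M₀ ≥ 1` and `M₀ ≥ C / ε₁` the emission `ε₁ y⁴` exceeds all bounded terms
  refine ⟨max 1 (C / ε₁), le_max_of_le_left zero_le_one, fun t x y m M ht hq hM => ?_⟩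
  have hr := hCr t ht
  have hβ := hCβ y
  have hf := hCf m
  have hb : |D.r t * D.q x * D.β y + D.f m| ≤ C := by
    refine (abs_add_le _ _).trans ?_
    rw [abs_mul, abs_mul, hC]
    have : 0 ≤ Cr := (abs_nonneg _).trans hr
    gcongr
  have hM1 : 1 ≤ M := (le_max_left _ _).trans hM
  have hMC : C ≤ ε₁ * M := by
    have := (le_max_right _ _).trans hM
    rw [div_le_iff₀ hε₁] at this
    linarith
  have hem : ∀ y : ℝ, M ≤ |y| → C ≤ D.ε y * |y| ^ 3 * |y| := by
    intro y hy
    have h1 : 1 ≤ |y| := hM1.trans hy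
    have h2 : 1 ≤ |y| ^ 3 := one_le_pow₀ h1
    calc C ≤ ε₁ * M := hMC
      _ ≤ ε₁ * |y| := by gcongr
      _ = ε₁ * 1 * |y| := by ring
      _ ≤ D.ε y * |y| ^ 3 * |y| := by
        have h3 := hε y
        have h4 : 0 ≤ D.ε y := hε₁.le.trans h3
        gcongr
  rw [abs_le] at hb
  unfold reaction
  constructor
  · intro h
    have h1 : |y| = y := abs_of_nonneg (by linarith)
    have h2 := hem y (by rw [h1]; exact h)
    nth_rw 2 [h1] at h2
    linarith
  · intro h
    have h1 : |y| = -y := abs_of_nonpos (by linarith)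
    have h2 := hem y (by rw [h1]; linarith)
    nth_rw 2 [h1] at h2
    linarith

lemma abs_pow_three_mul_sub_le {M a c : ℝ} (ha : |a| ≤ M) (hc : |c| ≤ M) :
    |(|a| ^ 3 * a - |c| ^ 3 * c)| ≤ 4 * M ^ 3 * |a - c| := by
  have hM : 0 ≤ M := (abs_nonneg a).trans ha
  have h1 : |a| ^ 3 * a - |c| ^ 3 * c = |a| ^ 3 * (a - c) + (|a| ^ 3 - |c| ^ 3) * c := by ring
  have h2 : |(|a| ^ 3 - |c| ^ 3)| ≤ 3 * M ^ 2 * |a - c| := by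
    have h3 : |a| ^ 3 - |c| ^ 3 = (|a| ^ 2 + |a| * |c| + |c| ^ 2) * (|a| - |c|) := by ring
    rw [h3, abs_mul, abs_of_nonneg (by positivity : 0 ≤ |a| ^ 2 + |a| * |c| + |c| ^ 2)]
    have h4 : |a| ^ 2 + |a| * |c| + |c| ^ 2 ≤ 3 * M ^ 2 := by
      have e1 : |a| ^ 2 ≤ M ^ 2 := by gcongr
      have e2 : |c| ^ 2 ≤ M ^ 2 := by gcongr
      have e3 : |a| * |c| ≤ M * M := by gcongr
      nlinarith
    have := abs_abs_sub_abs_le a c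
    gcongr
  rw [h1]
  refine (abs_add_le _ _).trans ?_
  rw [abs_mul, abs_mul, abs_pow, abs_abs]
  have e1 : |a| ^ 3 ≤ M ^ 3 := by gcongr
  calc |a| ^ 3 * |a - c| + |(|a| ^ 3 - |c| ^ 3)| * |c|
      ≤ M ^ 3 * |a - c| + 3 * M ^ 2 * |a - c| * M := by gcongr
    _ = _ := by ring

/-- The truncated reaction is globally Lipschitz. -/
lemma Admissible.exists_abs_reaction_clamp_sub_le (hD : D.Admissible) {Cq M : ℝ} (hCq : 0 ≤ Cq)
    (hM : 0 ≤ M) : ∃ A Lw Lm : ℝ, 0 ≤ A ∧ 0 ≤ Lw ∧ 0 ≤ Lm ∧ ∀ t t' x y y' m m' : ℝ, 0 ≤ t →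
      |D.q x| ≤ Cq → |D.reaction t x (clamp M y) m - D.reaction t' x (clamp M y') m'| ≤
        A * |D.r t - D.r t'| + Lw * |y - y'| + Lm * |m - m'| := by
  obtain ⟨Cr, hCr⟩ := hD.r_bdd
  obtain ⟨Cβ, hCβ⟩ := hD.β_bdd
  obtain ⟨Lβ, hLβ⟩ := hD.β_deriv_bdd
  obtain ⟨Cε, hCε⟩ := hD.ε_bdd
  obtain ⟨Lε, hLε⟩ := hD.ε_deriv_bdd
  obtain ⟨Lf, hLf⟩ := hD.f_deriv_bdd
  have hCr0 : 0 ≤ Cr := (abs_nonneg _).trans (hCr 0 le_rfl)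
  have hCβ0 : 0 ≤ Cβ := (abs_nonneg _).trans (hCβ 0)
  have hLβ0 : 0 ≤ Lβ := (abs_nonneg _).trans (hLβ 0)
  have hCε0 : 0 ≤ Cε := (abs_nonneg _).trans (hCε 0)
  have hLε0 : 0 ≤ Lε := (abs_nonneg _).trans (hLε 0)
  have hLf0 : 0 ≤ Lf := (abs_nonneg _).trans (hLf 0)
  refine ⟨Cq * Cβ, Cr * Cq * Lβ + (Lε * M ^ 4 + Cε * (4 * M ^ 3)), Lf, by positivity,
    by positivity, hLf0, fun t t' x y y' m m' ht hq => ?_⟩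
  set a := clamp M y with ha
  set c := clamp M y' with hc
  have hac : |a - c| ≤ |y - y'| := abs_clamp_sub_le M y y'
  have haM : |a| ≤ M := abs_clamp_le hM y
  have hcM : |c| ≤ M := abs_clamp_le hM y'
  have hβ : |D.β a - D.β c| ≤ Lβ * |y - y'| :=
    (abs_sub_le_of_deriv_bound (hD.β_contDiff.differentiable (by norm_num)) hLβ a c).trans
      (by gcongr)
  have hε : |D.ε a - D.ε c| ≤ Lε * |y - y'| :=
    (abs_sub_le_of_deriv_bound (hD.ε_contDiff.differentiable (by norm_num)) hLε a c).trans
      (by gcongr)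
  have hf : |D.f m - D.f m'| ≤ Lf * |m - m'| :=
    abs_sub_le_of_deriv_bound (hD.f_contDiff.differentiable (by norm_num)) hLf m m'
  have hp : |(|a| ^ 3 * a - |c| ^ 3 * c)| ≤ 4 * M ^ 3 * |y - y'| :=
    (abs_pow_three_mul_sub_le haM hcM).trans (by gcongr)
  have hpa : |(|a| ^ 3 * a)| ≤ M ^ 4 := by
    rw [abs_mul, abs_pow, abs_abs, ← pow_succ]
    gcongr
  have hsplit : D.reaction t x a m - D.reaction t' x c m' =
      (D.r t - D.r t') * D.q x * D.β c + D.r t * D.q x * (D.β a - D.β c) +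
        (-((D.ε a - D.ε c) * (|a| ^ 3 * a))) + (-(D.ε c * (|a| ^ 3 * a - |c| ^ 3 * c))) +
          (D.f m - D.f m') := by
    unfold reaction
    ring
  have hβc := hCβ c
  have hεc := hCε c
  have hrt := hCr t ht
  have e1 : |(D.r t - D.r t') * D.q x * D.β c| ≤ |D.r t - D.r t'| * Cq * Cβ := by
    rw [abs_mul, abs_mul]
    gcongr
  have e2 : |D.r t * D.q x * (D.β a - D.β c)| ≤ Cr * Cq * (Lβ * |y - y'|) := by
    rw [abs_mul, abs_mul]
    gcongr
  have e3 : |(-((D.ε a - D.ε c) * (|a| ^ 3 * a)))| ≤ Lε * |y - y'| * M ^ 4 := by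
    rw [abs_neg, abs_mul]
    gcongr
  have e4 : |(-(D.ε c * (|a| ^ 3 * a - |c| ^ 3 * c)))| ≤ Cε * (4 * M ^ 3 * |y - y'|) := by
    rw [abs_neg, abs_mul]
    gcongr
  rw [hsplit]
  refine (abs_add_le _ _).trans ?_
  have s1 := abs_add_le ((D.r t - D.r t') * D.q x * D.β c + D.r t * D.q x * (D.β a - D.β c) +
        (-((D.ε a - D.ε c) * (|a| ^ 3 * a)))) (-(D.ε c * (|a| ^ 3 * a - |c| ^ 3 * c)))
  have s2 := abs_add_le ((D.r t - D.r t') * D.q x * D.β c + D.r t * D.q x * (D.β a - D.β c))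
        (-((D.ε a - D.ε c) * (|a| ^ 3 * a)))
  have s3 := abs_add_le ((D.r t - D.r t') * D.q x * D.β c) (D.r t * D.q x * (D.β a - D.β c))
  linarith

lemma Admissible.memLp_reaction_clamp (hD : D.Admissible) {M : ℝ} (hM : 0 ≤ M) {t : ℝ} (ht : 0 ≤ t)
    (w m : L2I) : MemLp (fun x => D.reaction t x (clamp M (w x)) (m x)) 2 volI := by
  obtain ⟨Cq, hCq, hq⟩ := exists_ae_abs_le hD.q_mem
  obtain ⟨A, Lw, Lm, hA, hLw, hLm, h⟩ := hD.exists_abs_reaction_clamp_sub_le hCq hM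
  have hmeas : ∀ w m : ℝ → ℝ, AEStronglyMeasurable w volI → AEStronglyMeasurable m volI →
      AEStronglyMeasurable (fun x => D.reaction t x (clamp M (w x)) (m x)) volI := by
    intro w m hw hm
    have hc := (continuous_clamp M).comp_aestronglyMeasurable hw
    refine (((hD.q_mem.1.const_mul _).mul (hD.β_contDiff.continuous.comp_aestronglyMeasurable
      hc)).sub (((hD.ε_contDiff.continuous.comp_aestronglyMeasurable hc).mul
        ((continuous_abs.pow 3).comp_aestronglyMeasurable hc)).mul hc)).add
          (hD.f_contDiff.continuous.comp_aestronglyMeasurable hm)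
  obtain ⟨Cr, hCr⟩ := hD.r_bdd
  obtain ⟨Cβ, hCβ⟩ := hD.β_bdd
  obtain ⟨Cε, hCε⟩ := hD.ε_bdd
  obtain ⟨Cf, hCf⟩ := hD.f_bdd
  refine MemLp.of_bound (hmeas w m (memLp_coe w).1 (memLp_coe m).1)
    (Cr * Cq * Cβ + Cε * M ^ 3 * M + Cf) ?_
  filter_upwards [hq] with x hx
  have h1 := hCr t ht
  have h2 := hCβ (clamp M (w x))
  have h3 := hCε (clamp M (w x))
  have h4 := hCf (m x)
  have h5 := abs_clamp_le hM (w x)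
  have h6 : 0 ≤ Cr := (abs_nonneg _).trans h1
  have h7 : 0 ≤ Cε := (abs_nonneg _).trans h3
  refine (abs_add_le _ _).trans (add_le_add ((abs_sub _ _).trans (add_le_add ?_ ?_)) h4)
  · rw [abs_mul, abs_mul]
    gcongr
  · rw [abs_mul, abs_mul, abs_pow, abs_abs]
    gcongr

/-- Extension of a curve `z` on `[0, T]` by the history `h`; it is continuous on the line also if
`z 0 ≠ h 0`. -/
def extend (h : ℝ → L2I) (T : ℝ) (z : ℝ → L2I) (s : ℝ) : L2I :=
  h s + (z (max 0 (min s T)) - z 0)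

/-- The memory `∫_{-τ}^0 k(s, ·) u(t + s) ds` as a Bochner integral in `L²(I)`; `K s` stands for
multiplication by `k(s, ·)`. -/
def memory (τ : ℝ) (K : ℝ → L2I →L[ℝ] L2I) (u : ℝ → L2I) (t : ℝ) : L2I :=
  ∫ s in (-τ)..0, K s (u (t + s))

/-- The right-hand side of the model, with the temperature truncated to `[-M, M]`. -/
def truncatedForcing (D : Data) (M : ℝ) (K : ℝ → L2I →L[ℝ] L2I) (h : ℝ → L2I) (T : ℝ)
    (z : ℝ → L2I) (t : ℝ) : L2I :=
  classL2 fun x => D.reaction t x (clamp M (extend h T z t x)) (memory D.τ K (extend h T z) t x)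

lemma continuous_extend {h : ℝ → L2I} (hh : Continuous h) {T : ℝ} (hT : 0 ≤ T) {z : ℝ → L2I}
    (hz : ContinuousOn z (Icc 0 T)) : Continuous (extend h T z) := by
  refine hh.add (Continuous.sub ?_ continuous_const)
  exact hz.comp_continuous (by fun_prop) fun s => ⟨le_max_left _ _, max_le hT (min_le_right _ _)⟩

lemma norm_extend_sub_le {h : ℝ → L2I} {T t δ : ℝ} {z w : ℝ → L2I} (ht : 0 ≤ t)
    (hδ : ∀ s ∈ Icc 0 t, ‖z s - w s‖ ≤ δ) {s : ℝ} (hs : s ≤ t) :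
    ‖extend h T z s - extend h T w s‖ ≤ 2 * δ := by
  have h1 : extend h T z s - extend h T w s =
      (z (max 0 (min s T)) - w (max 0 (min s T))) - (z 0 - w 0) := by
    unfold extend
    abel
  rw [h1]
  have h2 := hδ (max 0 (min s T)) ⟨le_max_left _ _, max_le ht ((min_le_left _ _).trans hs)⟩
  have h3 := hδ 0 ⟨le_rfl, ht⟩
  exact (norm_sub_le _ _).trans (by linarith)

lemma continuous_memory {τ : ℝ} {K : ℝ → L2I →L[ℝ] L2I} (hK : Continuous K) {u : ℝ → L2I}
    (hu : Continuous u) : Continuous (memory τ K u) := by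
  refine intervalIntegral.continuous_parametric_intervalIntegral_of_continuous' ?_ _ _
  exact (hK.comp continuous_snd).clm_apply (hu.comp (continuous_fst.add continuous_snd))

theorem Admissible.exists_isCausalLipschitz (hD : D.Admissible) {M : ℝ} (hM : 0 ≤ M)
    {K : ℝ → L2I →L[ℝ] L2I} (hK : Continuous K) {h : ℝ → L2I} (hh : Continuous h) {T : ℝ}
    (hT : 0 ≤ T) : ∃ L : ℝ, IsCausalLipschitz T L (D.truncatedForcing M K h T) := by
  obtain ⟨Cq, hCq, hq⟩ := exists_ae_abs_le hD.q_mem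
  obtain ⟨A, Lw, Lm, hA, hLw, hLm, hlip⟩ := hD.exists_abs_reaction_clamp_sub_le hCq hM
  obtain ⟨K₁, hK₁, hnorm⟩ := norm_le_of_ae_abs_le
  obtain ⟨CK, hCK⟩ := isCompact_Icc.exists_bound_of_continuousOn (s := Icc (-D.τ) 0)
    hK.continuousOn
  have hCK0 : 0 ≤ CK := (norm_nonneg _).trans (hCK 0 ⟨by linarith [hD.τ_pos], le_rfl⟩)
  have hτ := hD.τ_pos
  -- this estimate gives continuity in time (`w = z`) and the Lipschitz property (`t = t'`)
  have key : ∀ z w : ℝ → L2I, ∀ t t' : ℝ, 0 ≤ t → 0 ≤ t' →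
      ‖D.truncatedForcing M K h T z t - D.truncatedForcing M K h T w t'‖ ≤
        K₁ * (A * |D.r t - D.r t'|) + Lw * ‖extend h T z t - extend h T w t'‖ +
          Lm * ‖memory D.τ K (extend h T z) t - memory D.τ K (extend h T w) t'‖ := by
    intro z w t t' ht ht'
    refine hnorm _ _ _ _ _ _ (by positivity) hLw hLm ?_
    filter_upwards [hq, Lp.coeFn_sub (D.truncatedForcing M K h T z t)
      (D.truncatedForcing M K h T w t'), Lp.coeFn_sub (extend h T z t) (extend h T w t'),
      Lp.coeFn_sub (memory D.τ K (extend h T z) t) (memory D.τ K (extend h T w) t'),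
      coeFn_classL2 (hD.memLp_reaction_clamp hM ht (extend h T z t)
        (memory D.τ K (extend h T z) t)),
      coeFn_classL2 (hD.memLp_reaction_clamp hM ht' (extend h T w t')
        (memory D.τ K (extend h T w) t'))] with x h0 h1 h2 h3 h4 h5
    rw [h1, h2, h3, Pi.sub_apply, Pi.sub_apply, Pi.sub_apply, truncatedForcing, truncatedForcing,
      h4, h5]
    exact hlip _ _ _ _ _ _ _ ht h0
  refine ⟨Lw * 2 + Lm * (D.τ * CK * 2), by positivity, fun z hz => ?_,
    fun z w hz hw t ht δ hδ => ?_⟩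
  · intro t₀ ht₀
    have c1 := (continuous_extend hh hT hz)
    have c2 := continuous_memory (τ := D.τ) hK c1
    have hr : ContinuousWithinAt D.r (Icc 0 T) t₀ :=
      (hD.r_contDiff.continuousOn t₀ ht₀.1).mono fun s hs => hs.1
    rw [ContinuousWithinAt, tendsto_iff_norm_sub_tendsto_zero]
    have hlim : Tendsto (fun t => K₁ * (A * |D.r t - D.r t₀|) +
        Lw * ‖extend h T z t - extend h T z t₀‖ +
          Lm * ‖memory D.τ K (extend h T z) t - memory D.τ K (extend h T z) t₀‖)
        (𝓝[Icc 0 T] t₀) (𝓝 (K₁ * (A * |D.r t₀ - D.r t₀|) +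
        Lw * ‖extend h T z t₀ - extend h T z t₀‖ +
          Lm * ‖memory D.τ K (extend h T z) t₀ - memory D.τ K (extend h T z) t₀‖)) := by
      refine Tendsto.add (Tendsto.add ?_ ?_) ?_
      · exact (((hr.sub_const _).abs).const_mul A).const_mul K₁
      · exact ((c1.continuousWithinAt.sub_const _).norm).const_mul Lw
      · exact ((c2.continuousWithinAt.sub_const _).norm).const_mul Lm
    simp only [sub_self, abs_zero, norm_zero, mul_zero, add_zero] at hlim
    refine squeeze_zero' (Eventually.of_forall fun _ => norm_nonneg _) ?_ hlim
    filter_upwards [self_mem_nhdsWithin] with t ht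
    exact key z z t t₀ ht.1 ht₀.1
  · have hδ0 : 0 ≤ δ := (norm_nonneg _).trans (hδ 0 ⟨le_rfl, ht.1⟩)
    have h1 := key z w t t ht.1 ht.1
    have h2 := norm_extend_sub_le (h := h) (T := T) ht.1 hδ le_rfl
    have hint : ∀ z, ContinuousOn z (Icc 0 T) →
        IntervalIntegrable (fun s => K s (extend h T z (t + s))) volume (-D.τ) 0 := fun z hz =>
      Continuous.intervalIntegrable (hK.clm_apply
        ((continuous_extend hh hT hz).comp (continuous_const.add continuous_id))) _ _
    have h3 : ‖memory D.τ K (extend h T z) t - memory D.τ K (extend h T w) t‖ ≤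
        D.τ * CK * 2 * δ := by
      rw [memory, memory, ← intervalIntegral.integral_sub (hint z hz) (hint w hw)]
      have h4 := intervalIntegral.norm_integral_le_of_norm_le_const (a := -D.τ) (b := 0)
        (C := CK * (2 * δ))
        (f := fun s => K s (extend h T z (t + s)) - K s (extend h T w (t + s))) ?_
      · rw [zero_sub, neg_neg, abs_of_pos hτ] at h4
        linarith
      · intro s hs
        rw [uIoc_of_le (by linarith)] at hs
        rw [← map_sub]
        refine (ContinuousLinearMap.le_opNorm _ _).trans ?_
        have h5 := hCK s ⟨hs.1.le, hs.2⟩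
        have h6 := norm_extend_sub_le (h := h) (T := T) ht.1 hδ (s := t + s) (by linarith [hs.2])
        gcongr
    simp only [sub_self, abs_zero, mul_zero, zero_add] at h1
    calc _ ≤ _ := h1
      _ ≤ Lw * (2 * δ) + Lm * (D.τ * CK * 2 * δ) := by gcongr
      _ = _ := by ring

end Data

/-! ### The history function as a Bochner integral -/

section History

variable {τ : ℝ} {k : ℝ → ℝ → ℝ}

/-- Multiplication by `k(s, ·)` is a norm continuous family of operators on `L²(I)`. -/
lemma exists_multiplication_operators (hτ : 0 ≤ τ)
    (hk : ContinuousOn (fun z : ℝ × ℝ => k z.1 z.2) (Icc (-τ) 0 ×ˢ Icc (-1) 1)) :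
    ∃ K : ℝ → L2I →L[ℝ] L2I, Continuous K ∧
      ∀ s ∈ Icc (-τ) 0, ∀ w : L2I, K s w =ᵐ[volI] fun x => k s x * w x := by
  have hcpt : IsCompact (Icc (-τ) 0 ×ˢ Icc (-1 : ℝ) 1) := isCompact_Icc.prod isCompact_Icc
  obtain ⟨C, hC⟩ := hcpt.exists_bound_of_continuousOn hk
  have hC0 : 0 ≤ C := (norm_nonneg _).trans (hC (0, 0) ⟨⟨by linarith, le_rfl⟩, by norm_num⟩)
  set π : ℝ → ℝ := fun s => max (-τ) (min s 0) with hπ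
  have hπm : ∀ s, π s ∈ Icc (-τ) 0 := fun s =>
    ⟨le_max_left _ _, max_le (by linarith) (min_le_right _ _)⟩
  have hπc : Continuous π := by fun_prop
  -- `k` is used through the projection `π` onto `[-τ, 0]`, so that `K` is continuous on the line
  have hmeas : ∀ s, AEStronglyMeasurable (fun x => k (π s) x) volI := fun s => by
    have h1 : ContinuousOn (fun x => k (π s) x) I :=
      hk.comp (f := fun x : ℝ => (π s, x)) (by fun_prop) fun x hx =>
        ⟨hπm s, Ioo_subset_Icc_self hx⟩
    exact h1.aestronglyMeasurable measurableSet_I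
  have hbd : ∀ s, ∀ᵐ x ∂volI, |k (π s) x| ≤ C := fun s => by
    filter_upwards [ae_restrict_mem measurableSet_I] with x hx
    exact hC (π s, x) ⟨hπm s, Ioo_subset_Icc_self hx⟩
  have hL : ∀ s (w : L2I), MemLp (fun x => k (π s) x * w x) 2 volI := by
    intro s w
    refine MemLp.of_le_mul (memLp_coe w) ((hmeas s).mul (memLp_coe w).1) (c := C) ?_
    filter_upwards [hbd s] with x hx
    rw [norm_mul]
    exact mul_le_mul_of_nonneg_right hx (norm_nonneg _)
  have hex : ∀ s, ∃ K : L2I →L[ℝ] L2I, ∀ w, K w =ᵐ[volI] fun x => k (π s) x * w x := by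
    intro s
    refine ⟨LinearMap.mkContinuous ⟨⟨fun w => (hL s w).toLp _, fun w z => ?_⟩, fun c w => ?_⟩ C
      fun w => ?_, fun w => (hL s w).coeFn_toLp⟩
    · apply Lp.ext
      filter_upwards [(hL s (w + z)).coeFn_toLp, Lp.coeFn_add ((hL s w).toLp _) ((hL s z).toLp _),
        (hL s w).coeFn_toLp, (hL s z).coeFn_toLp, Lp.coeFn_add w z] with x h1 h2 h3 h4 h5
      rw [h1, h2, Pi.add_apply, h3, h4, h5, Pi.add_apply, mul_add]
    · apply Lp.ext
      filter_upwards [(hL s (c • w)).coeFn_toLp, Lp.coeFn_smul c ((hL s w).toLp _),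
        (hL s w).coeFn_toLp, Lp.coeFn_smul c w] with x h1 h2 h3 h4
      simp only [RingHom.id_apply]
      rw [h1, h2, Pi.smul_apply, h3, h4, Pi.smul_apply, smul_eq_mul, smul_eq_mul]
      ring
    · refine Lp.norm_le_mul_norm_of_ae_le_mul ?_
      filter_upwards [(hL s w).coeFn_toLp, hbd s] with x h1 h2
      simp only [LinearMap.coe_mk, AddHom.coe_mk]
      rw [h1, norm_mul]
      exact mul_le_mul_of_nonneg_right h2 (norm_nonneg _)
  choose K hK using hex
  refine ⟨K, ?_, fun s hs w => ?_⟩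
  · rw [Metric.continuous_iff]
    intro s₀ δ hδ
    -- uniform continuity of `k` is continuity of `K` in operator norm
    have huc := hcpt.uniformContinuousOn_of_continuous hk
    obtain ⟨η, hη, hunif⟩ := Metric.uniformContinuousOn_iff.1 huc (δ / 2) (by positivity)
    obtain ⟨η', hη', hπη⟩ := Metric.continuous_iff.1 hπc s₀ η hη
    refine ⟨η', hη', fun s hs => ?_⟩
    rw [dist_eq_norm]
    refine lt_of_le_of_lt (ContinuousLinearMap.opNorm_le_bound _ (by positivity : 0 ≤ δ / 2)
      fun w => ?_) (by linarith)
    refine Lp.norm_le_mul_norm_of_ae_le_mul ?_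
    rw [sub_apply]
    filter_upwards [Lp.coeFn_sub (K s w) (K s₀ w), hK s w, hK s₀ w,
      ae_restrict_mem measurableSet_I] with x h1 h2 h3 hx
    rw [h1, Pi.sub_apply, h2, h3, ← sub_mul, norm_mul]
    refine mul_le_mul_of_nonneg_right ?_ (norm_nonneg _)
    have h4 := hunif (π s, x) ⟨hπm s, Ioo_subset_Icc_self hx⟩ (π s₀, x)
      ⟨hπm s₀, Ioo_subset_Icc_self hx⟩ (by
        rw [Prod.dist_eq, dist_self, max_eq_left dist_nonneg]
        exact hπη s hs)
    rw [Real.dist_eq] at h4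
    exact h4.le
  · have : π s = s := by
      rw [hπ]
      simp only
      rw [min_eq_left hs.2, max_eq_right hs.1]
    have h1 := hK s w
    rwa [this] at h1

/-- The representatives of a continuous curve in `V` are jointly continuous, which provides
measurability in `(t, x)`. -/
lemma continuousOn_rep {ρ₀ : ℝ} (hρ : 0 < ρ₀) {s : Set ℝ} {w : ℝ → V ρ₀} (hw : ContinuousOn w s) :
    ContinuousOn (fun z : ℝ × ℝ => (w z.1).rep z.2) (s ×ˢ I) := by
  rintro ⟨t₀, x₀⟩ ⟨ht₀ : t₀ ∈ s, hx₀ : x₀ ∈ I⟩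
  obtain ⟨m, hm0, hm1⟩ := exists_between (mem_I_iff_abs.1 hx₀)
  obtain ⟨C, hC, hCrep⟩ := V.exists_abs_rep_le hρ hm1
  rw [ContinuousWithinAt, tendsto_iff_norm_sub_tendsto_zero]
  have h1 : Tendsto (fun z : ℝ × ℝ => C * ‖w z.1 - w t₀‖ + |(w t₀).rep z.2 - (w t₀).rep x₀|)
      (𝓝[s ×ˢ I] (t₀, x₀)) (𝓝 (C * ‖w t₀ - w t₀‖ + |(w t₀).rep x₀ - (w t₀).rep x₀|)) := by
    rw [nhdsWithin_prod_eq]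
    refine Tendsto.add ?_ ?_
    · exact ((((hw t₀ ht₀).tendsto.sub_const _).norm).const_mul C).comp tendsto_fst
    · exact ((((w t₀).rep_spec.1.continuousOn x₀ hx₀).tendsto.sub_const _).abs).comp tendsto_snd
  simp only [sub_self, norm_zero, mul_zero, abs_zero, add_zero] at h1
  refine squeeze_zero' (Eventually.of_forall fun _ => norm_nonneg _) ?_ h1
  have h2 : ∀ᶠ z : ℝ × ℝ in 𝓝[s ×ˢ I] (t₀, x₀), |z.2| ≤ m := by
    refine mem_nhdsWithin_of_mem_nhds ?_
    refine (continuous_abs.comp continuous_snd).continuousAt.eventually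
      (p := fun y => y ≤ m) (eventually_le_nhds hm0)
  filter_upwards [h2, self_mem_nhdsWithin] with z hz hzs
  have h3 := hCrep (w z.1 - w t₀) z.2 hz
  rw [V.rep_sub _ _ hzs.2] at h3
  have h4 : (w z.1).rep z.2 - (w t₀).rep x₀ =
      ((w z.1).rep z.2 - (w t₀).rep z.2) + ((w t₀).rep z.2 - (w t₀).rep x₀) := by ring
  rw [h4]
  exact (abs_add_le _ _).trans (by gcongr)

/-- Pointwise integration in time agrees with Bochner integration in `L²(I)`. -/
theorem integral_mul_rep_ae_eq {ρ₀ : ℝ} (hρ : 0 < ρ₀) (hτ : 0 ≤ τ)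
    (hk : ContinuousOn (fun z : ℝ × ℝ => k z.1 z.2) (Icc (-τ) 0 ×ˢ Icc (-1) 1))
    {K : ℝ → L2I →L[ℝ] L2I} (hKc : Continuous K)
    (hK : ∀ s ∈ Icc (-τ) 0, ∀ w : L2I, K s w =ᵐ[volI] fun x => k s x * w x)
    {w : ℝ → V ρ₀} (hw : ContinuousOn w (Icc (-τ) 0)) :
    (∫ s in (-τ)..0, K s (w s).toL2 : L2I) =ᵐ[volI]
      fun x => ∫ s in (-τ)..0, k s x * (w s).rep x := by
  have hle : -τ ≤ 0 := by linarith
  set ν : Measure ℝ := volume.restrict (Ioc (-τ) 0) with hν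
  set φ : ℝ × ℝ → ℝ := fun z => k z.1 z.2 * (w z.1).rep z.2 with hφ
  have hsub : Ioc (-τ) 0 ×ˢ I ⊆ Icc (-τ) 0 ×ˢ I := prod_mono Ioc_subset_Icc_self le_rfl
  have hφc : ContinuousOn φ (Ioc (-τ) 0 ×ˢ I) :=
    (hk.mono (hsub.trans (prod_mono le_rfl Ioo_subset_Icc_self))).mul
      ((continuousOn_rep hρ hw).mono hsub)
  have hφm : AEStronglyMeasurable φ (ν.prod volI) := by
    rw [hν, Measure.prod_restrict]
    exact hφc.aestronglyMeasurable (measurableSet_Ioc.prod measurableSet_I)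
  have hsec : ∀ s ∈ Ioc (-τ) 0, K s (w s).toL2 =ᵐ[volI] fun x => φ (s, x) := by
    intro s hs
    filter_upwards [hK s (Ioc_subset_Icc_self hs) (w s).toL2, (w s).rep_spec.2.1] with x h1 h2
    rw [h1, h2]
  have hcurve : ContinuousOn (fun s => K s (w s).toL2) (Icc (-τ) 0) :=
    hKc.continuousOn.clm_apply ((V.toL2CLM ρ₀).continuous.comp_continuousOn hw)
  obtain ⟨R, hR⟩ := isCompact_Icc.exists_bound_of_continuousOn hcurve
  obtain ⟨K₁, hK₁, hL1⟩ := exists_integral_abs_le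
  -- both sides have the same integral over every measurable `A ⊆ I`, by Fubini
  have hφi : Integrable φ (ν.prod volI) := by
    rw [integrable_prod_iff hφm]
    constructor
    · rw [hν]
      filter_upwards [ae_restrict_mem measurableSet_Ioc] with s hs
      exact (integrable_coe _).congr (hsec s hs)
    · refine Integrable.of_bound (C := K₁ * R) hφm.norm.integral_prod_right' ?_
      rw [hν]
      filter_upwards [ae_restrict_mem measurableSet_Ioc] with s hs
      rw [Real.norm_of_nonneg (integral_nonneg fun _ => norm_nonneg _)]
      have h1 : ∫ x, ‖φ (s, x)‖ ∂volI = ∫ x, |(K s (w s).toL2) x| ∂volI := by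
        refine integral_congr_ae ?_
        filter_upwards [hsec s hs] with x hx
        rw [hx, Real.norm_eq_abs]
      rw [h1]
      refine (hL1 _).trans ?_
      gcongr
      exact hR s (Ioc_subset_Icc_self hs)
  have hint : IntervalIntegrable (fun s => K s (w s).toL2) volume (-τ) 0 := by
    refine ContinuousOn.intervalIntegrable ?_
    rwa [uIcc_of_le hle]
  have hH : Integrable (fun x => ∫ s, φ (s, x) ∂ν) volI := hφi.integral_prod_right
  have hHeq : (fun x => ∫ s in (-τ)..0, k s x * (w s).rep x) = fun x => ∫ s, φ (s, x) ∂ν := by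
    ext x
    rw [intervalIntegral.integral_of_le hle]
  rw [hHeq]
  refine Integrable.ae_eq_of_forall_setIntegral_eq _ _ (integrable_coe _) hH fun A hA hAfin => ?_
  rw [← L2.inner_indicatorConstLp_one (𝕜 := ℝ) hA hAfin.ne]
  have h1 := (innerSL ℝ (indicatorConstLp 2 hA hAfin.ne (1 : ℝ))).intervalIntegral_comp_comm hint
  simp only [innerSL_apply_apply, L2.inner_indicatorConstLp_one] at h1
  rw [L2.inner_indicatorConstLp_one, ← h1, intervalIntegral.integral_of_le hle]
  have hφA : Integrable φ (ν.prod (volI.restrict A)) := by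
    have h2 : ν.prod (volI.restrict A) = (ν.prod volI).restrict (univ ×ˢ A) := by
      rw [← Measure.prod_restrict, Measure.restrict_univ]
    rw [h2]
    exact hφi.restrict
  rw [← integral_integral_swap (f := fun s x => φ (s, x)) hφA]
  refine setIntegral_congr_fun measurableSet_Ioc fun s hs => ?_
  exact setIntegral_congr_ae hA (by
    filter_upwards [hsec s hs] with x hx _ using hx)

end History

/-! ### A priori bound and reduction to the truncated problem -/

lemma abs_le_of_forcing_sign {ρ₀ : ℝ} (hρ : 0 < ρ₀) {T : ℝ} (hT : 0 ≤ T) {u v g : ℝ → L2I}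
    (hv : MemLp v 2 (volume.restrict (Ioo 0 T))) (hg : MemLp g 2 (volume.restrict (Ioo 0 T)))
    (hA : ∀ᵐ t ∂(volume.restrict (Ioo 0 T)), OpA ρ₀ (u t) (v t))
    (hu : ∀ t ∈ Icc 0 T, u t = u 0 + ∫ s in (0 : ℝ)..t, (v s + g s)) {M : ℝ}
    (h0 : ∀ᵐ x ∂volI, |u 0 x| ≤ M)
    (hgM : ∀ t ∈ Icc 0 T, ∀ᵐ x ∂volI, (M ≤ u t x → g t x ≤ 0) ∧ (u t x ≤ -M → 0 ≤ g t x)) :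
    ∀ t ∈ Icc 0 T, ∀ᵐ x ∂volI, |u t x| ≤ M := by
  intro t ht
  have hgM' : ∀ᵐ s ∂(volume.restrict (Ioo 0 T)), ∀ᵐ x ∂volI,
      (M ≤ u s x → g s x ≤ 0) ∧ (u s x ≤ -M → 0 ≤ g s x) := by
    filter_upwards [ae_restrict_mem measurableSet_Ioo] with s hs
    exact hgM s (Ioo_subset_Icc_self hs)
  have h1 := le_of_forcing_nonpos hρ hT hv hg hA hu (h0.mono fun x hx => (abs_le.1 hx).2)
    (hgM'.mono fun s hs => hs.mono fun x hx h => hx.1 h.le) t ht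
  have h2 := ge_of_forcing_nonneg hρ hT hv hg hA hu (h0.mono fun x hx => (abs_le.1 hx).1)
    (hgM'.mono fun s hs => hs.mono fun x hx h => hx.2 h.le) t ht
  filter_upwards [h1, h2] with x h3 h4 using abs_le.2 ⟨h4, h3⟩

lemma OpA.summable_mul_sq_coeff {ρ₀ : ℝ} {b : HilbertBasis ℕ ℝ L2I} {lam : ℕ → ℝ}
    (hlam : ∀ n, 0 ≤ lam n)
    (hA : ∀ w v, OpA ρ₀ w v ↔ ∀ n, inner ℝ (b n) v = -lam n * inner ℝ (b n) w) {w v : L2I}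
    (h : OpA ρ₀ w v) : Summable fun n => lam n * (inner ℝ (b n) w) ^ 2 := by
  refine Summable.of_nonneg_of_le (fun n => mul_nonneg (hlam n) (sq_nonneg _)) (fun n => ?_)
    ((hasSum_sq_coeff b w).summable.add (hasSum_sq_coeff b v).summable)
  -- `l y² ≤ y² + (l y)²`
  rw [(hA w v).1 h n]
  nlinarith [sq_nonneg (1 - lam n), sq_nonneg (inner ℝ (b n) w),
    mul_nonneg (sq_nonneg (1 - lam n)) (sq_nonneg (inner ℝ (b n) w)), hlam n,
    mul_nonneg (hlam n) (sq_nonneg (inner ℝ (b n) w)), sq_nonneg (lam n * inner ℝ (b n) w)]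

namespace Data

variable {D : Data}

/-- The initial history as a curve in `L²(I)`, extended by constants from `[-τ, 0]` to the line. -/
def past (D : Data) (u₀ : ℝ → V D.ρ₀) (s : ℝ) : L2I := (u₀ (max (-D.τ) (min s 0))).toL2

lemma continuous_past {u₀ : ℝ → V D.ρ₀} (hτ : 0 ≤ D.τ) (hu₀ : ContinuousOn u₀ (Icc (-D.τ) 0)) :
    Continuous (D.past u₀) :=
  (V.toL2CLM D.ρ₀).continuous.comp <| hu₀.comp_continuous (by fun_prop) fun _ =>
    ⟨le_max_left _ _, max_le (by linarith) (min_le_right _ _)⟩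

lemma past_of_mem {u₀ : ℝ → V D.ρ₀} {s : ℝ} (hs : s ∈ Icc (-D.τ) 0) :
    D.past u₀ s = (u₀ s).toL2 := by
  rw [past, min_eq_left hs.2, max_eq_right hs.1]

lemma past_of_nonneg {u₀ : ℝ → V D.ρ₀} (hτ : 0 ≤ D.τ) {s : ℝ} (hs : 0 ≤ s) :
    D.past u₀ s = (u₀ 0).toL2 := by
  rw [past, min_eq_right hs, max_eq_right (by linarith)]

section Reduction

variable {u₀ : ℝ → V D.ρ₀} {T : ℝ} {U : ℝ → V D.ρ₀} {z : ℝ → L2I}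

lemma extend_past_eq (hτ : 0 ≤ D.τ) (hT : 0 ≤ T) (hUz : ∀ t ∈ Icc 0 T, (U t).toL2 = z t)
    (hU₀ : ∀ s ∈ Icc (-D.τ) 0, U s = u₀ s) {s : ℝ} (hs : s ∈ Icc (-D.τ) T) :
    extend (D.past u₀) T z s = (U s).toL2 := by
  have hz0 : z 0 = (u₀ 0).toL2 := by
    rw [← hUz 0 ⟨le_rfl, hT⟩, hU₀ 0 ⟨by linarith, le_rfl⟩]
  rw [extend, min_eq_left hs.2]
  rcases le_total s 0 with h | h
  · rw [max_eq_left h, sub_self, add_zero, past_of_mem ⟨hs.1, h⟩, hU₀ s ⟨hs.1, h⟩]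
  · rw [max_eq_right h, past_of_nonneg hτ h, hz0, hUz s ⟨h, hs.2⟩]
    abel

lemma Admissible.memory_ae_eq_history (hD : D.Admissible) {K : ℝ → L2I →L[ℝ] L2I}
    (hKc : Continuous K)
    (hK : ∀ s ∈ Icc (-D.τ) 0, ∀ w : L2I, K s w =ᵐ[volI] fun x => D.k s x * w x)
    (hUc : ContinuousOn U (Icc (-D.τ) T)) (hUz : ∀ t ∈ Icc 0 T, (U t).toL2 = z t)
    (hU₀ : ∀ s ∈ Icc (-D.τ) 0, U s = u₀ s) {t : ℝ} (ht : t ∈ Icc 0 T) :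
    memory D.τ K (extend (D.past u₀) T z) t =ᵐ[volI] D.history fun s => U (t + s) := by
  have hτ := hD.τ_pos.le
  have hm : ∀ s ∈ Icc (-D.τ) 0, t + s ∈ Icc (-D.τ) T := fun s hs =>
    ⟨by linarith [hs.1, ht.1], by linarith [hs.2, ht.2]⟩
  have h1 : memory D.τ K (extend (D.past u₀) T z) t =
      ∫ s in (-D.τ)..0, K s (U (t + s)).toL2 := by
    refine intervalIntegral.integral_congr fun s hs => ?_
    rw [uIcc_of_le (by linarith)] at hs
    rw [extend_past_eq hτ (ht.1.trans ht.2) hUz hU₀ (hm s hs)]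
  rw [h1]
  exact integral_mul_rep_ae_eq hD.ρ₀_pos hτ hD.k_contDiff.continuousOn hKc hK
    (w := fun s => U (t + s)) (hUc.comp (by fun_prop) hm)

/-- Along a curve bounded by `M`, the truncated forcing is the right-hand side of the model. -/
lemma Admissible.truncatedForcing_ae_eq (hD : D.Admissible) {M : ℝ} (hM : 0 ≤ M)
    {K : ℝ → L2I →L[ℝ] L2I} (hKc : Continuous K)
    (hK : ∀ s ∈ Icc (-D.τ) 0, ∀ w : L2I, K s w =ᵐ[volI] fun x => D.k s x * w x)
    (hUc : ContinuousOn U (Icc (-D.τ) T)) (hUz : ∀ t ∈ Icc 0 T, (U t).toL2 = z t)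
    (hU₀ : ∀ s ∈ Icc (-D.τ) 0, U s = u₀ s) {t : ℝ} (ht : t ∈ Icc 0 T)
    (hbd : ∀ᵐ x ∂volI, |z t x| ≤ M) :
    D.truncatedForcing M K (D.past u₀) T z t =ᵐ[volI]
      fun x => D.G t (U t) x + D.F (fun s => U (t + s)) x := by
  have hτ := hD.τ_pos.le
  have hext : extend (D.past u₀) T z t = z t := by
    rw [extend_past_eq hτ (ht.1.trans ht.2) hUz hU₀ ⟨by linarith [ht.1], ht.2⟩, hUz t ht]
  filter_upwards [hbd, coeFn_classL2 (hD.memLp_reaction_clamp hM ht.1 (extend (D.past u₀) T z t)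
    (memory D.τ K (extend (D.past u₀) T z) t)), (U t).rep_spec.2.1,
    hD.memory_ae_eq_history hKc hK hUc hUz hU₀ ht] with x h1 h2 h3 h4
  rw [truncatedForcing, h2, hext, clamp_eq_self (abs_le.1 h1).1 (abs_le.1 h1).2, h4,
    ← hUz t ht, h3]
  rfl

variable {b : HilbertBasis ℕ ℝ L2I} {lam : ℕ → ℝ} {S : ℝ → L2I →L[ℝ] L2I}

/-- Every mild solution is bounded by `M`, hence solves the truncated problem. -/
lemma IsMildSolution.eq_duhamelMap (hU : D.IsMildSolution u₀ T U) (hD : D.Admissible) (hT : 0 ≤ T)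
    (hlam : ∀ n, 0 ≤ lam n)
    (hA : ∀ w v, OpA D.ρ₀ w v ↔ ∀ n, inner ℝ (b n) v = -lam n * inner ℝ (b n) w)
    (hS : IsDiagonalSemigroup b lam S) (hu₀A : InDomA D.ρ₀ (u₀ 0).toL2) {M Cq : ℝ} (hM : 0 ≤ M)
    (hq : ∀ᵐ x ∂volI, |D.q x| ≤ Cq)
    (hsign : ∀ t x y m : ℝ, 0 ≤ t → |D.q x| ≤ Cq →
      (M ≤ y → D.reaction t x y m ≤ 0) ∧ (y ≤ -M → 0 ≤ D.reaction t x y m))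
    (h0 : ∀ᵐ x ∂volI, |(u₀ 0).toL2 x| ≤ M) {K : ℝ → L2I →L[ℝ] L2I} (hKc : Continuous K)
    (hK : ∀ s ∈ Icc (-D.τ) 0, ∀ w : L2I, K s w =ᵐ[volI] fun x => D.k s x * w x) :
    ∀ t ∈ Icc 0 T, (U t).toL2 = duhamelMap S (u₀ 0).toL2
      (D.truncatedForcing M K (D.past u₀) T) (fun t => (U t).toL2) t := by
  have hτ := hD.τ_pos.le
  obtain ⟨S', g, hS', hgeq, hg, hduh⟩ := hU.duhamel
  have hS'd : IsDiagonalSemigroup b lam S' := hS'.isDiagonalSemigroup hlam hA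
  -- the semigroups of two mild solutions may differ at negative times only
  have hSS : ∀ t, 0 ≤ t → S' t = S t := fun t ht => by
    ext1 y
    exact ext_coeff b fun n => by rw [hS'd t ht, hS t ht]
  obtain ⟨v₀, hv₀⟩ := hu₀A
  obtain ⟨⟨v, hv, hvA, hvu⟩, -⟩ := hS'd.duhamel_regularity hlam hT hg
    (OpA.summable_mul_sq_coeff hlam hA hv₀) hduh
  have hU0 : U 0 = u₀ 0 := hU.initial 0 ⟨by linarith, le_rfl⟩
  have hbd := abs_le_of_forcing_sign hD.ρ₀_pos hT (u := fun t => (U t).toL2) hv hg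
    (hvA.mono fun t ht => (hA _ _).2 ht) hvu (M := M) (by simpa only [hU0] using h0) (by
      intro t ht
      filter_upwards [hq, hgeq t ht, (U t).rep_spec.2.1] with x h1 h2 h3
      rw [h2, h3]
      exact hsign t x _ (D.history (fun s => U (t + s)) x) ht.1 h1)
  intro t ht
  refine (hduh t ht).trans ?_
  rw [duhamelMap, hSS t ht.1]
  congr 1
  refine intervalIntegral.integral_congr fun s hs => ?_
  rw [uIcc_of_le ht.1] at hs
  have hs' : s ∈ Icc 0 T := ⟨hs.1, hs.2.trans ht.2⟩
  rw [hSS _ (by linarith [hs.2])]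
  congr 1
  apply Lp.ext
  exact (hgeq s hs').trans (hD.truncatedForcing_ae_eq hM hKc hK hU.continuousOn (fun _ _ => rfl)
    hU.initial hs' (hbd s hs')).symm

/-- A solution of the truncated problem is bounded by `M`, hence is a mild solution. -/
lemma Admissible.exists_isMildSolution (hD : D.Admissible) (hT : 0 ≤ T)
    (hu₀ : ContinuousOn u₀ (Icc (-D.τ) 0)) {E : ℕ → V D.ρ₀}
    (hlam : ∀ n, 0 ≤ lam n) (hE : ∀ n, (E n).toL2 = b n)
    (hEA : ∀ n, OpA D.ρ₀ (b n) (-lam n • b n))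
    (hS : IsDiagonalSemigroup b lam S) (hu₀A : InDomA D.ρ₀ (u₀ 0).toL2) {M Cq : ℝ} (hM : 0 ≤ M)
    (hq : ∀ᵐ x ∂volI, |D.q x| ≤ Cq)
    (hsign : ∀ t x y m : ℝ, 0 ≤ t → |D.q x| ≤ Cq →
      (M ≤ y → D.reaction t x y m ≤ 0) ∧ (y ≤ -M → 0 ≤ D.reaction t x y m))
    (h0 : ∀ᵐ x ∂volI, |(u₀ 0).toL2 x| ≤ M) {K : ℝ → L2I →L[ℝ] L2I} (hKc : Continuous K)
    (hK : ∀ s ∈ Icc (-D.τ) 0, ∀ w : L2I, K s w =ᵐ[volI] fun x => D.k s x * w x)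
    (hzc : ContinuousOn z (Icc 0 T))
    (hz : ∀ t ∈ Icc 0 T, z t = duhamelMap S (u₀ 0).toL2
      (D.truncatedForcing M K (D.past u₀) T) z t) :
    ∃ U : ℝ → V D.ρ₀, D.IsMildSolution u₀ T U := by
  have hτ := hD.τ_pos.le
  have hρ := hD.ρ₀_pos
  have hA := opA_iff_coeff hρ hE hEA
  set g : ℝ → L2I := D.truncatedForcing M K (D.past u₀) T z with hgdef
  obtain ⟨L, hL⟩ := hD.exists_isCausalLipschitz hM hKc (continuous_past hτ hu₀) hT
  have hg : MemLp g 2 (volume.restrict (Ioo 0 T)) :=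
    memLp_two_of_continuousOn (hL.continuousOn z hzc)
  obtain ⟨v₀, hv₀⟩ := id hu₀A
  obtain ⟨⟨v, hv, hvA, hvz⟩, hcont, B, hB, hzB⟩ := hS.duhamel_regularity hlam hT hg
    (OpA.summable_mul_sq_coeff hlam hA hv₀) hz
  obtain ⟨U₁, hU₁c, hU₁⟩ := exists_continuousOn_V hρ hlam hE hEA hcont hB hzB
  have hSA : IsSemigroupGeneratedBy (OpA D.ρ₀) S := hS.isSemigroupGeneratedBy hlam hA
  have hz0 : z 0 = (u₀ 0).toL2 := by
    rw [hz 0 ⟨le_rfl, hT⟩, duhamelMap, intervalIntegral.integral_same, add_zero, hSA.map_zero,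
      ContinuousLinearMap.id_apply]
  have hU₁0 : U₁ 0 = u₀ 0 := V.toL2_injective (by rw [hU₁ 0 ⟨le_rfl, hT⟩, hz0])
  classical
  set U : ℝ → V D.ρ₀ := fun t => if t ≤ 0 then u₀ t else U₁ t with hUdef
  have hU₀ : ∀ s ∈ Icc (-D.τ) 0, U s = u₀ s := fun s hs => if_pos hs.2
  have hUU₁ : ∀ t ∈ Icc 0 T, U t = U₁ t := by
    intro t ht
    rcases ht.1.eq_or_lt with h | h
    · rw [← h, hU₁0]
      exact if_pos le_rfl
    · exact if_neg h.not_ge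
  have hUz : ∀ t ∈ Icc 0 T, (U t).toL2 = z t := fun t ht => by rw [hUU₁ t ht, hU₁ t ht]
  have hUc : ContinuousOn U (Icc (-D.τ) T) := by
    rw [← Icc_union_Icc_eq_Icc (by linarith : -D.τ ≤ 0) hT]
    exact (hu₀.congr hU₀).union_of_isClosed (hU₁c.congr hUU₁) isClosed_Icc isClosed_Icc
  have hvA' : ∀ᵐ t ∂(volume.restrict (Ioo 0 T)), OpA D.ρ₀ (z t) (v t) :=
    hvA.mono fun t ht => (hA _ _).2 ht
  have hbd := abs_le_of_forcing_sign hρ hT hv hg hvA' hvz (M := M) (by rwa [hz0]) (by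
      intro t ht
      have hext : extend (D.past u₀) T z t = z t := by
        rw [extend_past_eq hτ hT hUz hU₀ ⟨by linarith [ht.1], ht.2⟩, hUz t ht]
      filter_upwards [hq, coeFn_classL2 (hD.memLp_reaction_clamp hM ht.1
        (extend (D.past u₀) T z t) (memory D.τ K (extend (D.past u₀) T z) t))] with x h1 h2
      rw [hgdef, truncatedForcing, h2, hext]
      -- where `|z| ≥ M` the truncated temperature is `±M`, and the sign condition applies to it
      constructor
      · intro h
        rw [clamp_of_ge hM h]
        exact (hsign t x M _ ht.1 h1).1 le_rfl
      · intro h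
        rw [clamp_of_le hM h]
        exact (hsign t x (-M) _ ht.1 h1).2 le_rfl)
  have hae : ∀ᵐ t ∂(volume.restrict (Ioo 0 T)), z t = (U t).toL2 := by
    filter_upwards [ae_restrict_mem measurableSet_Ioo] with t ht
    exact (hUz t (Ioo_subset_Icc_self ht)).symm
  refine ⟨U, hUc, ⟨fun s => v s + g s, hv.add hg, fun t ht => ?_⟩,
    ⟨(memLp_two_of_continuousOn hzc).ae_eq hae, v, hv, ?_⟩, hU₀, S, g, hSA, fun t ht =>
      hD.truncatedForcing_ae_eq hM hKc hK hUc hUz hU₀ ht (hbd t ht), hg, fun t ht => ?_⟩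
  · beta_reduce
    rw [hUz t ht, hUz 0 ⟨le_rfl, hT⟩]
    exact hvz t ht
  · filter_upwards [hvA', hae] with t h1 h2
    rwa [← h2]
  · exact (hUz t ht).trans (hz t ht)

end Reduction

end Data

end SellersEBM

end

open SellersEBM in
theorem mainTheorem1 (D : SellersEBM.Data) (hD : D.Admissible)
    (u₀ : ℝ → SellersEBM.V D.ρ₀)
    (hu₀ : ContinuousOn u₀ (Set.Icc (-D.τ) 0))
    (hu₀A : SellersEBM.InDomA D.ρ₀ (u₀ 0).toL2)
    (hu₀b : MeasureTheory.MemLp (u₀ 0).toL2 ⊤ SellersEBM.volI) :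
    ∀ T : ℝ, 0 < T →
      (∃ u : ℝ → SellersEBM.V D.ρ₀, D.IsMildSolution u₀ T u) ∧
      ∀ u v : ℝ → SellersEBM.V D.ρ₀, D.IsMildSolution u₀ T u → D.IsMildSolution u₀ T v →
        Set.EqOn u v (Set.Icc (-D.τ) T) := by
  intro T hT
  have hτ := hD.τ_pos.le
  have hρ := hD.ρ₀_pos
  obtain ⟨b, lam, E, hlam, hE, hEA⟩ := exists_eigenbasis hρ
  have hA := opA_iff_coeff hρ hE hEA
  obtain ⟨S, hS⟩ := exists_isDiagonalSemigroup (b := b) hlam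
  obtain ⟨Cq, hCq, hq⟩ := exists_ae_abs_le hD.q_mem
  obtain ⟨M₀, hM₀, hsign⟩ := hD.exists_reaction_sign hCq
  obtain ⟨M₁, -, hM₁⟩ := exists_ae_abs_le hu₀b
  obtain ⟨K, hKc, hK⟩ := exists_multiplication_operators hτ hD.k_contDiff.continuousOn
  -- beyond `M₀` the emission dominates, and `M₁` bounds `u₀(0)`
  have hM : 0 ≤ max M₀ M₁ := le_max_of_le_left hM₀
  have hsign' := fun t x y m ht hx => hsign t x y m (max M₀ M₁) ht hx (le_max_left _ _)
  have h0 := hM₁.mono fun x hx => hx.trans (le_max_right M₀ M₁)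
  obtain ⟨L, hL⟩ := hD.exists_isCausalLipschitz hM hKc (Data.continuous_past hτ hu₀) hT.le
  constructor
  · obtain ⟨v₀, hv₀⟩ := id hu₀A
    obtain ⟨z, hzc, hz⟩ := hL.exists_fixedPoint hS hlam hT.le
      (OpA.summable_mul_sq_coeff hlam hA hv₀)
    exact hD.exists_isMildSolution hT.le hu₀ hlam hE hEA hS hu₀A hM hq hsign' h0 hKc hK hzc hz
  · intro u v hu hv t ht
    rcases le_total t 0 with h | h
    · rw [hu.initial t ⟨ht.1, h⟩, hv.initial t ⟨ht.1, h⟩]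
    · have hcont : ∀ w : ℝ → V D.ρ₀, D.IsMildSolution u₀ T w →
          ContinuousOn (fun t => (w t).toL2) (Icc 0 T) := fun w hw =>
        (V.toL2CLM D.ρ₀).continuous.comp_continuousOn
          (hw.continuousOn.mono (Icc_subset_Icc_left (by linarith)))
      exact V.toL2_injective (hL.eqOn hS hlam (hcont u hu) (hcont v hv)
        (hu.eq_duhamelMap hD hT.le hlam hA hS hu₀A hM hq hsign' h0 hKc hK)
        (hv.eq_duhamelMap hD hT.le hlam hA hS hu₀A hM hq hsign' h0 hKc hK) ⟨h, ht.2⟩)
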